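/- Let $\mathcal T$ be a triangulation of an annulus $\mathcal A$ with boundary circles $E_1,E_2$, let $c(x,y)=c(y,x)>0$ be conductances on its edges, let $k>0$, and let $g$ be the solution of the discrete Dirichlet problem: $g=k$ at the vertices of $E_1$, $g=0$ at the vertices of $E_2$, and $\Delta g(x)=\sum_{y\sim x}c(x,y)(g(x)-g(y))=0$ at every interior vertex. Assume that the endpoints of every edge that is not a boundary edge have different $g$-values. Let a slit be an edge path from $E_1$ to $E_2$ along which $g$ is strictly decreasing, let $\mathcal Q$ be the triangulated quadrilateral obtained by cutting $\mathcal A$ open along the slit (split edges keep their conductances), let $\partial\mathcal Q_{\rm base}$ and $\partial\mathcal Q_{\rm top}$ be the two copies of the slit, in either order, and let $Q(E_1),Q(E_2)$ be the sides of $\mathcal Q$ over $E_1,E_2$. Put $$\mathrm{period}(g^*)=\sum_{u\in E_1}\frac{\partial g}{\partial n}(u)=\sum_{u\in E_1}\ \sum_{y\sim u,\ y\notin E_1}c(u,y)\,(g(u)-g(y)).$$ Let $h$ be a harmonic conjugate of $g$: a function on the vertices of $\mathcal Q$ with $h=\mathrm{period}(g^*)$ on $\partial\mathcal Q_{\rm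 top}$, $h=0$ on $\partial\mathcal Q_{\rm base}$, $\Delta h=0$ at the interior vertices of $\mathcal Q$, and $\frac{\partial h}{\partial n}=0$ at the vertices of $Q(E_1)$ and $Q(E_2)$ other than the four corners. Here the normal derivative may be taken in either of two senses, each with its non-degeneracy condition: (a) at a vertex $x$ of $Q(E_i)$, $\frac{\partial h}{\partial n}(x)=\sum c(x,y)(h(x)-h(y))$ over the neighbours $y\notin Q(E_i)$ of $x$ in $\mathcal Q$; in this case assume that $h$ is not constant on the vertex set of any triangle of $\mathcal Q$; (b) $\frac{\partial h}{\partial n}(x)=\sum c(x,y)(h(x)-h(y))$ over all the neighbours $y$ of $x$ in $\mathcal Q$; in this case assume that every edge of $\mathcal Q$ joining two vertices of $\partial\mathcal Q_{\rm base}$ is contained in $\partial\mathcal Q_{\rm base}$, and similarly for $\partial\mathcal Q_{\rm top}$. Extend $g$ and $h$ to $\mathcal Q$ affinely over the triangles, and let a level curve be a non-empty level set of such an extension. Then $\{g,h\}$ is a combinatorially orthogonal filling pair on $\mathcal Q$: both functions are non-negative, every level curve of $g$ meets every level curve of $h$ in exactly one point, and each of the two families of level curves is a non-singular foliation of $\mathcal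 Q$ by simple arcs. Hence the pair induces rectangular combinatorial nets: for any finite set $\mathcal L$ of level curves of $g$ that contain all the vertices of $\mathcal Q$, and any finite set $\mathcal M$ of level curves of $h$ that contain all the vertices of $\mathcal Q$, the union of the curves in $\mathcal L$ and $\mathcal M$ is the 1-skeleton of a decomposition of $\mathcal Q$ into finitely many closed topological quadrilaterals, any two of which are disjoint or meet exactly in one common vertex or one common side, such that in each quadrilateral one pair of opposite sides lies in level curves of $g$ and the other pair in level curves of $h$. -/

import Mathlib

open scoped unitInterval

noncomputable section

/-- A finite pure two-dimensional simplicial complex, given by its triangles. -/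
structure TriComplex (V : Type*) where
  triangles : Finset (Finset V)
  card_eq_three : ∀ t ∈ triangles, t.card = 3

namespace TriComplex

variable {V : Type*}

/-- The one-skeleton. -/
def graph (K : TriComplex V) : SimpleGraph V where
  Adj u v := u ≠ v ∧ ∃ t ∈ K.triangles, u ∈ t ∧ v ∈ t
  symm := ⟨fun _ _ h => ⟨h.1.symm, h.2.imp fun _ ht => ⟨ht.1, ht.2.2, ht.2.1⟩⟩⟩
  loopless := ⟨fun _ h => h.1 rfl⟩

/-- The set of triangles that contain both `u` and `v`. -/
def trianglesThrough (K : TriComplex V) (u v : V) : Set (Finset V) :=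
  {t | t ∈ K.triangles ∧ u ∈ t ∧ v ∈ t}

/-- The graph of boundary edges: the edges that lie in exactly one triangle. -/
def boundaryGraph (K : TriComplex V) : SimpleGraph V where
  Adj u v := K.graph.Adj u v ∧ (K.trianglesThrough u v).ncard = 1
  symm := ⟨fun u v h => ⟨h.1.symm, by
    have : K.trianglesThrough v u = K.trianglesThrough u v := by
      ext t; exact ⟨fun h => ⟨h.1, h.2.2, h.2.1⟩, fun h => ⟨h.1, h.2.2, h.2.1⟩⟩
    rw [this]; exact h.2⟩⟩
  loopless := ⟨fun _ h => h.1.1 rfl⟩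

/-- `K` is a connected compact surface with boundary: every edge lies in at most two triangles,
and the triangles around a vertex are connected through edges at that vertex (so that each link
is a path or a cycle). -/
structure IsConnectedSurface (K : TriComplex V) : Prop where
  mem_triangle : ∀ v : V, ∃ t ∈ K.triangles, v ∈ t
  edge_le_two : ∀ u v : V, K.graph.Adj u v → (K.trianglesThrough u v).ncard ≤ 2
  link_connected : ∀ v : V, ∀ t ∈ K.triangles, ∀ t' ∈ K.triangles, v ∈ t → v ∈ t' →
    Relation.ReflTransGen
      (fun a b => a ∈ K.triangles ∧ b ∈ K.triangles ∧ v ∈ a ∧ v ∈ b ∧ ∃ w, w ≠ v ∧ w ∈ a ∧ w ∈ b)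
      t t'
  connected : K.graph.Connected

/-- `K` triangulates an annulus whose two boundary circles have vertex sets `E₁` and `E₂`.
By the classification of surfaces, a connected compact surface with exactly two boundary
components and Euler characteristic zero is an annulus, and conversely. -/
structure IsAnnulus (K : TriComplex V) (E₁ E₂ : Set V) : Prop where
  surface : K.IsConnectedSurface
  euler : (Nat.card V : ℤ) - (K.graph.edgeSet.ncard : ℤ) + (K.triangles.card : ℤ) = 0
  nonempty₁ : E₁.Nonempty
  nonempty₂ : E₂.Nonempty
  disjoint : Disjoint E₁ E₂
  boundary : ∀ v, (∃ w, K.boundaryGraph.Adj v w) ↔ v ∈ E₁ ∪ E₂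
  component₁ : ∀ u ∈ E₁, ∀ v, K.boundaryGraph.Reachable u v ↔ v ∈ E₁
  component₂ : ∀ u ∈ E₂, ∀ v, K.boundaryGraph.Reachable u v ↔ v ∈ E₂

/-! ### Networks and boundary value problems -/

/-- A conductance function on the one-skeleton: symmetric and positive on edges. -/
def IsConductance (K : TriComplex V) (c : V → V → ℝ) : Prop :=
  ∀ x y, K.graph.Adj x y → c x y = c y x ∧ 0 < c x y

open Classical in
/-- The normal derivative of `u` at `x` with respect to `F`:
the sum of `c(x,y) (u(x) - u(y))` over the neighbours `y` of `x` in `F`. -/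
def normalDeriv [Fintype V] (K : TriComplex V) (c : V → V → ℝ) (F : Set V) (u : V → ℝ) (x : V) :
    ℝ :=
  ∑ y with K.graph.Adj x y ∧ y ∈ F, c x y * (u x - u y)

open Classical in
/-- The discrete Laplacian. -/
def laplacian [Fintype V] (K : TriComplex V) (c : V → V → ℝ) (u : V → ℝ) (x : V) : ℝ :=
  ∑ y with K.graph.Adj x y, c x y * (u x - u y)

/-- `g` solves the discrete Dirichlet problem with value `k` on `E₁` and `0` on `E₂`. -/
structure IsDirichletSolution [Fintype V] (K : TriComplex V) (c : V → V → ℝ) (E₁ E₂ : Set V)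
    (k : ℝ) (g : V → ℝ) : Prop where
  eq_on₁ : ∀ v ∈ E₁, g v = k
  eq_on₂ : ∀ v ∈ E₂, g v = 0
  harmonic : ∀ v, v ∉ E₁ → v ∉ E₂ → K.laplacian c g v = 0

open Classical in
/-- The period of the conjugate function of `g`: the integral over `E₁` of the normal derivative
of `g` (with respect to the remaining vertices). -/
def period [Fintype V] (K : TriComplex V) (c : V → V → ℝ) (E₁ : Set V) (g : V → ℝ) : ℝ :=
  ∑ v with v ∈ E₁, K.normalDeriv c E₁ᶜ g v

/-- `h` solves the discrete Dirichlet-Neumann problem with value `0` on `B`, value `P` on `T`,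
with vanishing normal derivative with respect to `Fᵢ` at the vertices of `Nᵢ` outside `B ∪ T`
(`i = 1, 2`), and with `h` harmonic at all the remaining vertices. -/
structure IsDirichletNeumannSolution [Fintype V] (K : TriComplex V) (c : V → V → ℝ)
    (B T N₁ N₂ F₁ F₂ : Set V) (P : ℝ) (h : V → ℝ) : Prop where
  eq_on_base : ∀ v ∈ B, h v = 0
  eq_on_top : ∀ v ∈ T, h v = P
  neumann₁ : ∀ v ∈ N₁, v ∉ B ∪ T → K.normalDeriv c F₁ h v = 0
  neumann₂ : ∀ v ∈ N₂, v ∉ B ∪ T → K.normalDeriv c F₂ h v = 0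
  harmonic : ∀ v, v ∉ B ∪ T ∪ N₁ ∪ N₂ → K.laplacian c h v = 0

/-! ### The polyhedron, affine extensions and level curves -/

/-- The polyhedron `|K|`, in barycentric coordinates. -/
def realization [Fintype V] (K : TriComplex V) : Set (V → ℝ) :=
  {x | (∀ v, 0 ≤ x v) ∧ ∑ v, x v = 1 ∧ ∃ t ∈ K.triangles, ∀ v, v ∉ t → x v = 0}

/-- The extension of a function on the vertices which is affine on every triangle. -/
def affineExtension [Fintype V] (f : V → ℝ) (x : V → ℝ) : ℝ := ∑ v, x v * f v

/-- The level set of the affine extension of `f` over `|K|` at the value `a`. -/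
def levelCurve [Fintype V] (K : TriComplex V) (f : V → ℝ) (a : ℝ) : Set (V → ℝ) :=
  {x | x ∈ K.realization ∧ affineExtension f x = a}

/-- The level curves of (the affine extension of) `f` form a non-singular foliation of `|K|`, a
surface with boundary and corners: the non-empty level curves are simple arcs, and every point
has an open neighbourhood with a homeomorphism onto a product of two intervals that takes the
traces of the level curves to the segments `{s} × J`. (The intervals may contain endpoints, which
accounts for boundary points and corners.) -/
def IsNonsingularFoliation [Fintype V] (K : TriComplex V) (f : V → ℝ) : Prop :=
  (∀ a, (K.levelCurve f a).Nonempty → Nonempty (K.levelCurve f a ≃ₜ I)) ∧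
  ∀ x : K.realization, ∃ U : Set K.realization, IsOpen U ∧ x ∈ U ∧
    ∃ S J : Set ℝ, S.OrdConnected ∧ S.Nontrivial ∧ J.OrdConnected ∧ J.Nontrivial ∧
      ∃ φ : U ≃ₜ S × J, ∀ y z : U,
        affineExtension f y.1.1 = affineExtension f z.1.1 ↔ (φ y).1 = (φ z).1

/-- Combinatorially orthogonal filling pairs of functions on the vertices. -/
structure IsCombinatoriallyOrthogonalFilling [Fintype V] (K : TriComplex V) (φ ψ : V → ℝ) :
    Prop where
  nonneg_left : ∀ v, 0 ≤ φ v
  nonneg_right : ∀ v, 0 ≤ ψ v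
  inter_eq_one : ∀ α β, (K.levelCurve φ α).Nonempty → (K.levelCurve ψ β).Nonempty →
    (K.levelCurve φ α ∩ K.levelCurve ψ β).ncard = 1
  foliation_left : K.IsNonsingularFoliation φ
  foliation_right : K.IsNonsingularFoliation ψ

/-! ### Rectangular nets -/

/-- The four sides of the unit square. -/
def squareSides : Set (Set (I × I)) :=
  {{p | p.1 = 0}, {p | p.1 = 1}, {p | p.2 = 0}, {p | p.2 = 1}}

/-- The four corners of the unit square. -/
def squareCorners : Set (I × I) := {(0, 0), (0, 1), (1, 0), (1, 1)}

/-- The embedded closed quadrilaterals `ρ i` are the two-cells of a rectangular combinatorial net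
of `|K|` for the pair `φ, ψ`: they cover `|K|`; two of them are disjoint or meet exactly in a
common vertex or a common side; and in each of them one pair of opposite sides lies in level
curves of `φ` and the other pair in level curves of `ψ`. -/
structure IsRectangularNet [Fintype V] (K : TriComplex V) (φ ψ : V → ℝ) {N : ℕ}
    (ρ : Fin N → I × I → (V → ℝ)) : Prop where
  continuous : ∀ i, Continuous (ρ i)
  injective : ∀ i, Function.Injective (ρ i)
  cover : ⋃ i, Set.range (ρ i) = K.realization
  inter : ∀ i j, i ≠ j →
    Set.range (ρ i) ∩ Set.range (ρ j) = ∅ ∨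
    (∃ p ∈ squareCorners, ∃ q ∈ squareCorners,
      Set.range (ρ i) ∩ Set.range (ρ j) = {ρ i p} ∧ ρ i p = ρ j q) ∨
    (∃ s ∈ squareSides, ∃ s' ∈ squareSides,
      Set.range (ρ i) ∩ Set.range (ρ j) = ρ i '' s ∧ ρ i '' s = ρ j '' s')
  sides_left : ∀ i, ∀ e : I, e = 0 ∨ e = 1 → ∃ a, ∀ t : I, ρ i (e, t) ∈ K.levelCurve φ a
  sides_right : ∀ i, ∀ e : I, e = 0 ∨ e = 1 → ∃ b, ∀ t : I, ρ i (t, e) ∈ K.levelCurve ψ b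

/-- The one-skeleton of a net: the union of all sides of its cells. -/
def netSkeleton {N : ℕ} (ρ : Fin N → I × I → (V → ℝ)) : Set (V → ℝ) :=
  ⋃ i, ⋃ s ∈ squareSides, ρ i '' s

/-- The pair `φ, ψ` induces rectangular combinatorial nets: given finitely many level
curves of `φ` (at the values in `A`) that contain all the vertices, and finitely many level curves
of `ψ` (at the values in `B`) that contain all the vertices, the union of all these level curves is
the one-skeleton of a rectangular net. -/
def InducesRectangularNets [Fintype V] (K : TriComplex V) (φ ψ : V → ℝ) : Prop :=
  ∀ A B : Finset ℝ,
    (∀ a ∈ A, (K.levelCurve φ a).Nonempty) → (∀ b ∈ B, (K.levelCurve ψ b).Nonempty) →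
    (∀ v, φ v ∈ A) → (∀ v, ψ v ∈ B) →
    ∃ (N : ℕ) (ρ : Fin N → I × I → (V → ℝ)), K.IsRectangularNet φ ψ ρ ∧
      netSkeleton ρ = (⋃ a ∈ A, K.levelCurve φ a) ∪ ⋃ b ∈ B, K.levelCurve ψ b

/-! ### Slits and cutting open -/

/-- `γ` is a slit for `g`: an edge path from `E₁` to `E₂` along which `g` decreases (in particular
the path is simple). -/
structure IsSlit (K : TriComplex V) (E₁ E₂ : Set V) (g : V → ℝ) {n : ℕ} (γ : Fin (n + 1) → V) :
    Prop where
  start_mem : γ 0 ∈ E₁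
  end_mem : γ (Fin.last n) ∈ E₂
  adj : ∀ i : Fin n, K.graph.Adj (γ i.castSucc) (γ i.succ)
  decreasing : StrictAnti fun i => g (γ i)

/-- `{v, w}` is an edge of the path `γ`. -/
def IsPathEdge {n : ℕ} (γ : Fin (n + 1) → V) (v w : V) : Prop :=
  ∃ i : Fin n, (v = γ i.castSucc ∧ w = γ i.succ) ∨ (w = γ i.castSucc ∧ v = γ i.succ)

/-- A corner of `K`: a triangle with one of its vertices. -/
abbrev Corner (K : TriComplex V) : Type _ := {p : V × Finset V // p.2 ∈ K.triangles ∧ p.1 ∈ p.2}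

/-- Two corners at the same vertex `v` whose triangles share an edge `{v, w}` that is not cut. -/
def CornerRel (K : TriComplex V) {n : ℕ} (γ : Fin (n + 1) → V) (p q : K.Corner) : Prop :=
  p.1.1 = q.1.1 ∧ ∃ w, w ≠ p.1.1 ∧ w ∈ p.1.2 ∧ w ∈ q.1.2 ∧ ¬ IsPathEdge γ p.1.1 w

/-- The vertices of the complex obtained by cutting `K` open along `γ`: the corners of `K`, where
neighbouring corners are identified unless they are separated by an edge of `γ`. -/
def CutVertex (K : TriComplex V) {n : ℕ} (γ : Fin (n + 1) → V) : Type _ := Quot (K.CornerRel γ)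

instance [Finite V] (K : TriComplex V) {n : ℕ} (γ : Fin (n + 1) → V) : Finite (K.CutVertex γ) :=
  inferInstanceAs (Finite (Quot (K.CornerRel γ)))

instance [Fintype V] (K : TriComplex V) {n : ℕ} (γ : Fin (n + 1) → V) :
    Fintype (K.CutVertex γ) :=
  Fintype.ofFinite _

/-- The vertex of the cut surface at a corner. -/
def cutMk (K : TriComplex V) {n : ℕ} (γ : Fin (n + 1) → V) (p : K.Corner) : K.CutVertex γ :=
  Quot.mk _ p

/-- The projection that glues the cut surface back together. -/
def proj (K : TriComplex V) {n : ℕ} (γ : Fin (n + 1) → V) : K.CutVertex γ → V :=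
  Quot.lift (fun p => p.1.1) fun _ _ h => h.1

open Classical in
/-- The triangle of the cut surface that lies over the triangle `t`. -/
def cutTriangle (K : TriComplex V) {n : ℕ} (γ : Fin (n + 1) → V) (t : {t // t ∈ K.triangles}) :
    Finset (K.CutVertex γ) :=
  t.1.attach.image fun v => K.cutMk γ ⟨(v.1, t.1), t.2, v.2⟩

open Classical in
/-- The complex obtained by cutting `K` open along `γ`. -/
def cut (K : TriComplex V) {n : ℕ} (γ : Fin (n + 1) → V) : TriComplex (K.CutVertex γ) where
  triangles := K.triangles.attach.image (K.cutTriangle γ)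
  card_eq_three := by
    intro t ht
    obtain ⟨s, -, rfl⟩ := Finset.mem_image.1 ht
    rw [cutTriangle, Finset.card_image_of_injective, Finset.card_attach]
    · exact K.card_eq_three _ s.2
    · intro v w h
      exact Subtype.ext (congrArg (K.proj γ) h)

/-- The conductances of the cut surface are those of `K`. -/
def cutConductance (K : TriComplex V) {n : ℕ} (γ : Fin (n + 1) → V) (c : V → V → ℝ) :
    K.CutVertex γ → K.CutVertex γ → ℝ :=
  fun x y => c (K.proj γ x) (K.proj γ y)

/-- `base` and `top` are the two copies of `γ` in the boundary of the cut surface: two disjoint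
edge paths over `γ`. -/
structure AreCutSides (K : TriComplex V) {n : ℕ} (γ : Fin (n + 1) → V)
    (base top : Fin (n + 1) → K.CutVertex γ) : Prop where
  proj_base : ∀ i, K.proj γ (base i) = γ i
  proj_top : ∀ i, K.proj γ (top i) = γ i
  adj_base : ∀ i : Fin n, (K.cut γ).graph.Adj (base i.castSucc) (base i.succ)
  adj_top : ∀ i : Fin n, (K.cut γ).graph.Adj (top i.castSucc) (top i.succ)
  ne : ∀ i, base i ≠ top i

/-- Every edge that joins two vertices of the path `β` is an edge of `β`. -/
def IsChordless (K : TriComplex V) {n : ℕ} (β : Fin (n + 1) → V) : Prop :=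
  ∀ i j, K.graph.Adj (β i) (β j) → IsPathEdge β (β i) (β j)

/-- `h` is a harmonic conjugate of `g` on the surface cut open along `γ`: it is `0` on `base`, the
period of the conjugate function of `g` on `top`, and harmonic at interior vertices, and its
normal derivative with respect to `F₁`, `F₂` vanishes at the vertices over `E₁`, `E₂` other than
the four corners. -/
def IsHarmonicConjugate [Fintype V] (K : TriComplex V) {n : ℕ} (γ : Fin (n + 1) → V)
    (c : V → V → ℝ) (E₁ E₂ : Set V) (g : V → ℝ) (base top : Fin (n + 1) → K.CutVertex γ)
    (F₁ F₂ : Set (K.CutVertex γ)) (h : K.CutVertex γ → ℝ) : Prop :=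
  (K.cut γ).IsDirichletNeumannSolution (K.cutConductance γ c) (Set.range base) (Set.range top)
    (K.proj γ ⁻¹' E₁) (K.proj γ ⁻¹' E₂) F₁ F₂ (K.period c E₁ g) h

end TriComplex

end

/-!
The cut surface `Q` is mapped to the plane by the affine extension of the pair `(g, h)`. This map is
a homeomorphism onto the rectangle `[0, k] × [0, P]`, where `P` is the period
(`IsFoldFree.exists_homeomorph`); the level curves of `g` and `h` are the preimages of the vertical
and of the horizontal segments, so the foliations and the nets are those of a rectangle
(`isNonsingularFoliation_of_homeomorph`, `IsFoldFree.inducesRectangularNets`).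

The reason is an index count in the style of Morse theory. For a function `f` on the vertices that
takes different values at adjacent vertices, count at each vertex `x` the sign changes of `f - f x`
along the link of `x`. Every triangle has exactly one middle vertex, so the sum of these numbers is
the number of triangles. By Euler's formula, the latter is too small by two for one sign change at
each boundary vertex and two at each interior vertex. Since these are the least numbers possible at
a vertex that is not a local extremum, a function whose only local extrema are two boundary vertices
has no saddles (`IsDiskLike.linkCut_eq_of_injective`). In particular, if `f` takes the same value at
the ends of an edge, and ties are broken without producing further extrema, then the two triangles
at this edge lie on different sides of the level of the edge (`IsDiskLike.exists_triangles`).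

This is applied to `h - a g` for all slopes `a`. These functions are harmonic at the interior
vertices, and elsewhere the boundary conditions leave only two opposite corners as extrema. They
may, however, have flat vertices, where the function agrees with its values at all neighbours.
`IsDiskLike.eq_empty_of_flat` excludes them: an auxiliary solution of a Dirichlet problem on the set
of flat vertices, which is a perturbation of either sign, together with `g`, would yield four sets
of neighbours of one vertex that all have the same cut number in its link, against the strict
submodularity of cut functions. In the first place one needs that `h` itself lies strictly between
`0` and `P` off the two sides of the slit and is monotone along the other two sides
(`IsGradedRectangle.isStrictHeight_of_compl`, `IsGradedRectangle.isStrictHeight_of_univ`); this is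
where the two versions of the Neumann condition and their non-degeneracy conditions enter.

Hence no triangle degenerates and no edge is a fold (`IsGradedRectangle.isFoldFree`). On a vertical
line, every crossing edge but the lowest is then the upper side of exactly one triangle, and every
one but the highest is the lower side of exactly one triangle. So each point of the rectangle is
covered once (`IsFoldFree.existsUnique_flag`), and `(g, h)` is bijective.

It remains to see that the cut surface is a rectangle in the sense required
(`IsAnnulus.isGradedRectangle_cut`): its corners are identified along uncut edges only, so a vertex
of the slit has exactly two copies, all other vertices have one, and the splitting of the two ends
of the slit raises the Euler characteristic from zero to one.
-/


noncomputable section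

namespace TriComplex

/-! ### Sign changes in links -/

section Counting

variable {W : Type*}

open Classical in
/-- The number of triangles that contain both `x` and `y`. -/
def edgeDegree (Q : TriComplex W) (x y : W) : ℕ := (Q.triangles.filter fun t => x ∈ t ∧ y ∈ t).card

/-- The edge of `t` opposite to its vertex `x` joins a vertex in `s` to a vertex outside `s`. -/
def Separates (x : W) (s : Set W) (t : Finset W) : Prop :=
  x ∈ t ∧ (∃ y ∈ t, y ≠ x ∧ y ∈ s) ∧ ∃ z ∈ t, z ≠ x ∧ z ∉ s

open Classical in
/-- The number of edges of the link of `x` that join a vertex in `s` to a vertex outside `s`; an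
edge of the link is encoded by the triangle that it spans together with `x`. -/
def linkCut (Q : TriComplex W) (x : W) (s : Set W) : ℕ :=
  (Q.triangles.filter (Separates x s)).card

/-- `f` takes both a smaller and a larger value at the neighbours of `x`. -/
def Mixed {α : Type*} [LT α] (Q : TriComplex W) (f : W → α) (x : W) : Prop :=
  (∃ y, Q.graph.Adj x y ∧ f y < f x) ∧ ∃ y, Q.graph.Adj x y ∧ f x < f y

/-- `x` is an endpoint of a boundary edge. -/
def IsBoundaryVertex (Q : TriComplex W) (x : W) : Prop := ∃ y, Q.boundaryGraph.Adj x y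

open Classical in
/-- The number of sign changes expected in the link of `x`: the link of an interior vertex is a
cycle, that of a boundary vertex is a path. -/
def expectedCut (Q : TriComplex W) (x : W) : ℕ := if Q.IsBoundaryVertex x then 1 else 2

/-- A surface whose Euler characteristic is at least one, expressed through the number of
triangles. -/
structure IsDiskLike [Fintype W] (Q : TriComplex W) : Prop where
  edge_le_two : ∀ u v : W, Q.graph.Adj u v → Q.edgeDegree u v ≤ 2
  link_connected : ∀ v : W, ∀ t ∈ Q.triangles, ∀ t' ∈ Q.triangles, v ∈ t → v ∈ t' →
    Relation.ReflTransGen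
      (fun a b => a ∈ Q.triangles ∧ b ∈ Q.triangles ∧ v ∈ a ∧ v ∈ b ∧ ∃ w, w ≠ v ∧ w ∈ a ∧ w ∈ b)
      t t'
  card_add_two_le : Q.triangles.card + 2 ≤ ∑ x, Q.expectedCut x

variable {Q : TriComplex W}

lemma ncard_trianglesThrough (x y : W) : (Q.trianglesThrough x y).ncard = Q.edgeDegree x y := by
  classical
  rw [edgeDegree, ← Set.ncard_coe_finset]
  congr 1
  ext t
  simp [trianglesThrough]

lemma boundaryGraph_adj_iff {x y : W} :
    Q.boundaryGraph.Adj x y ↔ Q.graph.Adj x y ∧ Q.edgeDegree x y = 1 := by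
  rw [← ncard_trianglesThrough]; rfl

lemma adj_of_mem {t : Finset W} (ht : t ∈ Q.triangles) {x y : W} (hx : x ∈ t) (hy : y ∈ t)
    (h : x ≠ y) : Q.graph.Adj x y := ⟨h, t, ht, hx, hy⟩

open Classical in
lemma eq_triple_of_mem {t : Finset W} (ht : t ∈ Q.triangles) {x y : W} (hx : x ∈ t) (hy : y ∈ t)
    (h : x ≠ y) : ∃ z, z ≠ x ∧ z ≠ y ∧ t = {x, y, z} := by
  have h3 := Q.card_eq_three t ht
  have hsub : ({x, y} : Finset W) ⊆ t := by
    intro a; simp only [Finset.mem_insert, Finset.mem_singleton]; rintro (rfl | rfl) <;> assumption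
  have hc : (t \ {x, y}).card = 1 := by
    rw [Finset.card_sdiff_of_subset hsub, h3, Finset.card_pair h]
  obtain ⟨z, hz⟩ := Finset.card_eq_one.1 hc
  have hzm : z ∈ t \ {x, y} := by rw [hz]; simp
  simp only [Finset.mem_sdiff, Finset.mem_insert, Finset.mem_singleton, not_or] at hzm
  refine ⟨z, hzm.2.1, hzm.2.2, ?_⟩
  rw [← Finset.sdiff_union_of_subset hsub, hz]
  ext a; simp only [Finset.mem_union, Finset.mem_insert, Finset.mem_singleton]; tauto

open Classical in
lemma eq_triple {t : Finset W} (ht : t ∈ Q.triangles) {x : W} (hx : x ∈ t) :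
    ∃ y z, y ≠ x ∧ z ≠ x ∧ y ≠ z ∧ t = {x, y, z} := by
  have h3 := Q.card_eq_three t ht
  obtain ⟨y, hy, hyx⟩ := Finset.exists_mem_ne (by omega : 1 < t.card) x
  obtain ⟨z, h1, h2, h3⟩ := eq_triple_of_mem ht hx hy hyx.symm
  exact ⟨y, z, hyx, h1, h2.symm, h3⟩

lemma edgeDegree_pos {x y : W} (h : Q.graph.Adj x y) : 0 < Q.edgeDegree x y := by
  classical
  obtain ⟨-, t, ht, hx, hy⟩ := h
  exact Finset.card_pos.2 ⟨t, by simp [ht, hx, hy]⟩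

lemma IsDiskLike.edgeDegree_eq_two [Fintype W] (hQ : Q.IsDiskLike) {x y : W}
    (h : Q.graph.Adj x y) (hb : ¬ Q.boundaryGraph.Adj x y) : Q.edgeDegree x y = 2 := by
  have := hQ.edge_le_two x y h
  have := edgeDegree_pos h
  rw [boundaryGraph_adj_iff] at hb
  have : Q.edgeDegree x y ≠ 1 := fun h' => hb ⟨h, h'⟩
  omega

/-- The link of a vertex is connected: a set which contains, with a vertex of the link, also all
its neighbours in the link contains the whole link. -/
lemma IsDiskLike.mem_of_link_closed [Fintype W] (hQ : Q.IsDiskLike) {x : W} {s : Set W}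
    (hs : ∀ t ∈ Q.triangles, x ∈ t → ∀ y ∈ t, ∀ z ∈ t, y ≠ x → z ≠ x → y ∈ s → z ∈ s)
    {y z : W} (hy : Q.graph.Adj x y) (hz : Q.graph.Adj x z) (hys : y ∈ s) : z ∈ s := by
  obtain ⟨hxy, t, ht, hxt, hyt⟩ := hy
  obtain ⟨hxz, t', ht', hxt', hzt'⟩ := hz
  have key : ∀ u, u ∈ Q.triangles → x ∈ u → Relation.ReflTransGen
      (fun a b => a ∈ Q.triangles ∧ b ∈ Q.triangles ∧ x ∈ a ∧ x ∈ b ∧ ∃ w, w ≠ x ∧ w ∈ a ∧ w ∈ b)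
      t u → ∀ v ∈ u, v ≠ x → v ∈ s := by
    intro u hu hxu hr
    clear hu hxu
    induction hr with
    | refl => intro v hv hvx; exact hs t ht hxt y hyt v hv hxy.symm hvx hys
    | tail _ hab ih =>
      obtain ⟨-, hb, -, hxb, w, hwx, hwa, hwb⟩ := hab
      intro v hv hvx
      exact hs _ hb hxb w hwb v hv hwx hvx (ih w hwa hwx)
  exact key t' ht' hxt' (hQ.link_connected x t ht t' ht' hxt hxt') z hzt' hxz.symm

lemma IsDiskLike.linkCut_pos [Fintype W] (hQ : Q.IsDiskLike) {x y z : W} {s : Set W}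
    (hy : Q.graph.Adj x y) (hz : Q.graph.Adj x z) (hys : y ∈ s) (hzs : z ∉ s) :
    0 < Q.linkCut x s := by
  classical
  by_contra h0
  have h0 : Q.linkCut x s = 0 := by omega
  rw [linkCut, Finset.card_eq_zero, Finset.filter_eq_empty_iff] at h0
  refine hzs (hQ.mem_of_link_closed (s := s) ?_ hy hz hys)
  intro t ht hxt a ha b hb hax hbx has
  by_contra hbs
  exact h0 ht ⟨hxt, ⟨a, ha, hax, has⟩, b, hb, hbx, hbs⟩

/-- Handshake lemma in the link of `x`. -/
lemma IsDiskLike.linkCut_mod_two [Fintype W] (hQ : Q.IsDiskLike) (x : W) (s : Set W) :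
    Q.linkCut x s % 2 = {y | Q.boundaryGraph.Adj x y ∧ y ∈ s}.ncard % 2 := by
  classical
  have h0 : {y | Q.boundaryGraph.Adj x y ∧ y ∈ s}.ncard =
      (Finset.univ.filter fun y => Q.boundaryGraph.Adj x y ∧ y ∈ s).card := by
    rw [← Set.ncard_coe_finset]; simp
  rw [h0]
  have h1 : ∑ y with Q.graph.Adj x y ∧ y ∈ s, Q.edgeDegree x y
      = ∑ t ∈ Q.triangles.filter (x ∈ ·), (t.filter fun y => y ≠ x ∧ y ∈ s).card := by
    simp only [edgeDegree, Finset.card_filter]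
    rw [Finset.sum_comm, Finset.sum_filter]
    refine Finset.sum_congr rfl fun t ht => ?_
    by_cases hxt : x ∈ t
    · simp only [hxt, true_and, if_true]
      rw [← Finset.card_filter, ← Finset.card_filter, Finset.filter_filter]
      congr 1
      ext y
      simp only [Finset.mem_filter, Finset.mem_univ, true_and]
      constructor
      · rintro ⟨⟨h, h'⟩, hy⟩; exact ⟨hy, h.1.symm, h'⟩
      · rintro ⟨hy, h, h'⟩; exact ⟨⟨adj_of_mem ht hxt hy h.symm, h'⟩, hy⟩
    · simp [hxt]
  have h2 : (∑ y with Q.graph.Adj x y ∧ y ∈ s, Q.edgeDegree x y) % 2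
      = (Finset.univ.filter fun y => Q.boundaryGraph.Adj x y ∧ y ∈ s).card % 2 := by
    rw [Finset.card_filter, Finset.sum_filter, Finset.sum_nat_mod,
      Finset.sum_nat_mod (s := Finset.univ) (f := fun y => if Q.boundaryGraph.Adj x y
        ∧ y ∈ s then 1 else 0)]
    congr 1
    refine Finset.sum_congr rfl fun y _ => ?_
    by_cases hy : Q.graph.Adj x y
    · by_cases hb : Q.boundaryGraph.Adj x y
      · have := (boundaryGraph_adj_iff.1 hb).2
        simp [hy, hb, this]
      · have := hQ.edgeDegree_eq_two hy hb
        by_cases hys : y ∈ s <;> simp [hy, hb, this, hys]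
    · have hb : ¬ Q.boundaryGraph.Adj x y := fun h => hy h.1
      simp [hy, hb]
  rw [← h2, h1, linkCut, Finset.card_filter, Finset.sum_nat_mod, Finset.sum_filter,
    Finset.sum_nat_mod (s := Q.triangles)
      (f := fun t => if x ∈ t then (t.filter fun y => y ≠ x ∧ y ∈ s).card else 0)]
  congr 1
  refine Finset.sum_congr rfl fun t ht => ?_
  by_cases hxt : x ∈ t
  · obtain ⟨y, z, hyx, hzx, hyz, rfl⟩ := eq_triple ht hxt
    by_cases hys : y ∈ s <;> by_cases hzs : z ∈ s <;>
      simp [Separates, hyx, hzx, hyz, hys, hzs, Finset.filter_insert, Finset.filter_singleton]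
  · simp [Separates, hxt]

/-- Every vertex lies on an even number of boundary edges. -/
lemma IsDiskLike.even_ncard_boundary [Fintype W] (hQ : Q.IsDiskLike) (x : W) :
    Even {y | Q.boundaryGraph.Adj x y}.ncard := by
  have h := hQ.linkCut_mod_two x Set.univ
  have h0 : Q.linkCut x Set.univ = 0 := by
    simp [linkCut, Separates]
  rw [h0] at h
  simp only [Set.mem_univ, and_true] at h
  rw [Nat.even_iff]; omega

lemma linkCut_congr {x : W} {s s' : Set W} (h : ∀ y, Q.graph.Adj x y → (y ∈ s ↔ y ∈ s')) :
    Q.linkCut x s = Q.linkCut x s' := by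
  classical
  unfold linkCut
  congr 1
  refine Finset.filter_congr fun t ht => ?_
  refine and_congr_right fun hxt => and_congr ?_ ?_
  · refine exists_congr fun y => and_congr_right fun hy => and_congr_right fun hyx => ?_
    exact h y (adj_of_mem ht hxt hy hyx.symm)
  · refine exists_congr fun y => and_congr_right fun hy => and_congr_right fun hyx => ?_
    exact not_congr (h y (adj_of_mem ht hxt hy hyx.symm))

lemma linkCut_compl (x : W) (s : Set W) : Q.linkCut x sᶜ = Q.linkCut x s := by
  classical
  unfold linkCut
  congr 1
  refine Finset.filter_congr fun t ht => ?_
  simp only [Separates, Set.mem_compl_iff, not_not]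
  tauto

/-- Moving `y` into `s` increases the cut if no neighbour of `y` in the link lies in `s`. -/
lemma linkCut_lt_insert {x y : W} {s : Set W} (hxy : Q.graph.Adj x y) (hy : y ∉ s)
    (h : ∀ t ∈ Q.triangles, x ∈ t → y ∈ t → ∀ z ∈ t, z ≠ x → z ≠ y → z ∉ s) :
    Q.linkCut x s < Q.linkCut x (insert y s) := by
  classical
  refine Finset.card_lt_card (Finset.ssubset_iff_subset_ne.2 ⟨?_, ?_⟩)
  · intro t ht
    simp only [Finset.mem_filter] at ht ⊢
    obtain ⟨ht, hxt, ⟨a, ha, hax, has⟩, b, hb, hbx, hbs⟩ := ht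
    have hay : a ≠ y := fun e => hy (e ▸ has)
    refine ⟨ht, hxt, ⟨a, ha, hax, Or.inr has⟩, b, hb, hbx, ?_⟩
    rintro (rfl | h')
    · exact h t ht hxt hb a ha hax hay has
    · exact hbs h'
  · obtain ⟨hne, t, ht, hxt, hyt⟩ := hxy
    intro he
    obtain ⟨z, hzx, hzy, rfl⟩ := eq_triple_of_mem ht hxt hyt hne
    have hz := h _ ht hxt hyt z (by simp) hzx hzy
    have : ({x, y, z} : Finset W) ∈ Q.triangles.filter (Separates x (insert y s)) := by
      simp only [Finset.mem_filter]
      exact ⟨ht, hxt, ⟨y, hyt, hne.symm, Or.inl rfl⟩, z, by simp, hzx, by simp [hzy, hz]⟩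
    rw [← he] at this
    simp only [Separates, Finset.mem_filter, Finset.mem_insert, Finset.mem_singleton] at this
    obtain ⟨-, -, ⟨a, (rfl | rfl | rfl), hax, has⟩, -⟩ := this
    · exact hax rfl
    · exact hy has
    · exact hz has

/-- Cut functions are submodular, strictly so if an edge joins the two differences. -/
lemma linkCut_submodular {x a b : W} {s s' : Set W} (ha : a ∈ s) (ha' : a ∉ s') (hb : b ∈ s')
    (hb' : b ∉ s) {t : Finset W} (ht : t ∈ Q.triangles) (hx : x ∈ t) (hat : a ∈ t) (hbt : b ∈ t)
    (hax : a ≠ x) (hbx : b ≠ x) :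
    Q.linkCut x (s ∩ s') + Q.linkCut x (s ∪ s') < Q.linkCut x s + Q.linkCut x s' := by
  classical
  simp only [linkCut, Finset.card_filter, ← Finset.sum_add_distrib]
  have key : ∀ u ∈ Q.triangles, x ∈ u → ∃ y z, (∀ r : Set W,
      Separates x r u ↔ (y ∈ r ↔ ¬ z ∈ r)) ∧
      ∀ c ∈ u, c ≠ x → c = y ∨ c = z := by
    intro u hu hxu
    obtain ⟨y, z, hyx, hzx, hyz, rfl⟩ := eq_triple hu hxu
    refine ⟨y, z, fun r => ?_, ?_⟩
    · simp only [Separates, Finset.mem_insert, Finset.mem_singleton, exists_eq_or_imp,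
        exists_eq_left, ne_eq, true_or, not_true_eq_false, false_and, false_or, hyx, hzx,
          not_false_eq_true, true_and]
      tauto
    · simp only [Finset.mem_insert, Finset.mem_singleton]; tauto
  refine Finset.sum_lt_sum ?_ ⟨t, ht, ?_⟩
  · intro u hu
    by_cases hxu : x ∈ u
    · obtain ⟨y, z, hyz, -⟩ := key u hu hxu
      simp only [hyz, Set.mem_inter_iff, Set.mem_union]
      by_cases h1 : y ∈ s <;> by_cases h2 : y ∈ s' <;> by_cases h3 : z ∈ s <;>
        by_cases h4 : z ∈ s' <;> simp [h1, h2, h3, h4]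
    · simp [Separates, hxu]
  · obtain ⟨y, z, hyz, hc⟩ := key t ht hx
    simp only [hyz, Set.mem_inter_iff, Set.mem_union]
    have hab : a ≠ b := fun e => ha' (e ▸ hb)
    obtain (⟨rfl, rfl⟩ | ⟨rfl, rfl⟩) : (a = y ∧ b = z) ∨ (a = z ∧ b = y) := by
      rcases hc a hat hax with h1 | h1 <;> rcases hc b hbt hbx with h2 | h2
      · exact absurd (h1.trans h2.symm) hab
      · exact .inl ⟨h1, h2⟩
      · exact .inr ⟨h1, h2⟩
      · exact absurd (h1.trans h2.symm) hab
    · simp [ha, ha', hb, hb']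
    · simp [ha, ha', hb, hb']

open Classical in
/-- Every triangle has exactly one middle vertex. -/
lemma sum_linkCut_eq_card [Fintype W] {α : Type*} [LinearOrder α] {f : W → α}
    (hf : Function.Injective f) : ∑ x, Q.linkCut x {y | f y < f x} = Q.triangles.card := by
  simp only [linkCut, Finset.card_filter]
  rw [Finset.sum_comm, Finset.card_eq_sum_ones]
  refine Finset.sum_congr rfl fun t ht => ?_
  obtain ⟨b, hb⟩ : ∃ b ∈ t, (∃ y ∈ t, f y < f b) ∧ (∃ z ∈ t, f b < f z) := by
    have h3 := Q.card_eq_three t ht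
    obtain ⟨a, b, c, hab, hac, hbc, rfl⟩ := Finset.card_eq_three.1 h3
    have h1 := hf.ne hab
    have h2 := hf.ne hac
    have h3 := hf.ne hbc
    simp only [Finset.mem_insert, Finset.mem_singleton, exists_eq_or_imp, exists_eq_left,
      lt_self_iff_false, false_or, or_false]
    rcases lt_or_gt_of_ne h1 with h1 | h1 <;> rcases lt_or_gt_of_ne h2 with h2 | h2 <;>
      rcases lt_or_gt_of_ne h3 with h3 | h3 <;> simp [h1, h2, h3]
  rw [Finset.sum_eq_single b]
  · obtain ⟨hbt, ⟨y, hy, hyb⟩, z, hz, hbz⟩ := hb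
    rw [if_pos]
    refine ⟨hbt, ⟨y, hy, ?_, hyb⟩, z, hz, ?_, ?_⟩
    · rintro rfl; exact lt_irrefl _ hyb
    · rintro rfl; exact lt_irrefl _ hbz
    · exact not_lt.2 hbz.le
  · rintro c - hcb
    rw [if_neg]
    rintro ⟨hct, ⟨y, hy, hyc, hyc'⟩, z, hz, hzc, hzc'⟩
    obtain ⟨hbt, ⟨y', hy', hyb'⟩, z', hz', hbz'⟩ := hb
    obtain ⟨d, hdb, hdc, rfl⟩ := eq_triple_of_mem ht hbt hct hcb.symm
    simp only [Set.mem_ofPred_eq, not_lt] at hyc' hzc'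
    have hzc'' := lt_of_le_of_ne hzc' (hf.ne hzc.symm)
    simp only [Finset.mem_insert, Finset.mem_singleton] at hy hz hy' hz'
    rcases hy with rfl | rfl | rfl <;> rcases hz with rfl | rfl | rfl <;>
    rcases hy' with rfl | rfl | rfl <;> rcases hz' with rfl | rfl | rfl <;>
    first | exact lt_irrefl _ (by assumption) | exact lt_asymm (by assumption) (by assumption) |
      grind
  · simp

lemma IsDiskLike.expectedCut_le [Fintype W] (hQ : Q.IsDiskLike) {α : Type*} [LinearOrder α]
    {f : W → α} {x : W} (hx : Q.Mixed f x) : Q.expectedCut x ≤ Q.linkCut x {y | f y < f x} := by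
  classical
  obtain ⟨⟨y, hy, hyx⟩, z, hz, hzx⟩ := hx
  have h1 := hQ.linkCut_pos (s := {y | f y < f x}) hy hz hyx (not_lt.2 hzx.le)
  have h2 := hQ.linkCut_mod_two x {y | f y < f x}
  unfold expectedCut
  split_ifs with hb
  · exact h1
  · have : {y | Q.boundaryGraph.Adj x y ∧ y ∈ {y | f y < f x}} = ∅ :=
      Set.eq_empty_of_forall_notMem fun y h => hb ⟨y, h.1⟩
    rw [this, Set.ncard_empty] at h2
    omega

/-- If an injective `f` has no local extrema besides two boundary vertices `p` and `q`, then it has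
no saddles either. -/
lemma IsDiskLike.linkCut_eq_of_injective [Fintype W] (hQ : Q.IsDiskLike) {α : Type*}
    [LinearOrder α] {f : W → α} (hf : Function.Injective f) {p q : W} (hpq : p ≠ q)
    (hp : Q.IsBoundaryVertex p) (hq : Q.IsBoundaryVertex q)
    (hm : ∀ x, x ≠ p → x ≠ q → Q.Mixed f x) {x : W} (hxp : x ≠ p) (hxq : x ≠ q) :
    Q.linkCut x {y | f y < f x} = Q.expectedCut x := by
  classical
  have h1 := sum_linkCut_eq_card (Q := Q) hf
  have h2 := hQ.card_add_two_le
  set S : Finset W := (Finset.univ.erase p).erase q with hS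
  have hsum : ∀ m : W → ℕ, ∑ x, m x = m p + (m q + ∑ x ∈ S, m x) := by
    intro m
    rw [hS, Finset.add_sum_erase _ _ (by simp [hpq.symm]), Finset.add_sum_erase _ _ (by simp)]
  have hmem : ∀ y ∈ S, Q.expectedCut y ≤ Q.linkCut y {z | f z < f y} := by
    intro y hy
    simp only [hS, Finset.mem_erase, Finset.mem_univ, and_true] at hy
    exact hQ.expectedCut_le (hm y hy.2 hy.1)
  rw [hsum] at h1 h2
  have hep : Q.expectedCut p = 1 := if_pos hp
  have heq : Q.expectedCut q = 1 := if_pos hq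
  have h3 := Finset.sum_le_sum hmem
  have h4 : ∑ x ∈ S, Q.expectedCut x = ∑ x ∈ S, Q.linkCut x {z | f z < f x} := by
    omega
  exact ((Finset.sum_eq_sum_iff_of_le hmem).1 h4 x (by simp [hS, hxp, hxq])).symm

/-- The number of sign changes does not depend on how the neighbours with equal values are
distributed: ties may be broken arbitrarily at mixed vertices. -/
lemma IsDiskLike.linkCut_eq [Fintype W] (hQ : Q.IsDiskLike) {α : Type*}
    [LinearOrder α] {f : W → α} {p q : W} (hpq : p ≠ q)
    (hp : Q.IsBoundaryVertex p) (hq : Q.IsBoundaryVertex q)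
    (hm : ∀ x, x ≠ p → x ≠ q → Q.Mixed f x) {x : W} (hxp : x ≠ p) (hxq : x ≠ q) {s : Set W}
    (h1 : ∀ y, f y < f x → y ∈ s) (h2 : ∀ y ∈ s, f y ≤ f x) :
    Q.linkCut x s = Q.expectedCut x := by
  classical
  let ψ : W → ℤ := fun y => if y = x then 0 else if y ∈ s then -1 else 1
  let F : W → α ×ₗ (ℤ ×ₗ Fin (Fintype.card W)) :=
    fun y => toLex (f y, toLex (ψ y, Fintype.equivFin W y))
  have hF : Function.Injective F := by
    intro a b hab
    have := congrArg (fun z => (ofLex (ofLex z).2).2) hab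
    exact (Fintype.equivFin W).injective this
  have hlt : ∀ a b, f a < f b → F a < F b := fun a b h => Prod.Lex.toLex_lt_toLex.2 (.inl h)
  have := hQ.linkCut_eq_of_injective hF hpq hp hq (x := x) ?_ hxp hxq
  · rw [← this]
    refine linkCut_congr fun y hy => ?_
    have hyx : y ≠ x := hy.1.symm
    simp only [Set.mem_ofPred_eq, F, Prod.Lex.toLex_lt_toLex, ψ, hyx, if_false, if_true]
    constructor
    · intro hys
      rcases (h2 y hys).lt_or_eq with h | h
      · exact .inl h
      · exact .inr ⟨h, .inl (by simp [hys])⟩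
    · rintro (h | ⟨h, h' | ⟨h', -⟩⟩)
      · exact h1 y h
      · by_contra hys; simp [hys] at h'
      · by_contra hys; simp [hys] at h'
  · intro y hyp hyq
    obtain ⟨⟨a, ha, ha'⟩, b, hb, hb'⟩ := hm y hyp hyq
    exact ⟨⟨a, ha, hlt _ _ ha'⟩, b, hb, hlt _ _ hb'⟩

/-- An edge on which `f` is constant has one adjacent triangle below and one above. -/
lemma IsDiskLike.exists_triangles [Fintype W] (hQ : Q.IsDiskLike) {α : Type*}
    [LinearOrder α] {f : W → α} {p q : W} (hpq : p ≠ q)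
    (hp : Q.IsBoundaryVertex p) (hq : Q.IsBoundaryVertex q)
    (hm : ∀ x, x ≠ p → x ≠ q → Q.Mixed f x) {x y : W} (hxp : x ≠ p) (hxq : x ≠ q)
    (hxy : Q.graph.Adj x y) (hf : f y = f x) :
    (∃ t ∈ Q.triangles, x ∈ t ∧ y ∈ t ∧ ∃ z ∈ t, f z < f x) ∧
    ∃ t ∈ Q.triangles, x ∈ t ∧ y ∈ t ∧ ∃ z ∈ t, f x < f z := by
  have hyx : y ≠ x := hxy.1.symm
  have key : ∀ s : Set W, (∀ y, f y < f x → y ∈ s) → (∀ y ∈ s, f y ≤ f x) →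
      Q.linkCut x s = Q.expectedCut x := fun s => hQ.linkCut_eq hpq hp hq hm hxp hxq
  constructor
  · by_contra! hc
    have h1 := key {z | f z < f x} (fun _ h => h) (fun _ h => le_of_lt h)
    have h2 := key (insert y {z | f z < f x}) (fun _ h => .inr h)
      (by rintro z (rfl | h); exacts [hf.le, le_of_lt h])
    have h3 := linkCut_lt_insert (s := {z | f z < f x}) hxy (by simp [hf])
      (fun t ht hxt hyt z hz _ _ => not_lt.2 (hc t ht hxt hyt z hz))
    omega
  · by_contra! hc
    have h1 := key ({z | f z ≤ f x} \ {x}) (fun z h => ⟨le_of_lt h, by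
      rintro rfl
      exact lt_irrefl _ h⟩) (fun _ h => h.1)
    have h2 := key ({z | f z ≤ f x} \ {x, y}) (fun z h => ⟨le_of_lt h, by
        rintro (rfl | rfl)
        · exact lt_irrefl _ h
        · exact absurd hf h.ne⟩)
      (fun _ h => h.1)
    rw [← linkCut_compl] at h1 h2
    have h3 := linkCut_lt_insert (s := ({z | f z ≤ f x} \ {x})ᶜ) hxy (by simp [hf, hyx])
      (fun t ht hxt hyt z hz hzx hzy => by simp [hc t ht hxt hyt z hz, hzx])
    have h4 : insert y ({z | f z ≤ f x} \ {x})ᶜ = ({z | f z ≤ f x} \ {x, y})ᶜ := by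
      ext z
      simp only [Set.mem_insert_iff, Set.mem_compl_iff, Set.mem_sdiff, Set.mem_singleton_iff]
      tauto
    rw [h4] at h3
    omega

end Counting

/-! ### Discrete harmonic functions -/

section Harmonic

variable {W : Type*}

/-- A weighted mean value is attained only strictly between the extreme values, unless all the
values agree. -/
lemma eq_or_mixed_of_sum_eq_zero {S : Finset W} {c : W → ℝ} {u : W → ℝ} {a : ℝ}
    (hc : ∀ y ∈ S, 0 < c y) (h : ∑ y ∈ S, c y * (a - u y) = 0) :
    (∀ y ∈ S, u y = a) ∨ (∃ y ∈ S, u y < a) ∧ ∃ y ∈ S, a < u y := by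
  by_cases h1 : ∃ y ∈ S, u y < a
  · by_cases h2 : ∃ y ∈ S, a < u y
    · exact .inr ⟨h1, h2⟩
    · push Not at h2
      left
      have := (Finset.sum_eq_zero_iff_of_nonneg fun y hy =>
        mul_nonneg (hc y hy).le (sub_nonneg.2 (h2 y hy))).1 h
      intro y hy
      have := (mul_eq_zero.1 (this y hy)).resolve_left (hc y hy).ne'
      linarith
  · push Not at h1
    left
    have := (Finset.sum_eq_zero_iff_of_nonpos fun y hy =>
      mul_nonpos_of_nonneg_of_nonpos (hc y hy).le (sub_nonpos.2 (h1 y hy))).1 h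
    intro y hy
    have := (mul_eq_zero.1 (this y hy)).resolve_left (hc y hy).ne'
    linarith

open Classical in
/-- The Laplacian of a graph with unit conductances. -/
def unitLaplacian [Fintype W] (G : SimpleGraph W) (u : W → ℝ) (x : W) : ℝ :=
  ∑ y with G.Adj x y, (u x - u y)

lemma eq_or_mixed_of_unitLaplacian [Fintype W] {Q : TriComplex W} {u : W → ℝ} {x : W}
    (h : unitLaplacian Q.graph u x = 0) : (∀ y, Q.graph.Adj x y → u y = u x) ∨ Q.Mixed u x := by
  classical
  have := eq_or_mixed_of_sum_eq_zero (S := Finset.univ.filter (Q.graph.Adj x)) (c := fun _ => 1)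
    (u := u) (a := u x) (fun _ _ => one_pos) (by simpa [unitLaplacian] using h)
  simpa [Mixed] using this

variable [Fintype W] {Q : TriComplex W} {S : Set W}

lemma le_of_unitLaplacian_eq_zero
    (hS : ∀ R : Set W, R ⊆ S → R.Nonempty → ∃ x ∈ R, ∃ y ∉ R, Q.graph.Adj x y) {u : W → ℝ} {a : ℝ}
    (hu : ∀ x ∈ S, unitLaplacian Q.graph u x = 0) (ha : ∀ x ∉ S, u x ≤ a) (x : W) : u x ≤ a := by
  by_contra hx
  push Not at hx
  obtain ⟨m, -, hm⟩ := Finset.exists_max_image Finset.univ u ⟨x, Finset.mem_univ x⟩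
  have ham : a < u m := hx.trans_le (hm x (Finset.mem_univ x))
  obtain ⟨z, hz, y, hy, hzy⟩ := hS {z | u z = u m}
    (fun z hz => by by_contra h; exact absurd (ha z h) (by
      rw [show u z = u m from hz]
      exact not_le.2 ham))
    ⟨m, rfl⟩
  have hzS : z ∈ S := by
    by_contra h; exact absurd (ha z h) (by rw [show u z = u m from hz]; exact not_le.2 ham)
  rcases eq_or_mixed_of_unitLaplacian (hu z hzS) with h | ⟨-, w, -, hw⟩
  · exact hy ((h y hzy).trans hz)
  · rw [show u z = u m from hz] at hw
    exact absurd (hm w (Finset.mem_univ w)) (not_le.2 hw)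

lemma unitLaplacian_neg (u : W → ℝ) (x : W) :
    unitLaplacian Q.graph (-u) x = -unitLaplacian Q.graph u x := by
  simp only [unitLaplacian, Pi.neg_apply, ← Finset.sum_neg_distrib]
  exact Finset.sum_congr rfl fun _ _ => by ring

/-- Solvability of the discrete Dirichlet problem. -/
lemma exists_unitLaplacian_eq_zero
    (hS : ∀ R : Set W, R ⊆ S → R.Nonempty → ∃ x ∈ R, ∃ y ∉ R, Q.graph.Adj x y) (b : W → ℝ) :
    ∃ u : W → ℝ, (∀ x ∉ S, u x = b x) ∧ ∀ x ∈ S, unitLaplacian Q.graph u x = 0 := by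
  classical
  let T : (W → ℝ) →ₗ[ℝ] (W → ℝ) :=
    { toFun := fun u x => if x ∈ S then unitLaplacian Q.graph u x else u x
      map_add' := by
        intro u v; ext x
        by_cases hx : x ∈ S
        · simp only [hx, if_true, Pi.add_apply, unitLaplacian, ← Finset.sum_add_distrib]
          exact Finset.sum_congr rfl fun _ _ => by ring
        · simp [hx]
      map_smul' := by
        intro a u; ext x
        by_cases hx : x ∈ S
        · simp only [hx, if_true, Pi.smul_apply, unitLaplacian, smul_eq_mul, RingHom.id_apply,
            Finset.mul_sum]
          exact Finset.sum_congr rfl fun _ _ => by ring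
        · simp [hx] }
  have hinj : Function.Injective T := by
    rw [← LinearMap.ker_eq_bot, LinearMap.ker_eq_bot']
    intro u hu
    have h1 : ∀ x ∈ S, unitLaplacian Q.graph u x = 0 := fun x hx => by
      have := congrFun hu x; simpa [T, hx] using this
    have h2 : ∀ x ∉ S, u x = 0 := fun x hx => by
      have := congrFun hu x; simpa [T, hx] using this
    ext x
    have h3 := le_of_unitLaplacian_eq_zero hS h1 (fun x hx => (h2 x hx).le) x
    have h4 := le_of_unitLaplacian_eq_zero hS (u := -u) (a := 0)
      (fun x hx => by rw [unitLaplacian_neg, h1 x hx, neg_zero]) (fun x hx => by simp [h2 x hx]) x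
    simp only [Pi.neg_apply, Pi.zero_apply] at h4 ⊢
    linarith
  obtain ⟨u, hu⟩ := LinearMap.injective_iff_surjective.1 hinj (fun x => if x ∈ S then 0 else b x)
  refine ⟨u, fun x hx => ?_, fun x hx => ?_⟩
  · have := congrFun hu x; simpa [T, hx] using this
  · have := congrFun hu x; simpa [T, hx] using this

end Harmonic

/-! ### Flat vertices -/

section Flat

variable {W : Type*} [Fintype W]

/-- Handshake lemma: if `A` has only even degrees and is joined to the outside only at `v`, then
`v` has an even number of neighbours in `A`. -/
lemma even_ncard_adj_of_closed {H : SimpleGraph W} {A : Set W} {v : W} (hv : v ∉ A)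
    (h1 : ∀ x ∈ A, Even {y | H.Adj x y}.ncard) (h2 : ∀ x ∈ A, ∀ y, H.Adj x y → y ∈ A ∨ y = v) :
    Even {x | x ∈ A ∧ H.Adj x v}.ncard := by
  classical
  let G : SimpleGraph W :=
    { Adj := fun x y => H.Adj x y ∧ x ∈ A ∧ y ∈ A
      symm := ⟨fun _ _ h => ⟨h.1.symm, h.2.2, h.2.1⟩⟩
      loopless := ⟨fun _ h => H.loopless.irrefl _ h.1⟩ }
  have hs := G.sum_degrees_eq_twice_card_edges
  have hd : ∀ x, (G.degree x + if x ∈ A ∧ H.Adj x v then 1 else 0) % 2 = 0 := by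
    intro x
    by_cases hx : x ∈ A
    · have he := h1 x hx
      have hset : {y | H.Adj x y} = ((G.neighborFinset x ∪ if H.Adj x v then {v} else ∅ :
        Finset W) : Set W) := by
        ext y
        by_cases hxv : H.Adj x v
        · simp only [hxv, if_true, Finset.coe_union, SimpleGraph.coe_neighborFinset,
          Set.mem_ofPred_eq,
            Set.mem_union, SimpleGraph.mem_neighborSet, Finset.coe_singleton, Set.mem_singleton_iff]
          constructor
          · intro h
            rcases h2 x hx y h with h' | h'
            · exact .inl ⟨h, hx, h'⟩
            · exact .inr h'
          · rintro (h | rfl)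
            · exact h.1
            · exact hxv
        · simp only [hxv, if_false, Finset.coe_union, SimpleGraph.coe_neighborFinset,
          Set.mem_ofPred_eq,
            Set.mem_union, SimpleGraph.mem_neighborSet, Finset.coe_empty, Set.mem_empty_iff_false,
              or_false]
          constructor
          · intro h
            rcases h2 x hx y h with h' | h'
            · exact ⟨h, hx, h'⟩
            · exact absurd (h' ▸ h) hxv
          · exact fun h => h.1
      have hdis : Disjoint (G.neighborFinset x) (if H.Adj x v then {v} else ∅) := by
        split_ifs
        · rw [Finset.disjoint_singleton_right, SimpleGraph.mem_neighborFinset]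
          exact fun h => hv h.2.2
        · simp
      rw [hset, Set.ncard_coe_finset, Finset.card_union_of_disjoint hdis,
        SimpleGraph.card_neighborFinset_eq_degree] at he
      rw [Nat.even_iff] at he
      by_cases hxv : H.Adj x v <;> simpa [hx, hxv] using he
    · have : G.degree x = 0 := by
        rw [← SimpleGraph.card_neighborFinset_eq_degree, Finset.card_eq_zero,
          Finset.eq_empty_iff_forall_notMem]
        intro y hy
        rw [SimpleGraph.mem_neighborFinset] at hy
        exact hx hy.2.1
      simp [this, hx]
  have hcard : {x | x ∈ A ∧ H.Adj x v}.ncard = ∑ x, if x ∈ A ∧ H.Adj x v then 1 else 0 := by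
    rw [← Finset.card_filter, ← Set.ncard_coe_finset]
    congr 1; ext; simp
  have htot : (∑ x, (G.degree x + if x ∈ A ∧ H.Adj x v then 1 else 0)) % 2 = 0 := by
    rw [Finset.sum_nat_mod, Finset.sum_eq_zero (fun x _ => hd x), Nat.zero_mod]
  rw [Finset.sum_add_distrib, hs, ← hcard] at htot
  rw [Nat.even_iff]; omega

variable {Q : TriComplex W} {α β : Type*} [LinearOrder α] [LinearOrder β]

/-- Flat vertices of `f` may be resolved by two further functions, in lexicographic order. -/
lemma IsDiskLike.linkCut_lex (hQ : Q.IsDiskLike) {f : W → α} {p q : W} (hpq : p ≠ q)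
    (hp : Q.IsBoundaryVertex p) (hq : Q.IsBoundaryVertex q) {S : Set W}
    (hS : ∀ x ∈ S, ∀ y, Q.graph.Adj x y → f y = f x)
    (hm : ∀ x, x ≠ p → x ≠ q → Q.Mixed f x ∨ x ∈ S)
    {ψ : W → ℝ} (hψ : ∀ x ∈ S, (∀ y, Q.graph.Adj x y → ψ y = ψ x) ∨ Q.Mixed ψ x)
    {χ : W → β} (hχ : ∀ x ∈ S, Q.Mixed χ x) {v : W} (hvp : v ≠ p) (hvq : v ≠ q) :
    Q.linkCut v {y | f y < f v ∨ f y = f v ∧ (ψ y < ψ v ∨ ψ y = ψ v ∧ χ y < χ v)}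
      = Q.expectedCut v := by
  let F : W → α ×ₗ (ℝ ×ₗ β) := fun y => toLex (f y, toLex (ψ y, χ y))
  have hF : ∀ y x, F y < F x ↔ f y < f x ∨ f y = f x ∧ (ψ y < ψ x ∨ ψ y = ψ x ∧ χ y < χ x) := by
    intro y x
    simp only [F, Prod.Lex.toLex_lt_toLex]
  refine hQ.linkCut_eq (f := F) hpq hp hq ?_ hvp hvq ?_ ?_
  · intro x hxp hxq
    rcases hm x hxp hxq with ⟨⟨a, ha, ha'⟩, b, hb, hb'⟩ | hx
    · exact ⟨⟨a, ha, (hF _ _).2 (.inl ha')⟩, b, hb, (hF _ _).2 (.inl hb')⟩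
    · rcases hψ x hx with hc | ⟨⟨a, ha, ha'⟩, b, hb, hb'⟩
      · obtain ⟨⟨a, ha, ha'⟩, b, hb, hb'⟩ := hχ x hx
        exact ⟨⟨a, ha, (hF _ _).2 (.inr ⟨hS x hx a ha, .inr ⟨hc a ha, ha'⟩⟩)⟩,
          b, hb, (hF _ _).2 (.inr ⟨(hS x hx b hb).symm, .inr ⟨(hc b hb).symm, hb'⟩⟩)⟩
      · exact ⟨⟨a, ha, (hF _ _).2 (.inr ⟨hS x hx a ha, .inl ha'⟩)⟩,
          b, hb, (hF _ _).2 (.inr ⟨(hS x hx b hb).symm, .inl hb'⟩)⟩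
  · intro y hy; exact (hF _ _).1 hy
  · intro y hy; exact ((hF _ _).2 hy).le

/-- A function without local extrema besides `p` and `q`, in the weak sense that every other vertex
is mixed or flat, has no flat vertices. If `v` is adjacent to the flat set `S`, and `v`, `w ∉ S` and
a flat vertex span a triangle, then one perturbs `f` on its level at `v` so that all neighbours of
`v` other than `w` move to one side, while `w` moves to either side independently; the four cuts
that arise in the link of `v` violate submodularity. -/
lemma IsDiskLike.eq_empty_of_flat (hQ : Q.IsDiskLike) {f : W → α} {p q : W} (hpq : p ≠ q)
    (hp : Q.IsBoundaryVertex p) (hq : Q.IsBoundaryVertex q) {S : Set W}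
    (hS : ∀ x ∈ S, ∀ y, Q.graph.Adj x y → f y = f x)
    (hm : ∀ x, x ≠ p → x ≠ q → Q.Mixed f x ∨ x ∈ S)
    (hfp : ∀ x ∈ S, f x ≠ f p) (hfq : ∀ x ∈ S, f x ≠ f q)
    (hexit : ∀ R : Set W, R ⊆ S → R.Nonempty → ∃ x ∈ R, ∃ y ∉ R, Q.graph.Adj x y)
    {χ : W → β} (hχ : Function.Injective χ) (hχS : ∀ x ∈ S, Q.Mixed χ x)
    (hside : ∀ x ∈ S, ∀ v, Q.boundaryGraph.Adj x v → ∃ N : Set W, v ∈ N ∧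
      (∀ y ∈ S, ∀ z, Q.boundaryGraph.Adj y z → (y ∈ N ↔ z ∈ N)) ∧
      ∀ y ∈ N, ∀ z ∈ N, Q.graph.Adj y z → Q.boundaryGraph.Adj y z) : S = ∅ := by
  classical
  by_contra hne
  obtain ⟨u, hu, v, hv, huv⟩ := hexit S subset_rfl (Set.nonempty_iff_ne_empty.2 hne)
  have hfv : f v = f u := hS u hu v huv
  have hvp : v ≠ p := fun e => hfp u hu (by rw [← hfv, e])
  have hvq : v ≠ q := fun e => hfq u hu (by rw [← hfv, e])
  have hmv : Q.Mixed f v := (hm v hvp hvq).resolve_right hv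
  obtain ⟨⟨z, hvz, hz⟩, -⟩ := hmv
  have hfS : ∀ x ∈ S, Q.graph.Adj v x → f x = f v := fun x hx h => (hS x hx v h.symm).symm
  -- a triangle at `v` with one further vertex in `S` and one outside `S`
  obtain ⟨t, ht, hvt, u₁, hu₁t, hu₁, w, hwt, hwv, hw⟩ : ∃ t ∈ Q.triangles, v ∈ t ∧
      ∃ u₁ ∈ t, u₁ ∈ S ∧ ∃ w ∈ t, w ≠ v ∧ w ∉ S := by
    by_contra! hc
    have := hQ.mem_of_link_closed (s := S)
      (fun t ht hvt a ha b hb hav hbv has => hc t ht hvt a ha has b hb hbv) huv.symm hvz hu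
    exact hz.ne (hfS z this hvz)
  have hu₁v : u₁ ≠ v := fun e => hv (e ▸ hu₁)
  have hwu₁ : w ≠ u₁ := fun e => hw (e ▸ hu₁)
  have hvw : Q.graph.Adj v w := adj_of_mem ht hvt hwt hwv.symm
  have hfw : f w = f v :=
    (hS u₁ hu₁ w (adj_of_mem ht hu₁t hwt hwu₁.symm)).trans
      (hS u₁ hu₁ v (adj_of_mem ht hu₁t hvt hu₁v)).symm
  obtain ⟨ψ, hψ, hψS⟩ := exists_unitLaplacian_eq_zero hexit
    (fun x => if x = v ∨ x = w then 0 else 1)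
  have hψ0 : ∀ x, 0 ≤ ψ x := by
    intro x
    have := le_of_unitLaplacian_eq_zero hexit (u := -ψ) (a := 0)
      (fun x hx => by rw [unitLaplacian_neg, hψS x hx, neg_zero])
      (fun x hx => by simp only [Pi.neg_apply, hψ x hx]; split_ifs <;> simp) x
    simpa using this
  have hψv : ψ v = 0 := by rw [hψ v hv]; simp
  have hψw : ψ w = 0 := by rw [hψ w hw]; simp
  set Z : Set W := {x | x ∈ S ∧ ψ x = 0} with hZ
  have hZnbr : ∀ x ∈ Z, ∀ y, Q.graph.Adj x y → y ∈ Z ∨ y = v ∨ y = w := by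
    rintro x ⟨hx, hx0⟩ y hxy
    have hy0 : ψ y = 0 := by
      rcases eq_or_mixed_of_unitLaplacian (hψS x hx) with h | ⟨⟨a, -, ha⟩, -⟩
      · rw [h y hxy, hx0]
      · rw [hx0] at ha; exact absurd (hψ0 a) (not_le.2 ha)
    by_cases hy : y ∈ S
    · exact .inl ⟨hy, hy0⟩
    · right
      by_contra h
      rw [hψ y hy, if_neg h] at hy0
      exact one_ne_zero hy0
  have hfZ : ∀ x, x ∈ Z ∨ x = w → Q.graph.Adj v x → f x = f v := by
    rintro x (hx | rfl) h
    · exact hfS x hx.1 h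
    · exact hfw
  have hzZ : ¬ (z ∈ Z ∨ z = w) := fun h => hz.ne (hfZ z h hvz)
  have hvZ : v ∉ Z := fun h => hv h.1
  have hwZ : w ∉ Z := fun h => hw h.1
  -- no neighbour of `v` lies in `Z`
  have hZv : ∀ x ∈ Z, ¬ Q.graph.Adj v x := by
    intro x hx hvx
    by_cases hall : ∀ s ∈ Q.triangles, v ∈ s → w ∈ s → ∀ y ∈ s, y ≠ v → y ≠ w → y ∈ Z
    · refine hzZ (hQ.mem_of_link_closed (s := {x | x ∈ Z ∨ x = w}) ?_ hvx hvz (.inl hx))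
      rintro s hs hvs a ha b hb hav hbv (haZ | rfl)
      · by_cases hab : a = b
        · exact .inl (hab ▸ haZ)
        · rcases hZnbr a haZ b (adj_of_mem hs ha hb hab) with h | h | h
          · exact .inl h
          · exact absurd h hbv
          · exact .inr h
      · by_cases hba : b = a
        · exact .inr hba
        · exact .inl (hall s hs hvs ha b hb hbv hba)
    · push Not at hall
      obtain ⟨s₀, hs₀, hvs₀, hws₀, y₀, hy₀, hy₀v, hy₀w, hy₀Z⟩ := hall
      have hcross : ∀ s ∈ Q.triangles, Separates v Z s →
          w ∈ s ∧ ∃ a ∈ s, a ∈ Z := by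
        rintro s hs ⟨hvs, ⟨a, ha, hav, haZ⟩, b, hb, hbv, hbZ⟩
        have hab : a ≠ b := fun e => hbZ (e ▸ haZ)
        rcases hZnbr a haZ b (adj_of_mem hs ha hb hab) with h | h | h
        · exact absurd h hbZ
        · exact absurd h hbv
        · exact ⟨h ▸ hb, a, ha, haZ⟩
      have hpos : 0 < Q.linkCut v Z := hQ.linkCut_pos hvx hvw hx hwZ
      have hs₀n : ¬ Separates v Z s₀ := by
        rintro ⟨-, ⟨a, ha, hav, haZ⟩, -⟩
        obtain ⟨d, hdv, hdw, rfl⟩ := eq_triple_of_mem hs₀ hvs₀ hws₀ hwv.symm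
        simp only [Finset.mem_insert, Finset.mem_singleton] at ha hy₀
        rcases ha with rfl | rfl | rfl
        · exact hav rfl
        · exact hwZ haZ
        · rcases hy₀ with rfl | rfl | rfl
          · exact hy₀v rfl
          · exact hy₀w rfl
          · exact hy₀Z haZ
      have hlt : Q.linkCut v Z < Q.edgeDegree v w := by
        refine Finset.card_lt_card (Finset.ssubset_iff_of_subset ?_ |>.2 ⟨s₀, ?_, ?_⟩)
        · intro s hs
          simp only [Finset.mem_filter] at hs ⊢
          exact ⟨hs.1, hs.2.1, (hcross s hs.1 hs.2).1⟩
        · simp [hs₀, hvs₀, hws₀]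
        · simp [hs₀n]
      have hle := hQ.edge_le_two v w hvw
      have hnb : ¬ Q.boundaryGraph.Adj v w := fun h => by
        have := (boundaryGraph_adj_iff.1 h).2; omega
      have hodd : {y | Q.boundaryGraph.Adj v y ∧ y ∈ Z}.ncard % 2 = 1 := by
        rw [← hQ.linkCut_mod_two]
        have : Q.linkCut v Z = 1 := by omega
        rw [this]
      obtain ⟨y, hvy, hyZ⟩ : {y | Q.boundaryGraph.Adj v y ∧ y ∈ Z}.Nonempty := by
        apply Set.nonempty_of_ncard_ne_zero; omega
      obtain ⟨N, hvN, hN1, hN2⟩ := hside y hyZ.1 v hvy.symm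
      have hev := even_ncard_adj_of_closed (H := Q.boundaryGraph) (A := Z ∩ N) (v := v)
        (fun h => hvZ h.1) (fun x _ => hQ.even_ncard_boundary x) (by
          rintro x ⟨hxZ, hxN⟩ y hxy
          have hyN := (hN1 x hxZ.1 y hxy).1 hxN
          rcases hZnbr x hxZ y hxy.1 with h | h | h
          · exact .inl ⟨h, hyN⟩
          · exact .inr h
          · exact absurd (hN2 v hvN w (h ▸ hyN) hvw) hnb)
      have hset : {x | x ∈ Z ∩ N ∧ Q.boundaryGraph.Adj x v}
          = {y | Q.boundaryGraph.Adj v y ∧ y ∈ Z} := by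
        ext x
        constructor
        · rintro ⟨⟨h1, -⟩, h2⟩; exact ⟨h2.symm, h1⟩
        · rintro ⟨h1, h2⟩; exact ⟨⟨h2, (hN1 x h2.1 v h1.symm).2 hvN⟩, h1.symm⟩
      rw [hset, Nat.even_iff] at hev
      omega
  -- the four perturbations
  have hψm : ∀ x ∈ S, (∀ y, Q.graph.Adj x y → ψ y = ψ x) ∨ Q.Mixed ψ x :=
    fun x hx => eq_or_mixed_of_unitLaplacian (hψS x hx)
  have hψm' : ∀ x ∈ S, (∀ y, Q.graph.Adj x y → (-ψ) y = (-ψ) x) ∨ Q.Mixed (-ψ) x :=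
    fun x hx => eq_or_mixed_of_unitLaplacian (by rw [unitLaplacian_neg, hψS x hx, neg_zero])
  have hχ' : ∀ x ∈ S, Q.Mixed (fun x => OrderDual.toDual (χ x)) x :=
    fun x hx => ⟨(hχS x hx).2, (hχS x hx).1⟩
  have c1 := hQ.linkCut_lex hpq hp hq hS hm hψm hχS hvp hvq
  have c2 := hQ.linkCut_lex hpq hp hq hS hm hψm hχ' hvp hvq
  have c3 := hQ.linkCut_lex hpq hp hq hS hm hψm' hχS hvp hvq
  have c4 := hQ.linkCut_lex hpq hp hq hS hm hψm' hχ' hvp hvq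
  simp only [OrderDual.toDual_lt_toDual] at c2 c4
  set A : Set W := {y | f y < f v} with hA
  set U : Set W := {y | f y = f v ∧ y ≠ w} with hU
  have hψU : ∀ y, Q.graph.Adj v y → y ∈ U → 0 < ψ y := by
    rintro y hvy ⟨hy, hyw⟩
    refine lt_of_le_of_ne (hψ0 y) fun h0 => ?_
    by_cases hyS : y ∈ S
    · exact hZv y ⟨hyS, h0.symm⟩ hvy
    · rw [hψ y hyS, if_neg (by rintro (h | h); exacts [hvy.1 h.symm, hyw h])] at h0
      exact zero_ne_one h0
  have hpos : ∀ P : W → Prop, Q.linkCut v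
      {y | f y < f v ∨ f y = f v ∧ (ψ y < ψ v ∨ ψ y = ψ v ∧ P y)} =
      Q.linkCut v (A ∪ {y | y = w ∧ P w}) := by
    intro P
    refine linkCut_congr fun y hvy => ?_
    simp only [Set.mem_ofPred_eq, Set.mem_union, hA]
    refine or_congr_right ?_
    rw [hψv]
    constructor
    · rintro ⟨hy, h | ⟨h, hP⟩⟩
      · exact absurd (hψ0 y) (not_le.2 h)
      · by_cases hyw : y = w
        · exact ⟨hyw, hyw ▸ hP⟩
        · exact absurd h (hψU y hvy ⟨hy, hyw⟩).ne'
    · rintro ⟨rfl, hP⟩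
      exact ⟨hfw, .inr ⟨hψw, hP⟩⟩
  have hneg : ∀ P : W → Prop, Q.linkCut v
      {y | f y < f v ∨ f y = f v ∧ ((-ψ) y < (-ψ) v ∨ (-ψ) y = (-ψ) v ∧ P y)} =
      Q.linkCut v (A ∪ U ∪ {y | y = w ∧ P w}) := by
    intro P
    refine linkCut_congr fun y hvy => ?_
    simp only [Set.mem_ofPred_eq, Set.mem_union, hA, or_assoc]
    refine or_congr_right ?_
    simp only [Pi.neg_apply, hψv, neg_zero, neg_lt_zero, neg_eq_zero]
    constructor
    · rintro ⟨hy, h⟩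
      by_cases hyw : y = w
      · subst hyw
        rcases h with h | h
        · exact absurd hψw h.ne'
        · exact .inr ⟨rfl, h.2⟩
      · exact .inl ⟨hy, hyw⟩
    · rintro (h | ⟨rfl, hP⟩)
      · exact ⟨h.1, .inl (hψU y hvy h)⟩
      · exact ⟨hfw, .inr ⟨hψw, hP⟩⟩
  rw [hpos (fun y => χ y < χ v)] at c1
  rw [hpos (fun y => χ v < χ y)] at c2
  rw [hneg (fun y => χ y < χ v)] at c3
  rw [hneg (fun y => χ v < χ y)] at c4
  have hsub := linkCut_submodular (Q := Q) (x := v) (a := w) (b := u₁) (s := A ∪ {w}) (s' := A ∪ U)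
    (.inr rfl) (by rintro (h | h); exacts [absurd hfw h.ne, h.2 rfl])
    (.inr ⟨hS u₁ hu₁ v (adj_of_mem ht hu₁t hvt hu₁v) |>.symm, hwu₁.symm⟩)
    (by
      rintro (h | h)
      · exact absurd (hfS u₁ hu₁ (adj_of_mem ht hvt hu₁t hu₁v.symm)) h.ne
      · exact hwu₁ h.symm) ht hvt hwt hu₁t hwv hu₁v
  have e1 : (A ∪ {w}) ∩ (A ∪ U) = A := by
    ext y
    simp only [Set.mem_inter_iff, Set.mem_union, Set.mem_singleton_iff, hU, Set.mem_ofPred_eq]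
    tauto
  have e2 : A ∪ {w} ∪ (A ∪ U) = A ∪ U ∪ {w} := by
    ext y
    simp only [Set.mem_union]
    tauto
  rw [e1, e2] at hsub
  have hlt : {y | y = w ∧ True} = ({w} : Set W) := by ext; simp
  have hgt : {y | y = w ∧ False} = (∅ : Set W) := by ext; simp
  rcases lt_or_gt_of_ne (hχ.ne hwv) with h | h
  · simp only [h, h.not_gt, hlt, hgt, Set.union_empty] at c1 c2 c3 c4
    omega
  · simp only [h, h.not_gt, hlt, hgt, Set.union_empty] at c1 c2 c3 c4
    omega

end Flat

/-! ### Triangulated rectangles with a harmonic height function -/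

section Rectangle

variable {W : Type*} [Fintype W]

/-- `Q` is a triangulated rectangle with sides `N₁`, `b`, `N₂`, `t`, and `g` is a harmonic function
on `Q` with the values `k` on `N₁` and `0` on `N₂`, which decreases along the edge paths `b` and `t`
and is constant only on boundary edges. Connectivity is expressed by `exists_exit`: from every set
of vertices off `b` and `t` an edge leads out. By `exists_potential`, there is a function that has
no local maxima along `N₁` and no local minima along `N₂`, except on `b` and `t`. -/
structure IsGradedRectangle (Q : TriComplex W) (c : W → W → ℝ) (N₁ N₂ : Set W) {n : ℕ}
    (b t : Fin (n + 1) → W) (g : W → ℝ) (k : ℝ) : Prop where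
  disk : Q.IsDiskLike
  k_pos : 0 < k
  conductance_pos : ∀ x y, Q.graph.Adj x y → 0 < c x y
  nonneg : ∀ x, 0 ≤ g x
  le : ∀ x, g x ≤ k
  eq_k : ∀ x, g x = k ↔ x ∈ N₁
  eq_zero : ∀ x, g x = 0 ↔ x ∈ N₂
  b_zero : b 0 ∈ N₁
  b_last : b (Fin.last n) ∈ N₂
  t_zero : t 0 ∈ N₁
  t_last : t (Fin.last n) ∈ N₂
  b_anti : StrictAnti fun i => g (b i)
  t_anti : StrictAnti fun i => g (t i)
  b_ne_t : ∀ i j, b i ≠ t j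
  not_adj : ∀ i, ¬ Q.graph.Adj (b i) (t i)
  boundary_cases : ∀ x y, Q.boundaryGraph.Adj x y →
    IsPathEdge b x y ∨ IsPathEdge t x y ∨ (x ∈ N₁ ∧ y ∈ N₁) ∨ (x ∈ N₂ ∧ y ∈ N₂)
  b_edge : ∀ i : Fin n, Q.boundaryGraph.Adj (b i.castSucc) (b i.succ)
  t_edge : ∀ i : Fin n, Q.boundaryGraph.Adj (t i.castSucc) (t i.succ)
  harmonic : ∀ x, x ∉ Set.range b ∪ Set.range t → x ∉ N₁ → x ∉ N₂ → Q.laplacian c g x = 0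
  mixed : ∀ x, x ∉ Set.range b ∪ Set.range t → x ∉ N₁ → x ∉ N₂ → Q.Mixed g x
  boundary_of_eq : ∀ x y, Q.graph.Adj x y → g x = g y → Q.boundaryGraph.Adj x y
  exists_exit : ∀ S : Set W, S.Nonempty → Disjoint S (Set.range b ∪ Set.range t) →
    ∃ x ∈ S, ∃ y ∉ S, Q.graph.Adj x y
  exists_adj_lt : ∀ x ∈ N₁, x ∉ Set.range b ∪ Set.range t → ∃ y, Q.graph.Adj x y ∧ g y < g x
  exists_adj_gt : ∀ x ∈ N₂, x ∉ Set.range b ∪ Set.range t → ∃ y, Q.graph.Adj x y ∧ g x < g y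
  exists_potential : ∃ r : W → ℝ,
    (∀ x ∈ N₁, x ∉ Set.range b ∪ Set.range t → ∃ y ∈ N₁, Q.graph.Adj x y ∧ r x < r y) ∧
    ∀ x ∈ N₂, x ∉ Set.range b ∪ Set.range t → ∃ y ∈ N₂, Q.graph.Adj x y ∧ r y < r x

namespace IsGradedRectangle

variable {Q : TriComplex W} {c : W → W → ℝ} {N₁ N₂ : Set W} {n : ℕ} {b t : Fin (n + 1) → W}
  {g : W → ℝ} {k : ℝ}

lemma swap (hR : Q.IsGradedRectangle c N₁ N₂ b t g k) : Q.IsGradedRectangle c N₁ N₂ t b g k where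
  disk := hR.disk
  k_pos := hR.k_pos
  conductance_pos := hR.conductance_pos
  nonneg := hR.nonneg
  le := hR.le
  eq_k := hR.eq_k
  eq_zero := hR.eq_zero
  b_zero := hR.t_zero
  b_last := hR.t_last
  t_zero := hR.b_zero
  t_last := hR.b_last
  b_anti := hR.t_anti
  t_anti := hR.b_anti
  b_ne_t := fun i j => (hR.b_ne_t j i).symm
  not_adj := fun i h => hR.not_adj i h.symm
  boundary_cases := fun x y h => by have := hR.boundary_cases x y h; tauto
  b_edge := hR.t_edge
  t_edge := hR.b_edge
  harmonic := by rw [Set.union_comm]; exact hR.harmonic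
  mixed := by rw [Set.union_comm]; exact hR.mixed
  boundary_of_eq := hR.boundary_of_eq
  exists_exit := by rw [Set.union_comm]; exact hR.exists_exit
  exists_adj_lt := by rw [Set.union_comm]; exact hR.exists_adj_lt
  exists_adj_gt := by rw [Set.union_comm]; exact hR.exists_adj_gt
  exists_potential := by rw [Set.union_comm]; exact hR.exists_potential

lemma g_b_zero (hR : Q.IsGradedRectangle c N₁ N₂ b t g k) : g (b 0) = k := (hR.eq_k _).2 hR.b_zero

lemma g_b_last (hR : Q.IsGradedRectangle c N₁ N₂ b t g k) : g (b (Fin.last n)) = 0 :=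
    (hR.eq_zero _).2 hR.b_last

lemma notMem_N₂ (hR : Q.IsGradedRectangle c N₁ N₂ b t g k) {x : W} (hx : x ∈ N₁) : x ∉ N₂ :=
    fun h => by
  have h1 := (hR.eq_k x).2 hx
  have h2 := (hR.eq_zero x).2 h
  exact hR.k_pos.ne (h2.symm.trans h1)

lemma n_pos (hR : Q.IsGradedRectangle c N₁ N₂ b t g k) : 0 < n := by
  rcases Nat.eq_zero_or_pos n with rfl | h
  · exact absurd hR.b_last (hR.notMem_N₂ hR.b_zero)
  · exact h

lemma b_injective (hR : Q.IsGradedRectangle c N₁ N₂ b t g k) : Function.Injective b :=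
    fun _ _ h => hR.b_anti.injective (congrArg g h)

lemma eq_zero_of_b_mem (hR : Q.IsGradedRectangle c N₁ N₂ b t g k) {i : Fin (n + 1)}
    (h : b i ∈ N₁) : i = 0 :=
  hR.b_anti.injective (((hR.eq_k _).2 h).trans hR.g_b_zero.symm)

lemma eq_last_of_b_mem (hR : Q.IsGradedRectangle c N₁ N₂ b t g k) {i : Fin (n + 1)}
    (h : b i ∈ N₂) : i = Fin.last n :=
  hR.b_anti.injective (((hR.eq_zero _).2 h).trans hR.g_b_last.symm)

/-- An inner vertex of the path `b` has a successor. -/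
lemma exists_b_succ (hR : Q.IsGradedRectangle c N₁ N₂ b t g k) {i : Fin (n + 1)}
    (hi : i ≠ Fin.last n) :
    ∃ y, Q.boundaryGraph.Adj (b i) y ∧ y ∈ Set.range b ∧ g y < g (b i) := by
  obtain ⟨j, rfl⟩ := Fin.exists_castSucc_eq.2 hi
  exact ⟨_, hR.b_edge j, ⟨_, rfl⟩, hR.b_anti Fin.castSucc_lt_succ⟩

lemma exists_b_pred (hR : Q.IsGradedRectangle c N₁ N₂ b t g k) {i : Fin (n + 1)} (hi : i ≠ 0) :
    ∃ y, Q.boundaryGraph.Adj (b i) y ∧ y ∈ Set.range b ∧ g (b i) < g y := by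
  obtain ⟨j, rfl⟩ := Fin.exists_succ_eq.2 hi
  exact ⟨_, (hR.b_edge j).symm, ⟨_, rfl⟩, hR.b_anti Fin.castSucc_lt_succ⟩

lemma exists_boundary_ne (hR : Q.IsGradedRectangle c N₁ N₂ b t g k) {v w : W}
    (h : Q.boundaryGraph.Adj v w) :
    ∃ y, y ≠ w ∧ Q.boundaryGraph.Adj v y := by
  by_contra! hc
  have he := hR.disk.even_ncard_boundary v
  have : {y | Q.boundaryGraph.Adj v y} = {w} := by
    ext y
    constructor
    · intro hy; by_contra hne; exact hc y hne hy
    · rintro rfl; exact h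
  rw [this, Set.ncard_singleton] at he
  exact absurd he (by decide)

/-- The corner `b 0` has a neighbour on the side `N₁`. -/
lemma exists_adj_b_zero (hR : Q.IsGradedRectangle c N₁ N₂ b t g k) :
    ∃ y, Q.boundaryGraph.Adj (b 0) y ∧ y ∈ N₁ ∧
    y ∉ Set.range b ∪ Set.range t := by
  have h0 := hR.b_edge ⟨0, hR.n_pos⟩
  have e0 : (⟨0, hR.n_pos⟩ : Fin n).castSucc = 0 := rfl
  rw [e0] at h0
  obtain ⟨y, hy, hby⟩ := hR.exists_boundary_ne h0
  have hyN : y ∈ N₁ := by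
    rcases hR.boundary_cases _ _ hby with ⟨i, ⟨h1, h2⟩ | ⟨h1, h2⟩⟩ | ⟨i, ⟨h1, h2⟩ | ⟨h1,
      h2⟩⟩ | h | h
    · have hi : i = ⟨0, hR.n_pos⟩ := by
        have := hR.b_injective h1
        ext; simpa using (congrArg Fin.val this).symm
      subst hi
      exact absurd h2 hy
    · exact absurd (hR.b_injective h2).symm (Fin.succ_ne_zero i)
    · exact absurd h1 (hR.b_ne_t _ _)
    · exact absurd h2 (hR.b_ne_t _ _)
    · exact h.2
    · exact absurd h.1 (hR.notMem_N₂ hR.b_zero)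
  refine ⟨y, hby, hyN, ?_⟩
  rintro (⟨i, rfl⟩ | ⟨i, rfl⟩)
  · rw [hR.eq_zero_of_b_mem hyN] at hby
    exact hby.ne rfl
  · rw [hR.swap.eq_zero_of_b_mem hyN] at hby
    exact hR.not_adj 0 hby.1

/-- The corner `b n` has a neighbour on the side `N₂`. -/
lemma exists_adj_b_last (hR : Q.IsGradedRectangle c N₁ N₂ b t g k) :
    ∃ y, Q.boundaryGraph.Adj (b (Fin.last n)) y ∧ y ∈ N₂ ∧
    y ∉ Set.range b ∪ Set.range t := by
  have hn := hR.n_pos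
  have h0 := (hR.b_edge ⟨n - 1, by omega⟩).symm
  have e0 : (⟨n - 1, by omega⟩ : Fin n).succ = Fin.last n := by
    ext; simp; omega
  rw [e0] at h0
  obtain ⟨y, hy, hby⟩ := hR.exists_boundary_ne h0
  have hyN : y ∈ N₂ := by
    rcases hR.boundary_cases _ _ hby with ⟨i, ⟨h1, h2⟩ | ⟨h1, h2⟩⟩ | ⟨i, ⟨h1, h2⟩ | ⟨h1,
      h2⟩⟩ | h | h
    · exact absurd (hR.b_injective h1).symm (Fin.castSucc_lt_last i).ne
    · have hi : i = ⟨n - 1, by omega⟩ := by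
        have := congrArg Fin.val (hR.b_injective h2)
        ext; simp at this ⊢; omega
      subst hi
      exact absurd h1 hy
    · exact absurd h1 (hR.b_ne_t _ _)
    · exact absurd h2 (hR.b_ne_t _ _)
    · exact absurd hR.b_last (hR.notMem_N₂ h.1)
    · exact h.2
  refine ⟨y, hby, hyN, ?_⟩
  rintro (⟨i, rfl⟩ | ⟨i, rfl⟩)
  · rw [hR.eq_last_of_b_mem hyN] at hby
    exact hby.ne rfl
  · rw [hR.swap.eq_last_of_b_mem hyN] at hby
    exact hR.not_adj _ hby.1

lemma isBoundaryVertex_b (hR : Q.IsGradedRectangle c N₁ N₂ b t g k) (i : Fin (n + 1)) :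
    Q.IsBoundaryVertex (b i) := by
  by_cases hi : i = 0
  · subst hi; obtain ⟨y, hy, -⟩ := hR.exists_adj_b_zero; exact ⟨y, hy⟩
  · obtain ⟨y, hy, -⟩ := hR.exists_b_pred hi; exact ⟨y, hy⟩

lemma boundary_cases_of_notMem (hR : Q.IsGradedRectangle c N₁ N₂ b t g k) {x y : W}
    (hx : x ∉ Set.range b ∪ Set.range t)
    (h : Q.boundaryGraph.Adj x y) : (x ∈ N₁ ∧ y ∈ N₁) ∨ (x ∈ N₂ ∧ y ∈ N₂) := by
  rcases hR.boundary_cases _ _ h with ⟨i, ⟨h1, h2⟩ | ⟨h1, h2⟩⟩ | ⟨i, ⟨h1, h2⟩ | ⟨h1, h2⟩⟩ | h | h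
  · exact absurd (.inl ⟨_, h1.symm⟩) hx
  · exact absurd (.inl ⟨_, h2.symm⟩) hx
  · exact absurd (.inr ⟨_, h1.symm⟩) hx
  · exact absurd (.inr ⟨_, h2.symm⟩) hx
  · exact .inl h
  · exact .inr h

lemma exists_boundary_of_mem (hR : Q.IsGradedRectangle c N₁ N₂ b t g k) {x : W}
    (hx : x ∉ Set.range b ∪ Set.range t)
    (hN : x ∈ N₁ ∨ x ∈ N₂) : ∃ y, Q.boundaryGraph.Adj x y := by
  obtain ⟨r, h1, h2⟩ := hR.exists_potential
  rcases hN with hN | hN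
  · obtain ⟨y, hy, hxy, -⟩ := h1 x hN hx
    exact ⟨y, hR.boundary_of_eq x y hxy (((hR.eq_k x).2 hN).trans ((hR.eq_k y).2 hy).symm)⟩
  · obtain ⟨y, hy, hxy, -⟩ := h2 x hN hx
    exact ⟨y, hR.boundary_of_eq x y hxy (((hR.eq_zero x).2 hN).trans ((hR.eq_zero y).2 hy).symm)⟩

/-- The hypothesis on boundary edges in `IsDiskLike.eq_empty_of_flat`: the sides `N₁` and `N₂` have
no chords. -/
lemma exists_side (hR : Q.IsGradedRectangle c N₁ N₂ b t g k) {S : Set W}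
    (hS : ∀ x ∈ S, x ∉ Set.range b ∪ Set.range t) :
    ∀ x ∈ S, ∀ v, Q.boundaryGraph.Adj x v → ∃ N : Set W, v ∈ N ∧
      (∀ y ∈ S, ∀ z, Q.boundaryGraph.Adj y z → (y ∈ N ↔ z ∈ N)) ∧
      ∀ y ∈ N, ∀ z ∈ N, Q.graph.Adj y z → Q.boundaryGraph.Adj y z := by
  intro x hx v hv
  rcases hR.boundary_cases_of_notMem (hS x hx) hv with h | h
  · refine ⟨N₁, h.2, fun y hy z hz => ?_, fun y hy z hz hyz => ?_⟩
    · rcases hR.boundary_cases_of_notMem (hS y hy) hz with h' | h'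
      · exact iff_of_true h'.1 h'.2
      · exact iff_of_false (fun h => hR.notMem_N₂ h h'.1) fun h => hR.notMem_N₂ h h'.2
    · exact hR.boundary_of_eq y z hyz (((hR.eq_k y).2 hy).trans ((hR.eq_k z).2 hz).symm)
  · refine ⟨N₂, h.2, fun y hy z hz => ?_, fun y hy z hz hyz => ?_⟩
    · rcases hR.boundary_cases_of_notMem (hS y hy) hz with h' | h'
      · exact iff_of_false (fun h => hR.notMem_N₂ h'.1 h) fun h => hR.notMem_N₂ h'.2 h
      · exact iff_of_true h'.1 h'.2
    · exact hR.boundary_of_eq y z hyz (((hR.eq_zero y).2 hy).trans ((hR.eq_zero z).2 hz).symm)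

/-- An injective function, with values in a linear order, without local extrema off the sides `b`
and `t`. -/
lemma exists_resolution (hR : Q.IsGradedRectangle c N₁ N₂ b t g k) :
    ∃ χ : W → ℝ ×ₗ (ℝ ×ₗ Fin (Fintype.card W)), Function.Injective χ ∧
    ∀ x, x ∉ Set.range b ∪ Set.range t → Q.Mixed χ x := by
  obtain ⟨r, h1, h2⟩ := hR.exists_potential
  let χ : W → ℝ ×ₗ (ℝ ×ₗ Fin (Fintype.card W)) :=
    fun x => toLex (g x, toLex (r x, Fintype.equivFin W x))
  have hlt : ∀ x y, g x < g y → χ x < χ y := fun x y h => Prod.Lex.toLex_lt_toLex.2 (.inl h)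
  have hlt' : ∀ x y, g x = g y → r x < r y → χ x < χ y := fun x y h h' =>
    Prod.Lex.toLex_lt_toLex.2 (.inr ⟨h, Prod.Lex.toLex_lt_toLex.2 (.inl h')⟩)
  refine ⟨χ, fun x y h => ?_, fun x hx => ?_⟩
  · exact (Fintype.equivFin W).injective (congrArg (fun z => (ofLex (ofLex z).2).2) h)
  · by_cases hx1 : x ∈ N₁
    · obtain ⟨y, hy, hxy, hr⟩ := h1 x hx1 hx
      obtain ⟨z, hxz, hz⟩ := hR.exists_adj_lt x hx1 hx
      exact ⟨⟨z, hxz, hlt _ _ hz⟩, y, hxy,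
        hlt' _ _ (((hR.eq_k x).2 hx1).trans ((hR.eq_k y).2 hy).symm) hr⟩
    by_cases hx2 : x ∈ N₂
    · obtain ⟨y, hy, hxy, hr⟩ := h2 x hx2 hx
      obtain ⟨z, hxz, hz⟩ := hR.exists_adj_gt x hx2 hx
      exact ⟨⟨y, hxy, hlt' _ _ (((hR.eq_zero y).2 hy).trans ((hR.eq_zero x).2 hx2).symm) hr⟩,
        z, hxz, hlt _ _ hz⟩
    · obtain ⟨⟨y, hy, hy'⟩, z, hz, hz'⟩ := hR.mixed x hx hx1 hx2
      exact ⟨⟨y, hy, hlt _ _ hy'⟩, z, hz, hlt _ _ hz'⟩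

end IsGradedRectangle

end Rectangle

/-! ### The conjugate function has no flat vertices and is monotone on the sides -/

section Conjugate

variable {W : Type*}

/-- `h` interpolates strictly between the sides `b`, where it vanishes, and `t`, where it is `P`:
it has no local extrema elsewhere, not even along the two other sides. -/
structure IsStrictHeight (Q : TriComplex W) (N₁ N₂ : Set W) {n : ℕ} (b t : Fin (n + 1) → W)
    (h : W → ℝ) (P : ℝ) : Prop where
  pos : 0 < P
  eq_zero : ∀ i, h (b i) = 0
  eq_top : ∀ i, h (t i) = P
  nonneg : ∀ x, 0 ≤ h x
  le : ∀ x, h x ≤ P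
  mixed : ∀ x, x ∉ Set.range b ∪ Set.range t → Q.Mixed h x
  mixed_side : ∀ x, x ∉ Set.range b ∪ Set.range t → x ∈ N₁ ∨ x ∈ N₂ →
    (∃ y, Q.boundaryGraph.Adj x y ∧ h y < h x) ∧ ∃ y, Q.boundaryGraph.Adj x y ∧ h x < h y
  chordless_b : Q.IsChordless b
  chordless_t : Q.IsChordless t

namespace IsStrictHeight

variable {Q : TriComplex W} {N₁ N₂ : Set W} {n : ℕ} {b t : Fin (n + 1) → W} {h : W → ℝ} {P : ℝ}

lemma h_pos (hh : Q.IsStrictHeight N₁ N₂ b t h P) {x : W}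
    (hx : x ∉ Set.range b ∪ Set.range t) : 0 < h x := by
  obtain ⟨⟨y, -, hy⟩, -⟩ := hh.mixed x hx
  exact (hh.nonneg y).trans_lt hy

lemma h_lt (hh : Q.IsStrictHeight N₁ N₂ b t h P) {x : W}
    (hx : x ∉ Set.range b ∪ Set.range t) : h x < P := by
  obtain ⟨-, y, -, hy⟩ := hh.mixed x hx
  exact hy.trans_le (hh.le y)

lemma mem_b_iff (hh : Q.IsStrictHeight N₁ N₂ b t h P) {x : W} : h x = 0 ↔ x ∈ Set.range b := by
  constructor
  · intro h0
    by_contra hx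
    by_cases hx' : x ∈ Set.range t
    · obtain ⟨i, rfl⟩ := hx'
      rw [hh.eq_top] at h0; exact hh.pos.ne' h0
    · exact (hh.h_pos (fun h => h.elim hx hx')).ne' h0
  · rintro ⟨i, rfl⟩; exact hh.eq_zero i

lemma mem_t_iff (hh : Q.IsStrictHeight N₁ N₂ b t h P) {x : W} : h x = P ↔ x ∈ Set.range t := by
  constructor
  · intro h0
    by_contra hx
    by_cases hx' : x ∈ Set.range b
    · obtain ⟨i, rfl⟩ := hx'
      rw [hh.eq_zero] at h0; exact hh.pos.ne h0
    · exact (hh.h_lt (fun h => h.elim hx' hx)).ne h0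
  · rintro ⟨i, rfl⟩; exact hh.eq_top i

end IsStrictHeight

variable [Fintype W] {Q : TriComplex W} {c : W → W → ℝ} {N₁ N₂ : Set W} {n : ℕ}
  {b t : Fin (n + 1) → W} {g : W → ℝ} {k : ℝ}

open Classical in
/-- A function that breaks ties of `h`: it orders the sides `b` and `t` according to `g`, and lifts
the vertices without smaller neighbours, respectively lowers those without larger neighbours. -/
def tieBreak (Q : TriComplex W) (b t : Fin (n + 1) → W) (g : W → ℝ) (k : ℝ) (h : W → ℝ) (x : W) :
    ℝ :=
  if x ∈ Set.range b ∪ Set.range t then g x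
  else if Q.Mixed h x then 0
  else if ∃ y, Q.graph.Adj x y ∧ h x < h y then 2 * k else -(2 * k)

lemma IsDiskLike.ne_of_boundary (hQ : Q.IsDiskLike) {α : Type*} [LinearOrder α] {f : W → α}
    {p q : W} (hpq : p ≠ q)
    (hp : Q.IsBoundaryVertex p) (hq : Q.IsBoundaryVertex q)
    (hm : ∀ x, x ≠ p → x ≠ q → Q.Mixed f x) {x y : W} (hxp : x ≠ p) (hxq : x ≠ q)
    (hxy : Q.boundaryGraph.Adj x y) : f y ≠ f x := by
  classical
  intro hf
  obtain ⟨⟨s, hs, hxs, hys, z, hz, hz'⟩, s', hs', hxs', hys', z', hz'', hzz⟩ :=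
    hQ.exists_triangles hpq hp hq hm hxp hxq hxy.1 hf
  have h1 := (boundaryGraph_adj_iff.1 hxy).2
  obtain ⟨s₀, hs₀⟩ := Finset.card_eq_one.1 h1
  have e1 : s = s₀ := by rw [← Finset.mem_singleton, ← hs₀]; simp [hs, hxs, hys]
  have e2 : s' = s₀ := by rw [← Finset.mem_singleton, ← hs₀]; simp [hs', hxs', hys']
  subst e1; subst e2
  obtain ⟨w, hwx, hwy, rfl⟩ := eq_triple_of_mem hs hxs hys hxy.1.1
  simp only [Finset.mem_insert, Finset.mem_singleton] at hz hz''
  rcases hz with rfl | rfl | rfl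
  · exact lt_irrefl _ hz'
  · exact hz'.ne hf
  · rcases hz'' with rfl | rfl | rfl
    · exact lt_irrefl _ hzz
    · exact hzz.ne hf.symm
    · exact lt_asymm hz' hzz

/-- On the boundary, a function without extrema besides `p` and `q` is monotone at `x`. -/
lemma IsDiskLike.mixed_boundary (hQ : Q.IsDiskLike) {α : Type*} [LinearOrder α] {f : W → α}
    {p q : W} (hpq : p ≠ q)
    (hp : Q.IsBoundaryVertex p) (hq : Q.IsBoundaryVertex q)
    (hm : ∀ x, x ≠ p → x ≠ q → Q.Mixed f x) {x : W} (hxp : x ≠ p) (hxq : x ≠ q)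
    (hx : Q.IsBoundaryVertex x) :
    (∃ y, Q.boundaryGraph.Adj x y ∧ f y < f x) ∧ ∃ y, Q.boundaryGraph.Adj x y ∧ f x < f y := by
  have h1 := hQ.linkCut_eq hpq hp hq hm hxp hxq (s := {y | f y < f x}) (fun _ h => h)
    (fun _ h => le_of_lt h)
  have h2 := hQ.linkCut_mod_two x {y | f y < f x}
  rw [h1, expectedCut, if_pos hx] at h2
  have h3 := hQ.even_ncard_boundary x
  have hne : ∀ y, Q.boundaryGraph.Adj x y → f y ≠ f x :=
    fun y => hQ.ne_of_boundary hpq hp hq hm hxp hxq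
  constructor
  · obtain ⟨y, hy, hy'⟩ : {y | Q.boundaryGraph.Adj x y ∧ y ∈ {y | f y < f x}}.Nonempty := by
      apply Set.nonempty_of_ncard_ne_zero; omega
    exact ⟨y, hy, hy'⟩
  · by_contra! hc
    have : {y | Q.boundaryGraph.Adj x y ∧ y ∈ {y | f y < f x}} = {y | Q.boundaryGraph.Adj x y} := by
      ext y
      exact ⟨fun h => h.1, fun h => ⟨h, lt_of_le_of_ne (hc y h) (hne y h)⟩⟩
    rw [this] at h2
    rw [Nat.even_iff] at h3
    omega

namespace IsGradedRectangle

/-- Breaking ties leaves only the corners `b n` and `t 0` as local extrema. A vertex on a side that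
is not mixed has a neighbour on its own level, from which the tie breaker separates it. -/
lemma mixed_tieBreak (hR : Q.IsGradedRectangle c N₁ N₂ b t g k) {h : W → ℝ} {P : ℝ}
    (hb : ∀ i, h (b i) = 0) (ht : ∀ i, h (t i) = P) (h0 : ∀ x, 0 ≤ h x)
    (hP' : ∀ x, h x ≤ P)
    (hm : ∀ x, x ∉ Set.range b ∪ Set.range t → Q.Mixed h x ∨
      ((x ∈ N₁ ∨ x ∈ N₂) ∧
        (∃ y, Q.graph.Adj x y ∧ h y = h x ∧ (y ∈ Set.range b ∪ Set.range t ∨ Q.Mixed h y)) ∧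
        ∀ z, Q.boundaryGraph.Adj x z → h z ≠ h x)) (x : W) (hx1 : x ≠ b (Fin.last n))
    (hx2 : x ≠ t 0) : Q.Mixed (fun x => toLex (h x, Q.tieBreak b t g k h x)) x := by
  have hk := hR.k_pos
  set κ := Q.tieBreak b t g k h with hκ
  have κR : ∀ x ∈ Set.range b ∪ Set.range t, κ x = g x := fun x hx => by simp only [hκ, tieBreak,
    if_pos hx]
  have κM : ∀ x, x ∉ Set.range b ∪ Set.range t → Q.Mixed h x → κ x = 0 := fun x hx hx' => by
    simp only [hκ, tieBreak, if_neg hx, if_pos hx']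
  have κU : ∀ x, x ∉ Set.range b ∪ Set.range t → ¬ Q.Mixed h x →
      (∃ y, Q.graph.Adj x y ∧ h x < h y) → κ x = 2 * k := fun x hx hx' hy => by
    simp only [hκ, tieBreak, if_neg hx, if_neg hx', if_pos hy]
  have κL : ∀ x, x ∉ Set.range b ∪ Set.range t → ¬ Q.Mixed h x →
      (¬ ∃ y, Q.graph.Adj x y ∧ h x < h y) → κ x = -(2 * k) := fun x hx hx' hy => by
    simp only [hκ, tieBreak, if_neg hx, if_neg hx', if_neg hy]
  have hlt : ∀ x y, h x < h y → toLex (h x, κ x) < toLex (h y, κ y) :=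
    fun x y h => Prod.Lex.toLex_lt_toLex.2 (.inl h)
  have hlt' : ∀ x y, h x = h y → κ x < κ y → toLex (h x, κ x) < toLex (h y, κ y) :=
    fun x y h h' => Prod.Lex.toLex_lt_toLex.2 (.inr ⟨h, h'⟩)
  have hg : ∀ x y, x ∈ Set.range b ∪ Set.range t → y ∈ Set.range b ∪ Set.range t → h x = h y →
      g x < g y → toLex (h x, κ x) < toLex (h y, κ y) := by
    intro x y hx hy he hl
    exact hlt' x y he (by rw [κR x hx, κR y hy]; exact hl)
  by_cases hxR : x ∈ Set.range b ∪ Set.range t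
  · rcases hxR with ⟨i, rfl⟩ | ⟨i, rfl⟩
    · obtain ⟨y, hy, hyb, hgy⟩ := hR.exists_b_succ (i := i) (fun e => hx1 (by rw [e]))
      refine ⟨⟨y, hy.1, hg _ _ (.inl hyb) (.inl ⟨i, rfl⟩) ?_ hgy⟩, ?_⟩
      · obtain ⟨j, rfl⟩ := hyb; rw [hb, hb]
      by_cases hi : i = 0
      · subst hi
        obtain ⟨z, hz, hzN, hzR⟩ := hR.exists_adj_b_zero
        refine ⟨z, hz.1, ?_⟩
        rcases (h0 z).lt_or_eq with hz0 | hz0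
        · exact hlt _ _ (by rw [hb]; exact hz0)
        · have hzM : ¬ Q.Mixed h z := by
            rintro ⟨⟨a, -, ha⟩, -⟩
            exact absurd (h0 a) (by rw [hz0]; exact not_le.2 ha)
          obtain ⟨-, -, hne⟩ := (hm z hzR).resolve_left hzM
          exact absurd ((hb 0).trans hz0) (hne _ hz.symm)
      · obtain ⟨z, hz, hzb, hgz⟩ := hR.exists_b_pred hi
        refine ⟨z, hz.1, hg _ _ (.inl ⟨i, rfl⟩) (.inl hzb) ?_ hgz⟩
        obtain ⟨j, rfl⟩ := hzb; rw [hb, hb]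
    · by_cases hi : i = Fin.last n
      · subst hi
        obtain ⟨y, hy, hyb, hgy⟩ := hR.swap.exists_b_pred (i := Fin.last n) (fun e => hx2 (by rw
          [e]))
        refine ⟨?_, y, hy.1, hg _ _ (.inr ⟨_, rfl⟩) (.inr hyb) ?_ hgy⟩
        · obtain ⟨z, hz, hzN, hzR⟩ := hR.swap.exists_adj_b_last
          rw [Set.union_comm] at hzR
          refine ⟨z, hz.1, ?_⟩
          rcases (hP' z).lt_or_eq with hz0 | hz0
          · exact hlt _ _ (by rw [ht]; exact hz0)
          · have hzM : ¬ Q.Mixed h z := by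
              rintro ⟨-, a, -, ha⟩
              exact absurd (hP' a) (by rw [← hz0]; exact not_le.2 ha)
            obtain ⟨-, -, hne⟩ := (hm z hzR).resolve_left hzM
            exact absurd ((ht _).trans hz0.symm) (hne _ hz.symm)
        · obtain ⟨j, rfl⟩ := hyb; rw [ht, ht]
      · obtain ⟨y, hy, hyb, hgy⟩ := hR.swap.exists_b_succ hi
        obtain ⟨z, hz, hzb, hgz⟩ := hR.swap.exists_b_pred (i := i) (fun e => hx2 (by rw [e]))
        refine ⟨⟨y, hy.1, hg _ _ (.inr hyb) (.inr ⟨i, rfl⟩) ?_ hgy⟩,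
          z, hz.1, hg _ _ (.inr ⟨i, rfl⟩) (.inr hzb) ?_ hgz⟩
        · obtain ⟨j, rfl⟩ := hyb; rw [ht, ht]
        · obtain ⟨j, rfl⟩ := hzb; rw [ht, ht]
  · by_cases hxM : Q.Mixed h x
    · obtain ⟨⟨a, ha, ha'⟩, a', ha1, ha2⟩ := hxM
      exact ⟨⟨a, ha, hlt _ _ ha'⟩, a', ha1, hlt _ _ ha2⟩
    · obtain ⟨hN, ⟨y, hxy, hyx, hyR⟩, hne⟩ := (hm x hxR).resolve_left hxM
      have hκy : 0 ≤ κ y ∧ κ y ≤ k := by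
        by_cases hyR' : y ∈ Set.range b ∪ Set.range t
        · rw [κR y hyR']; exact ⟨hR.nonneg y, hR.le y⟩
        · rw [κM y hyR' (hyR.resolve_left hyR')]; exact ⟨le_rfl, hk.le⟩
      obtain ⟨z, hz⟩ := hR.exists_boundary_of_mem hxR hN
      by_cases hU : ∃ y, Q.graph.Adj x y ∧ h x < h y
      · obtain ⟨a, ha, ha'⟩ := hU
        exact ⟨⟨y, hxy, hlt' _ _ hyx (by rw [κU x hxR hxM ⟨a, ha, ha'⟩]; linarith)⟩,
          a, ha, hlt _ _ ha'⟩
      · have hzx : h z < h x := lt_of_le_of_ne (by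
          by_contra hc; exact hU ⟨z, hz.1, not_le.1 hc⟩) (hne z hz)
        exact ⟨⟨z, hz.1, hlt _ _ hzx⟩, y, hxy, hlt' _ _ hyx.symm (by
          rw [κL x hxR hxM hU]
          linarith)⟩

lemma isStrictHeight (hR : Q.IsGradedRectangle c N₁ N₂ b t g k) {h : W → ℝ} {P : ℝ} (hP : 0 < P)
    (hb : ∀ i, h (b i) = 0) (ht : ∀ i, h (t i) = P) (h0 : ∀ x, 0 ≤ h x)
    (hP' : ∀ x, h x ≤ P)
    (hm : ∀ x, x ∉ Set.range b ∪ Set.range t → Q.Mixed h x ∨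
      ((x ∈ N₁ ∨ x ∈ N₂) ∧
        (∃ y, Q.graph.Adj x y ∧ h y = h x ∧ (y ∈ Set.range b ∪ Set.range t ∨ Q.Mixed h y)) ∧
        ∀ z, Q.boundaryGraph.Adj x z → h z ≠ h x))
    (hc : (∀ s ∈ Q.triangles, ∃ x ∈ s, ∃ y ∈ s, h x ≠ h y) ∨ (Q.IsChordless b ∧ Q.IsChordless t)) :
    Q.IsStrictHeight N₁ N₂ b t h P := by
  classical
  set κ := Q.tieBreak b t g k h with hκ
  have κR : ∀ x ∈ Set.range b ∪ Set.range t, κ x = g x := fun x hx => by simp only [hκ, tieBreak,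
    if_pos hx]
  have κM : ∀ x, x ∉ Set.range b ∪ Set.range t → Q.Mixed h x → κ x = 0 := fun x hx hx' => by
    simp only [hκ, tieBreak, if_neg hx, if_pos hx']
  have hpq : b (Fin.last n) ≠ t 0 := hR.b_ne_t _ _
  have hp := hR.isBoundaryVertex_b (Fin.last n)
  have hq := hR.swap.isBoundaryVertex_b 0
  have hf := hR.mixed_tieBreak hb ht h0 hP' hm
  have hRne : ∀ x, x ∉ Set.range b ∪ Set.range t → x ≠ b (Fin.last n) ∧ x ≠ t 0 := fun x hx =>
    ⟨fun e => hx (.inl ⟨_, e.symm⟩), fun e => hx (.inr ⟨_, e.symm⟩)⟩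
  have hside : ∀ x, x ∉ Set.range b ∪ Set.range t → x ∈ N₁ ∨ x ∈ N₂ → _ := fun x hx hN =>
    hR.disk.mixed_boundary hpq hp hq hf (hRne x hx).1 (hRne x hx).2
      (hR.exists_boundary_of_mem hx hN)
  have hM : ∀ x, x ∉ Set.range b ∪ Set.range t → Q.Mixed h x := by
    intro x hx
    by_contra hxM
    obtain ⟨hN, -, hne⟩ := (hm x hx).resolve_left hxM
    obtain ⟨⟨y, hy, hy'⟩, z, hz, hz'⟩ := hside x hx hN
    rw [Prod.Lex.toLex_lt_toLex] at hy' hz'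
    exact hxM ⟨⟨y, hy.1, hy'.resolve_right fun h => hne y hy h.1⟩,
      z, hz.1, hz'.resolve_right fun h => hne z hz h.1.symm⟩
  have hpos : ∀ x, x ∉ Set.range b ∪ Set.range t → 0 < h x ∧ h x < P := by
    intro x hx
    obtain ⟨⟨y, -, hy⟩, z, -, hz⟩ := hM x hx
    exact ⟨(h0 y).trans_lt hy, hz.trans_le (hP' z)⟩
  have hκ0 : ∀ x y, x ∉ Set.range b ∪ Set.range t → h y = h x → κ y = κ x := by
    intro x y hx hyx
    have hy : y ∉ Set.range b ∪ Set.range t := by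
      rintro (⟨i, rfl⟩ | ⟨i, rfl⟩)
      · rw [hb] at hyx; exact (hpos x hx).1.ne hyx
      · rw [ht] at hyx; exact (hpos x hx).2.ne' hyx
    rw [κM x hx (hM x hx), κM y hy (hM y hy)]
  have hbchord : ∀ i j, Q.boundaryGraph.Adj (b i) (b j) → IsPathEdge b (b i) (b j) := by
    intro i j hij
    have hne : b i ≠ b j := hij.ne
    rcases hR.boundary_cases _ _ hij with h | ⟨l, ⟨h1, -⟩ | ⟨h1, -⟩⟩ | h | h
    · exact h
    · exact absurd h1 (hR.b_ne_t _ _)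
    · exact absurd h1 (hR.b_ne_t _ _)
    · exact absurd (by rw [hR.eq_zero_of_b_mem h.1, hR.eq_zero_of_b_mem h.2]) hne
    · exact absurd (by rw [hR.eq_last_of_b_mem h.1, hR.eq_last_of_b_mem h.2]) hne
  have htchord : ∀ i j, Q.boundaryGraph.Adj (t i) (t j) → IsPathEdge t (t i) (t j) := by
    intro i j hij
    have hne : t i ≠ t j := hij.ne
    rcases hR.boundary_cases _ _ hij with ⟨l, ⟨h1, -⟩ | ⟨h1, -⟩⟩ | h | h | h
    · exact absurd h1.symm (hR.b_ne_t _ _)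
    · exact absurd h1.symm (hR.b_ne_t _ _)
    · exact h
    · exact absurd (by rw [hR.swap.eq_zero_of_b_mem h.1, hR.swap.eq_zero_of_b_mem h.2]) hne
    · exact absurd (by rw [hR.swap.eq_last_of_b_mem h.1, hR.swap.eq_last_of_b_mem h.2]) hne
  have hsymm : ∀ (β : Fin (n + 1) → W) x y, IsPathEdge β x y → IsPathEdge β y x :=
    fun β x y ⟨l, hl⟩ => ⟨l, hl.symm⟩
  -- an interior chord would produce two sign changes in the link of a boundary vertex
  have htwo : ∀ x y, x ≠ b (Fin.last n) → x ≠ t 0 → Q.IsBoundaryVertex x → Q.graph.Adj x y →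
      ¬ Q.boundaryGraph.Adj x y → (∀ s ∈ Q.triangles, x ∈ s → y ∈ s →
        Separates x {z | toLex (h z, κ z) < toLex (h x, κ x)} s) → False := by
    intro x y hx1 hx2 hxb hxy hnb hsep
    have h1 := hR.disk.linkCut_eq hpq hp hq hf hx1 hx2
      (s := {y | toLex (h y, κ y) < toLex (h x, κ x)}) (fun _ h => h) (fun _ h => le_of_lt h)
    rw [expectedCut, if_pos hxb] at h1
    have h2 := hR.disk.edgeDegree_eq_two hxy hnb
    have h3 : Q.edgeDegree x y ≤
        Q.linkCut x {z | toLex (h z, κ z) < toLex (h x, κ x)} := by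
      refine Finset.card_le_card fun s hs => ?_
      simp only [Finset.mem_filter] at hs ⊢
      exact ⟨hs.1, hsep s hs.1 hs.2.1 hs.2.2⟩
    omega
  have hchord : Q.IsChordless b ∧ Q.IsChordless t := by
    rcases hc with hc | hc
    · constructor
      · have key : ∀ i j, i < j → Q.graph.Adj (b i) (b j) → IsPathEdge b (b i) (b j) := by
          intro i j hij hadj
          by_contra hpe
          have hnb : ¬ Q.boundaryGraph.Adj (b i) (b j) := fun h => hpe (hbchord i j h)
          refine htwo (b i) (b j) (fun e => ?_) (hR.b_ne_t _ _)
            (hR.isBoundaryVertex_b i) hadj hnb ?_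
          · rw [hR.b_injective e] at hij; exact absurd hij (not_lt.2 (Fin.le_last j))
          · intro s hs his hjs
            refine ⟨his, ⟨b j, hjs, hadj.1.symm, ?_⟩, ?_⟩
            · refine Prod.Lex.toLex_lt_toLex.2 (.inr ⟨by rw [hb, hb], ?_⟩)
              rw [κR _ (.inl ⟨_, rfl⟩), κR _ (.inl ⟨_, rfl⟩)]
              exact hR.b_anti hij
            · obtain ⟨z, hzi, hzj, rfl⟩ := eq_triple_of_mem hs his hjs hadj.1
              refine ⟨z, by simp, hzi, ?_⟩
              have hz0 : h z ≠ 0 := by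
                intro hz0
                obtain ⟨a, ha, a', ha', hne⟩ := hc _ hs
                simp only [Finset.mem_insert, Finset.mem_singleton] at ha ha'
                apply hne
                rcases ha with rfl | rfl | rfl <;> rcases ha' with rfl | rfl | rfl <;>
                  simp only [hb, hz0]
              have hz1 := (h0 z).lt_of_ne hz0.symm
              simp only [Set.mem_ofPred_eq, not_lt]
              refine (Prod.Lex.toLex_lt_toLex.2 (.inl ?_)).le
              rw [hb]; exact hz1
        intro i j hadj
        rcases lt_trichotomy i j with h | rfl | h
        · exact key i j h hadj
        · exact absurd rfl hadj.1
        · exact hsymm _ _ _ (key j i h hadj.symm)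
      · have key : ∀ i j, i < j → Q.graph.Adj (t i) (t j) → IsPathEdge t (t i) (t j) := by
          intro i j hij hadj
          by_contra hpe
          have hnb : ¬ Q.boundaryGraph.Adj (t j) (t i) := fun h => hpe (htchord i j h.symm)
          refine htwo (t j) (t i) (hR.b_ne_t _ _).symm (fun e => ?_) (hR.swap.isBoundaryVertex_b j)
            hadj.symm hnb ?_
          · rw [hR.swap.b_injective e] at hij; exact absurd hij (not_lt.2 (Fin.zero_le i))
          · intro s hs hjs his
            refine ⟨hjs, ?_, ⟨t i, his, hadj.1, ?_⟩⟩
            · obtain ⟨z, hzi, hzj, rfl⟩ := eq_triple_of_mem hs his hjs hadj.1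
              refine ⟨z, by simp, hzj, ?_⟩
              have hz0 : h z ≠ P := by
                intro hz0
                obtain ⟨a, ha, a', ha', hne⟩ := hc _ hs
                simp only [Finset.mem_insert, Finset.mem_singleton] at ha ha'
                apply hne
                rcases ha with rfl | rfl | rfl <;> rcases ha' with rfl | rfl | rfl <;>
                  simp only [ht, hz0]
              refine Prod.Lex.toLex_lt_toLex.2 (.inl ?_)
              rw [ht]; exact (hP' z).lt_of_ne hz0
            · simp only [Set.mem_ofPred_eq, not_lt]
              refine (Prod.Lex.toLex_lt_toLex.2 (.inr ⟨by rw [ht, ht], ?_⟩)).le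
              rw [κR _ (.inr ⟨_, rfl⟩), κR _ (.inr ⟨_, rfl⟩)]
              exact hR.t_anti hij
        intro i j hadj
        rcases lt_trichotomy i j with h | rfl | h
        · exact key i j h hadj
        · exact absurd rfl hadj.1
        · exact hsymm _ _ _ (key j i h hadj.symm)
    · exact hc
  refine ⟨hP, hb, ht, h0, hP', hM, fun x hx hN => ?_, hchord.1, hchord.2⟩
  obtain ⟨⟨y, hy, hy'⟩, z, hz, hz'⟩ := hside x hx hN
  rw [Prod.Lex.toLex_lt_toLex] at hy' hz'
  refine ⟨⟨y, hy, hy'.resolve_right ?_⟩, z, hz, hz'.resolve_right ?_⟩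
  · rintro ⟨h1, h2⟩; exact h2.ne (hκ0 x y hx h1)
  · rintro ⟨h1, h2⟩; exact h2.ne (hκ0 x z hx h1.symm).symm

end IsGradedRectangle

end Conjugate

section Neumann

variable {W : Type*} [Fintype W] {Q : TriComplex W} {c : W → W → ℝ} {N₁ N₂ : Set W} {n : ℕ}
  {b t : Fin (n + 1) → W} {g : W → ℝ} {k : ℝ}

lemma eq_or_mixed_of_normalDeriv {F : Set W} {u : W → ℝ} {x : W}
    (hc : ∀ x y, Q.graph.Adj x y → 0 < c x y) (h : Q.normalDeriv c F u x = 0) :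
    (∀ y, Q.graph.Adj x y → y ∈ F → u y = u x) ∨ Q.Mixed u x := by
  classical
  rcases eq_or_mixed_of_sum_eq_zero (fun y hy => hc x y (Finset.mem_filter.1 hy).2.1) h with h | h
  · left
    intro y hy hyF
    exact h y (by simp [hy, hyF])
  · right
    obtain ⟨⟨y, hy, hy'⟩, z, hz, hz'⟩ := h
    simp only [Finset.mem_filter, Finset.mem_univ, true_and] at hy hz
    exact ⟨⟨y, hy.1, hy'⟩, z, hz.1, hz'⟩

lemma eq_or_mixed_of_laplacian {u : W → ℝ} {x : W}
    (hc : ∀ x y, Q.graph.Adj x y → 0 < c x y) (h : Q.laplacian c u x = 0) :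
    (∀ y, Q.graph.Adj x y → u y = u x) ∨ Q.Mixed u x := by
  classical
  have : Q.normalDeriv c Set.univ u x = 0 := by
    rw [← h]; unfold normalDeriv laplacian; congr 1; ext; simp
  simpa using eq_or_mixed_of_normalDeriv hc this

namespace IsGradedRectangle

lemma exists_adj (hR : Q.IsGradedRectangle c N₁ N₂ b t g k) {x : W}
    (hx : x ∉ Set.range b ∪ Set.range t) : ∃ y, Q.graph.Adj x y := by
  obtain ⟨y, rfl, z, -, hz⟩ := hR.exists_exit {x} ⟨x, rfl⟩
    (Set.disjoint_singleton_left.2 hx)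
  exact ⟨z, hz⟩

/-- A triangle at a boundary edge in `N₁` or `N₂` has its third vertex elsewhere. -/
lemma ne_of_boundary_triangle (hR : Q.IsGradedRectangle c N₁ N₂ b t g k) {x y z : W}
    {s : Finset W} (hs : s ∈ Q.triangles) (hx : x ∈ s) (hy : y ∈ s) (hz : z ∈ s) (hxz : z ≠ x)
    (hyz : z ≠ y) (hxy : Q.boundaryGraph.Adj x y)
    (hg : ∃ w, Q.graph.Adj x w ∧ g w ≠ g x) (hxyg : g y = g x) : g z ≠ g x := by
  classical
  intro hzx
  obtain ⟨w, hxw, hw⟩ := hg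
  have hbz := hR.boundary_of_eq x z (adj_of_mem hs hx hz hxz.symm) hzx.symm
  have huniq : ∀ v, v ∈ s → Q.boundaryGraph.Adj x v → ∀ s' ∈ Q.triangles, x ∈ s' → v ∈ s' →
      s' = s := by
    intro v hv hxv s' hs' hxs' hvs'
    obtain ⟨s₀, hs₀⟩ := Finset.card_eq_one.1 (boundaryGraph_adj_iff.1 hxv).2
    have e1 : s = s₀ := by rw [← Finset.mem_singleton, ← hs₀]; simp [hs, hx, hv]
    have e2 : s' = s₀ := by rw [← Finset.mem_singleton, ← hs₀]; simp [hs', hxs', hvs']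
    rw [e1, e2]
  have hsz : ∀ v ∈ s, v ≠ x → v = y ∨ v = z := by
    obtain ⟨v, -, -, rfl⟩ := eq_triple_of_mem hs hx hy hxy.ne
    simp only [Finset.mem_insert, Finset.mem_singleton] at hz ⊢
    rcases hz with rfl | rfl | rfl
    · exact absurd rfl hxz
    · exact absurd rfl hyz
    · tauto
  have := hR.disk.mem_of_link_closed (x := x) (s := {v | v = y ∨ v = z}) ?_ hxy.1 hxw (.inl rfl)
  · rcases this with rfl | rfl
    · exact hw hxyg
    · exact hw hzx
  · rintro s' hs' hxs' a ha a' ha' hax hax' hay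
    have : s' = s := by
      rcases hay with rfl | rfl
      · exact huniq a hy hxy s' hs' hxs' ha
      · exact huniq a hz hbz s' hs' hxs' ha
    exact hsz a' (this ▸ ha') hax'

/-- Conjugate functions, for the normal derivative relative to the vertices off the side. -/
lemma isStrictHeight_of_compl (hR : Q.IsGradedRectangle c N₁ N₂ b t g k) {h : W → ℝ} {P : ℝ}
    (hP : 0 < P)
    (hh : Q.IsDirichletNeumannSolution c (Set.range b) (Set.range t) N₁ N₂ N₁ᶜ N₂ᶜ P h)
    (hT : ∀ s ∈ Q.triangles, ∃ x ∈ s, ∃ y ∈ s, h x ≠ h y) :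
    Q.IsStrictHeight N₁ N₂ b t h P := by
  classical
  have hb : ∀ i, h (b i) = 0 := fun i => hh.eq_on_base _ ⟨i, rfl⟩
  have ht : ∀ i, h (t i) = P := fun i => hh.eq_on_top _ ⟨i, rfl⟩
  have hconst : ∀ s ∈ Q.triangles, ∀ x ∈ s, ¬ ∀ y ∈ s, h y = h x := by
    intro s hs x hx hc
    obtain ⟨a, ha, a', ha', hne⟩ := hT s hs
    exact hne ((hc a ha).trans (hc a' ha').symm)
  have hint : ∀ x, x ∉ Set.range b ∪ Set.range t → x ∉ N₁ → x ∉ N₂ → Q.Mixed h x := by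
    intro x hx h1 h2
    refine (eq_or_mixed_of_laplacian hR.conductance_pos (hh.harmonic x (by simp_all))).resolve_left
      fun hc => ?_
    obtain ⟨y, hxy, s, hs, hxs, hys⟩ := hR.exists_adj hx
    exact hconst s hs x hxs fun z hz => by
      by_cases hzx : z = x
      · rw [hzx]
      · exact hc z (adj_of_mem hs hxs hz (Ne.symm hzx))
  have hN₁ : ∀ x, x ∉ Set.range b ∪ Set.range t → x ∈ N₁ → ¬ Q.Mixed h x →
      ∀ y, Q.graph.Adj x y → y ∉ N₁ → h y = h x := fun x hx h1 hM =>
    (eq_or_mixed_of_normalDeriv hR.conductance_pos (hh.neumann₁ x h1 hx)).resolve_right hM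
  have hN₂ : ∀ x, x ∉ Set.range b ∪ Set.range t → x ∈ N₂ → ¬ Q.Mixed h x →
      ∀ y, Q.graph.Adj x y → y ∉ N₂ → h y = h x := fun x hx h1 hM =>
    (eq_or_mixed_of_normalDeriv hR.conductance_pos (hh.neumann₂ x h1 hx)).resolve_right hM
  -- a vertex that is not mixed lies on a side, and its neighbours off that side are on its level
  have hnot : ∀ x, x ∉ Set.range b ∪ Set.range t → ¬ Q.Mixed h x → ∃ N : Set W, ∃ a : ℝ,
      (∀ v, g v = a ↔ v ∈ N) ∧ x ∈ N ∧ (∀ y, Q.graph.Adj x y → y ∉ N → h y = h x) ∧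
      (∃ y, Q.graph.Adj x y ∧ g y ≠ g x) ∧ (N = N₁ ∨ N = N₂) := by
    intro x hx hM
    by_cases h1 : x ∈ N₁
    · obtain ⟨y, hy, hy'⟩ := hR.exists_adj_lt x h1 hx
      exact ⟨N₁, k, hR.eq_k, h1, hN₁ x hx h1 hM, ⟨y, hy, hy'.ne⟩, .inl rfl⟩
    by_cases h2 : x ∈ N₂
    · obtain ⟨y, hy, hy'⟩ := hR.exists_adj_gt x h2 hx
      exact ⟨N₂, 0, hR.eq_zero, h2, hN₂ x hx h2 hM, ⟨y, hy, hy'.ne'⟩, .inr rfl⟩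
    · exact absurd (hint x hx h1 h2) hM
  have hm : ∀ x, x ∉ Set.range b ∪ Set.range t → Q.Mixed h x ∨
      ((x ∈ N₁ ∨ x ∈ N₂) ∧
        (∃ y, Q.graph.Adj x y ∧ h y = h x ∧ (y ∈ Set.range b ∪ Set.range t ∨ Q.Mixed h y)) ∧
        ∀ z, Q.boundaryGraph.Adj x z → h z ≠ h x) := by
    intro x hx
    by_cases hM : Q.Mixed h x
    · exact .inl hM
    right
    obtain ⟨N, a, hN, hxN, hoff, ⟨y, hxy, hy⟩, hNN⟩ := hnot x hx hM
    have hyN : y ∉ N := fun h' => hy (((hN y).2 h').trans ((hN x).2 hxN).symm)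
    refine ⟨by rcases hNN with rfl | rfl <;> simp [hxN], ⟨y, hxy, hoff y hxy hyN, ?_⟩, ?_⟩
    · by_contra! hc
      obtain ⟨N', a', hN', hyN', hoff', -, -⟩ := hnot y hc.1 hc.2
      obtain ⟨-, s, hs, hxs, hys⟩ := hxy
      refine hconst s hs x hxs fun z hz => ?_
      by_cases hzx : z = x
      · rw [hzx]
      by_cases hzy : z = y
      · rw [hzy]; exact hoff y (adj_of_mem hs hxs hys (fun e => hyN (e ▸ hxN))) hyN
      have hyx : h y = h x := hoff y (adj_of_mem hs hxs hys (fun e => hyN (e ▸ hxN))) hyN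
      by_cases hzN : z ∈ N
      · rw [hoff' z (adj_of_mem hs hys hz (Ne.symm hzy)) ?_, hyx]
        intro hzN'
        apply hyN
        rw [← hN, ← (hN z).2 hzN, (hN' y).2 hyN', (hN' z).2 hzN']
      · exact hoff z (adj_of_mem hs hxs hz (Ne.symm hzx)) hzN
    · intro z hxz hzx
      have hgz : g z = g x := by
        rcases hR.boundary_cases_of_notMem hx hxz with ⟨h1, h2⟩ | ⟨h1, h2⟩
        · rw [(hR.eq_k _).2 h1, (hR.eq_k _).2 h2]
        · rw [(hR.eq_zero _).2 h1, (hR.eq_zero _).2 h2]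
      obtain ⟨-, s, hs, hxs, hzs⟩ := hxz.1
      obtain ⟨w, hwx, hwz, rfl⟩ := eq_triple_of_mem hs hxs hzs hxz.ne
      have hw := hR.ne_of_boundary_triangle hs hxs hzs (by simp) hwx hwz hxz ⟨y, hxy, hy⟩ hgz
      refine hconst _ hs x hxs fun v hv => ?_
      simp only [Finset.mem_insert, Finset.mem_singleton] at hv
      rcases hv with rfl | rfl | rfl
      · rfl
      · exact hzx
      · exact hoff v (adj_of_mem hs hxs (by simp) hwx.symm)
          fun h' => hw (((hN v).2 h').trans ((hN x).2 hxN).symm)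
  have hval : ∀ x ∈ Set.range b ∪ Set.range t, 0 ≤ h x ∧ h x ≤ P := by
    rintro x (⟨i, rfl⟩ | ⟨i, rfl⟩)
    · rw [hb]; exact ⟨le_rfl, hP.le⟩
    · rw [ht]; exact ⟨hP.le, le_rfl⟩
  refine hR.isStrictHeight hP hb ht ?_ ?_ hm (.inl hT)
  · intro x
    obtain ⟨m, -, hmin⟩ := Finset.exists_min_image Finset.univ h ⟨x, Finset.mem_univ x⟩
    refine le_trans ?_ (hmin x (Finset.mem_univ x))
    by_cases hmR : m ∈ Set.range b ∪ Set.range t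
    · exact (hval m hmR).1
    have hnM : ∀ y, h y = h m → ¬ Q.Mixed h y := by
      rintro y hy ⟨⟨z, -, hz⟩, -⟩
      rw [hy] at hz
      exact absurd (hmin z (Finset.mem_univ z)) (not_le.2 hz)
    obtain ⟨-, ⟨y, -, hy, hy'⟩, -⟩ := (hm m hmR).resolve_left (hnM m rfl)
    rw [← hy]
    exact (hval y (hy'.resolve_right (hnM y hy))).1
  · intro x
    obtain ⟨m, -, hmax⟩ := Finset.exists_max_image Finset.univ h ⟨x, Finset.mem_univ x⟩
    refine (hmax x (Finset.mem_univ x)).trans ?_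
    by_cases hmR : m ∈ Set.range b ∪ Set.range t
    · exact (hval m hmR).2
    have hnM : ∀ y, h y = h m → ¬ Q.Mixed h y := by
      rintro y hy ⟨-, z, -, hz⟩
      rw [hy] at hz
      exact absurd (hmax z (Finset.mem_univ z)) (not_le.2 hz)
    obtain ⟨-, ⟨y, -, hy, hy'⟩, -⟩ := (hm m hmR).resolve_left (hnM m rfl)
    rw [← hy]
    exact (hval y (hy'.resolve_right (hnM y hy))).2

/-- The corners `b 0` and `t 0` are connected along the side `N₁`: by parity, a part of `N₁` that
contains just one of them is not a union of components. -/
lemma mem_t_zero_of_closed (hR : Q.IsGradedRectangle c N₁ N₂ b t g k) {S : Set W}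
    (hS : ∀ x ∈ S, ∀ y, Q.graph.Adj x y → y ∈ S) (hb : b 0 ∈ S) : t 0 ∈ S := by
  classical
  by_contra ht
  set A : Set W := {x | x ∈ S ∧ x ∈ N₁ ∧ x ≠ b 0} with hA
  have hAR : ∀ x ∈ A, x ∉ Set.range b ∪ Set.range t := by
    rintro x ⟨hxS, hxN, hx0⟩ (⟨i, rfl⟩ | ⟨i, rfl⟩)
    · rw [hR.eq_zero_of_b_mem hxN] at hx0; exact hx0 rfl
    · rw [hR.swap.eq_zero_of_b_mem hxN] at hxS; exact ht hxS
  have hev := even_ncard_adj_of_closed (H := Q.boundaryGraph) (A := A) (v := b 0)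
    (fun h => h.2.2 rfl) (fun x _ => hR.disk.even_ncard_boundary x) (by
      intro x hx y hxy
      have hyS : y ∈ S := hS x hx.1 y hxy.1
      have hyN : y ∈ N₁ := by
        rcases hR.boundary_cases_of_notMem (hAR x hx) hxy with h | h
        · exact h.2
        · exact absurd h.1 (hR.notMem_N₂ hx.2.1)
      by_cases hy : y = b 0
      · exact .inr hy
      · exact .inl ⟨hyS, hyN, hy⟩)
  have h0 := hR.b_edge ⟨0, hR.n_pos⟩
  have e0 : (⟨0, hR.n_pos⟩ : Fin n).castSucc = 0 := rfl
  rw [e0] at h0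
  set w := b (⟨0, hR.n_pos⟩ : Fin n).succ with hw
  have hwA : w ∉ {x | x ∈ A ∧ Q.boundaryGraph.Adj x (b 0)} := by
    rintro ⟨h, -⟩; exact hAR w h (.inl ⟨_, rfl⟩)
  have hset : {y | Q.boundaryGraph.Adj (b 0) y} =
      insert w {x | x ∈ A ∧ Q.boundaryGraph.Adj x (b 0)} := by
    ext y
    constructor
    · intro hy
      have hyS : y ∈ S := hS _ hb y hy.1
      rcases hR.boundary_cases _ _ hy with
        ⟨i, ⟨h1, h2⟩ | ⟨h1, h2⟩⟩ | ⟨i, ⟨h1, h2⟩ | ⟨h1, h2⟩⟩ | h | h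
      · have hi : i = ⟨0, hR.n_pos⟩ := by
          have := hR.b_injective h1
          ext; simpa using (congrArg Fin.val this).symm
        subst hi
        exact .inl h2
      · exact absurd (hR.b_injective h2).symm (Fin.succ_ne_zero i)
      · exact absurd h1 (hR.b_ne_t _ _)
      · exact absurd h2 (hR.b_ne_t _ _)
      · exact .inr ⟨⟨hyS, h.2, SimpleGraph.Adj.ne' (G := Q.boundaryGraph) hy⟩,
        SimpleGraph.Adj.symm (G := Q.boundaryGraph) hy⟩
      · exact absurd h.1 (hR.notMem_N₂ hR.b_zero)
    · rintro (rfl | h)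
      · exact h0
      · exact h.2.symm
  have hev' := hR.disk.even_ncard_boundary (b 0)
  rw [hset, Set.ncard_insert_of_notMem hwA] at hev'
  rw [Nat.even_iff] at hev hev'
  omega

lemma adj_of_isPathEdge (hR : Q.IsGradedRectangle c N₁ N₂ b t g k) {x y : W}
    (h : IsPathEdge b x y) : Q.boundaryGraph.Adj x y := by
  obtain ⟨i, ⟨rfl, rfl⟩ | ⟨rfl, rfl⟩⟩ := h
  · exact hR.b_edge i
  · exact (hR.b_edge i).symm

/-- If `h` is non-negative, without strict local minima off `b` and `t`, and vanishes on `b`, which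
has no chords, then it vanishes nowhere else. -/
lemma mem_range_of_eq_zero (hR : Q.IsGradedRectangle c N₁ N₂ b t g k) {h : W → ℝ}
    (hch : Q.IsChordless b) (ht : ∀ i, 0 < h (t i)) (h0 : ∀ x, 0 ≤ h x)
    (hm : ∀ x, x ∉ Set.range b ∪ Set.range t → (∀ y, Q.graph.Adj x y → h y = h x) ∨ Q.Mixed h x)
    {x : W} (hx : h x = 0) : x ∈ Set.range b := by
  classical
  by_contra hxb
  set Z : Set W := {x | x ∉ Set.range b ∧ h x = 0} with hZ
  have hZR : ∀ x ∈ Z, x ∉ Set.range b ∪ Set.range t := by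
    rintro x ⟨h1, h2⟩ (h' | ⟨i, rfl⟩)
    · exact h1 h'
    · exact (ht i).ne' h2
  have hZn : ∀ x ∈ Z, ∀ y, Q.graph.Adj x y → y ∈ Z ∨ y ∈ Set.range b := by
    intro x hx y hxy
    rcases hm x (hZR x hx) with hc | ⟨⟨z, -, hz⟩, -⟩
    · by_cases hy : y ∈ Set.range b
      · exact .inr hy
      · exact .inl ⟨hy, (hc y hxy).trans hx.2⟩
    · rw [hx.2] at hz; exact absurd (h0 z) (not_le.2 hz)
  have htouch : ∀ i, (∃ z ∈ Z, Q.graph.Adj (b i) z) → ∀ y, Q.graph.Adj (b i) y →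
      y ∈ Z ∨ (y ∈ Set.range b ∧ ∃ z ∈ Z, Q.graph.Adj y z) := by
    rintro i ⟨z, hz, hiz⟩ y hiy
    have := hR.disk.mem_of_link_closed (x := b i) (s := {y | y ∈ Z ∨ (y ∈ Set.range b ∧
      ∃ z ∈ Z, ∃ s ∈ Q.triangles, b i ∈ s ∧ y ∈ s ∧ z ∈ s)}) ?_ hiz hiy (.inl hz)
    · rcases this with h | ⟨h, z, hz, s, hs, -, hys, hzs⟩
      · exact .inl h
      · exact .inr ⟨h, z, hz, adj_of_mem hs hys hzs fun e => hz.1 (e ▸ h)⟩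
    · rintro s hs his a ha a' ha' hai hai' (haZ | ⟨⟨j, rfl⟩, z', hz', s', hs', his', has', hzs'⟩)
      · by_cases haa : a' = a
        · exact .inl (haa ▸ haZ)
        · rcases hZn a haZ a' (adj_of_mem hs ha ha' (Ne.symm haa)) with h | h
          · exact .inl h
          · exact .inr ⟨h, a, haZ, s, hs, his, ha', ha⟩
      · have hij := hR.adj_of_isPathEdge (hch i j (adj_of_mem hs his ha hai.symm))
        obtain ⟨s₀, hs₀⟩ := Finset.card_eq_one.1 (boundaryGraph_adj_iff.1 hij).2
        have e1 : s = s₀ := by rw [← Finset.mem_singleton, ← hs₀]; simp [hs, his, ha]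
        have e2 : s' = s₀ := by rw [← Finset.mem_singleton, ← hs₀]; simp [hs', his', has']
        rw [e1] at ha'
        rw [e2] at hzs'
        by_cases haa : a' = b j
        · subst haa
          exact .inr ⟨⟨j, rfl⟩, z', hz', s', hs', his', has', e2 ▸ hzs'⟩
        · left
          rw [← e1] at ha' hzs'
          obtain ⟨w, -, -, rfl⟩ := eq_triple_of_mem hs his ha hai.symm
          simp only [Finset.mem_insert, Finset.mem_singleton] at ha' hzs'
          have hza : z' = w := by
            rcases hzs' with h | h | h
            · exact absurd ⟨i, h.symm⟩ hz'.1
            · exact absurd ⟨j, h.symm⟩ hz'.1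
            · exact h
          have : a' = w := by tauto
          rw [this, ← hza]; exact hz'
  obtain ⟨z, hz, y, hy, hzy⟩ := hR.exists_exit Z ⟨x, hxb, hx⟩
    (Set.disjoint_left.2 hZR)
  obtain ⟨i₀, rfl⟩ := (hZn z hz y hzy).resolve_left hy
  have hstep : ∀ i : Fin n, (∃ z ∈ Z, Q.graph.Adj (b i.castSucc) z) ↔
      ∃ z ∈ Z, Q.graph.Adj (b i.succ) z := by
    intro i
    constructor
    · intro h
      exact ((htouch _ h _ (hR.b_edge i).1).resolve_left fun h' => h'.1 ⟨_, rfl⟩).2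
    · intro h
      exact ((htouch _ h _ (hR.b_edge i).1.symm).resolve_left fun h' => h'.1 ⟨_, rfl⟩).2
  have hall : ∀ i, (∃ z ∈ Z, Q.graph.Adj (b i) z) ↔ ∃ z ∈ Z, Q.graph.Adj (b 0) z := by
    intro i
    induction i using Fin.induction with
    | zero => rfl
    | succ i ih => rw [← hstep, ih]
  have hz0 : ∃ z ∈ Z, Q.graph.Adj (b 0) z := (hall i₀).1 ⟨z, hz, hzy.symm⟩
  have hmem := hR.mem_t_zero_of_closed (S := Z ∪ Set.range b) (by
    rintro v (hv | ⟨i, rfl⟩) y hvy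
    · exact hZn v hv y hvy
    · rcases htouch i ((hall i).2 hz0) y hvy with h | h
      · exact .inl h
      · exact .inr h.1) (.inr ⟨0, rfl⟩)
  rcases hmem with h | ⟨i, h⟩
  · exact (ht 0).ne' h.2
  · exact hR.b_ne_t _ _ h

/-- If `h` lies strictly between its values on `b` and `t` elsewhere, then ordering the vertices of
`b` and `t` by `g` leaves only the extrema `b n` and `t 0` on these sides. -/
lemma mixed_lex_of_mem (hR : Q.IsGradedRectangle c N₁ N₂ b t g k) {h : W → ℝ} {P : ℝ}
    (hb : ∀ i, h (b i) = 0) (ht : ∀ i, h (t i) = P)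
    (hm : ∀ x, x ∉ Set.range b ∪ Set.range t → 0 < h x ∧ h x < P) {κ : W → ℝ}
    (hκ : ∀ x ∈ Set.range b ∪ Set.range t, κ x = g x) {x : W}
    (hx : x ∈ Set.range b ∪ Set.range t) (hx1 : x ≠ b (Fin.last n))
    (hx2 : x ≠ t 0) : Q.Mixed (fun x => toLex (h x, κ x)) x := by
  have hlt : ∀ x y, h x < h y → toLex (h x, κ x) < toLex (h y, κ y) :=
    fun x y h => Prod.Lex.toLex_lt_toLex.2 (.inl h)
  have hg : ∀ x y, x ∈ Set.range b ∪ Set.range t → y ∈ Set.range b ∪ Set.range t → h x = h y →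
      g x < g y → toLex (h x, κ x) < toLex (h y, κ y) := fun x y hx hy he hl =>
    Prod.Lex.toLex_lt_toLex.2 (.inr ⟨he, by rw [hκ x hx, hκ y hy]; exact hl⟩)
  rcases hx with ⟨i, rfl⟩ | ⟨i, rfl⟩
  · obtain ⟨y, hy, ⟨j, rfl⟩, hgy⟩ := hR.exists_b_succ (i := i) (fun e => hx1 (by rw [e]))
    refine ⟨⟨_, hy.1, hg _ _ (.inl ⟨j, rfl⟩) (.inl ⟨i, rfl⟩) (by rw [hb, hb]) hgy⟩, ?_⟩
    by_cases hi : i = 0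
    · subst hi
      obtain ⟨z, hz, hzN, hzR⟩ := hR.exists_adj_b_zero
      exact ⟨z, hz.1, hlt _ _ (by rw [hb]; exact (hm z hzR).1)⟩
    · obtain ⟨z, hz, ⟨j, rfl⟩, hgz⟩ := hR.exists_b_pred hi
      exact ⟨_, hz.1, hg _ _ (.inl ⟨i, rfl⟩) (.inl ⟨j, rfl⟩) (by rw [hb, hb]) hgz⟩
  · obtain ⟨y, hy, ⟨j, rfl⟩, hgy⟩ := hR.swap.exists_b_pred (i := i) (fun e => hx2 (by rw [e]))
    refine ⟨?_, _, hy.1, hg _ _ (.inr ⟨i, rfl⟩) (.inr ⟨j, rfl⟩) (by rw [ht, ht]) hgy⟩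
    by_cases hi : i = Fin.last n
    · subst hi
      obtain ⟨z, hz, hzN, hzR⟩ := hR.swap.exists_adj_b_last
      rw [Set.union_comm] at hzR
      exact ⟨z, hz.1, hlt _ _ (by rw [ht]; exact (hm z hzR).2)⟩
    · obtain ⟨z, hz, ⟨j, rfl⟩, hgz⟩ := hR.swap.exists_b_succ hi
      exact ⟨_, hz.1, hg _ _ (.inr ⟨j, rfl⟩) (.inr ⟨i, rfl⟩) (by rw [ht, ht]) hgz⟩

/-- Conjugate functions, for the normal derivative relative to all vertices. -/
lemma isStrictHeight_of_univ (hR : Q.IsGradedRectangle c N₁ N₂ b t g k) {h : W → ℝ} {P : ℝ}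
    (hP : 0 < P)
    (hh : Q.IsDirichletNeumannSolution c (Set.range b) (Set.range t) N₁ N₂ Set.univ Set.univ P h)
    (hcb : Q.IsChordless b) (hct : Q.IsChordless t) :
    Q.IsStrictHeight N₁ N₂ b t h P := by
  classical
  have hb : ∀ i, h (b i) = 0 := fun i => hh.eq_on_base _ ⟨i, rfl⟩
  have ht : ∀ i, h (t i) = P := fun i => hh.eq_on_top _ ⟨i, rfl⟩
  have hm : ∀ x, x ∉ Set.range b ∪ Set.range t →
      (∀ y, Q.graph.Adj x y → h y = h x) ∨ Q.Mixed h x := by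
    intro x hx
    by_cases h1 : x ∈ N₁
    · simpa using eq_or_mixed_of_normalDeriv hR.conductance_pos (hh.neumann₁ x h1 hx)
    by_cases h2 : x ∈ N₂
    · simpa using eq_or_mixed_of_normalDeriv hR.conductance_pos (hh.neumann₂ x h2 hx)
    · exact eq_or_mixed_of_laplacian hR.conductance_pos (hh.harmonic x (by simp_all))
  have hval : ∀ x ∈ Set.range b ∪ Set.range t, 0 ≤ h x ∧ h x ≤ P := by
    rintro x (⟨i, rfl⟩ | ⟨i, rfl⟩)
    · rw [hb]; exact ⟨le_rfl, hP.le⟩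
    · rw [ht]; exact ⟨hP.le, le_rfl⟩
  have h0 : ∀ x, 0 ≤ h x := by
    intro x
    obtain ⟨m, -, hmin⟩ := Finset.exists_min_image Finset.univ h ⟨x, Finset.mem_univ x⟩
    refine le_trans ?_ (hmin x (Finset.mem_univ x))
    by_contra hneg
    obtain ⟨y, hy, z, hz, hyz⟩ := hR.exists_exit {y | h y = h m} ⟨m, rfl⟩
      (Set.disjoint_left.2 fun y hy hyR => hneg (by rw [← show h y = h m from hy]; exact
        (hval y hyR).1))
    have hyR : y ∉ Set.range b ∪ Set.range t := fun hyR =>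
      hneg (by rw [← show h y = h m from hy]; exact (hval y hyR).1)
    rcases hm y hyR with hc | ⟨⟨w, -, hw⟩, -⟩
    · exact hz ((hc z hyz).trans hy)
    · rw [show h y = h m from hy] at hw
      exact absurd (hmin w (Finset.mem_univ w)) (not_le.2 hw)
  have hle : ∀ x, h x ≤ P := by
    intro x
    obtain ⟨m, -, hmax⟩ := Finset.exists_max_image Finset.univ h ⟨x, Finset.mem_univ x⟩
    refine (hmax x (Finset.mem_univ x)).trans ?_
    by_contra hneg
    obtain ⟨y, hy, z, hz, hyz⟩ := hR.exists_exit {y | h y = h m} ⟨m, rfl⟩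
      (Set.disjoint_left.2 fun y hy hyR => hneg (by rw [← show h y = h m from hy]; exact
        (hval y hyR).2))
    have hyR : y ∉ Set.range b ∪ Set.range t := fun hyR =>
      hneg (by rw [← show h y = h m from hy]; exact (hval y hyR).2)
    rcases hm y hyR with hc | ⟨-, w, -, hw⟩
    · exact hz ((hc z hyz).trans hy)
    · rw [show h y = h m from hy] at hw
      exact absurd (hmax w (Finset.mem_univ w)) (not_le.2 hw)
  have hpos : ∀ x, x ∉ Set.range b ∪ Set.range t → 0 < h x ∧ h x < P := by
    intro x hx
    constructor
    · refine (h0 x).lt_of_ne fun he => hx (.inl ?_)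
      exact hR.mem_range_of_eq_zero hcb (fun i => by rw [ht]; exact hP) h0 hm he.symm
    · refine (hle x).lt_of_ne fun he => hx (.inr ?_)
      refine hR.swap.mem_range_of_eq_zero (h := fun x => P - h x) hct
        (fun i => by simpa [hb] using hP) (fun x => sub_nonneg.2 (hle x)) ?_ (by simp [he])
      intro y hy
      rw [Set.union_comm] at hy
      rcases hm y hy with hc | ⟨⟨z, hz, hz'⟩, w, hw, hw'⟩
      · left; intro z hz; simp [hc z hz]
      · right; exact ⟨⟨w, hw, by linarith⟩, z, hz, by linarith⟩
  -- there are no flat vertices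
  set κ : W → ℝ := fun x => if x ∈ Set.range b ∪ Set.range t then g x else 0 with hκ
  have κR : ∀ x ∈ Set.range b ∪ Set.range t, κ x = g x := fun x hx => by
    simp only [hκ, if_pos hx]
  have κ0 : ∀ x, x ∉ Set.range b ∪ Set.range t → κ x = 0 := fun x hx => by
    simp only [hκ, if_neg hx]
  set S : Set W := {x | x ∉ Set.range b ∪ Set.range t ∧ ∀ y, Q.graph.Adj x y → h y = h x} with hS
  have hSe : S = ∅ := by
    obtain ⟨χ, hχ, hχm⟩ := hR.exists_resolution
    refine hR.disk.eq_empty_of_flat (f := fun x => toLex (h x, κ x)) (hR.b_ne_t (Fin.last n) 0)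
      (hR.isBoundaryVertex_b _) (hR.swap.isBoundaryVertex_b _) ?_ ?_ ?_ ?_ ?_ hχ
      (fun x hx => hχm x hx.1) (hR.exists_side fun x hx => hx.1)
    · rintro x ⟨hx, hc⟩ y hxy
      have hy : y ∉ Set.range b ∪ Set.range t := by
        rintro (⟨i, rfl⟩ | ⟨i, rfl⟩)
        · have := hc _ hxy; rw [hb] at this; exact (hpos x hx).1.ne this
        · have := hc _ hxy; rw [ht] at this; exact (hpos x hx).2.ne' this
      simp only [hc y hxy, κ0 x hx, κ0 y hy]
    · intro x hx1 hx2
      by_cases hx : x ∈ Set.range b ∪ Set.range t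
      · exact .inl (hR.mixed_lex_of_mem hb ht hpos κR hx hx1 hx2)
      · rcases hm x hx with hc | ⟨⟨z, hz, hz'⟩, w, hw, hw'⟩
        · exact .inr ⟨hx, hc⟩
        · exact .inl ⟨⟨z, hz, Prod.Lex.toLex_lt_toLex.2 (.inl hz')⟩,
            w, hw, Prod.Lex.toLex_lt_toLex.2 (.inl hw')⟩
    · rintro x ⟨hx, -⟩ he
      have := congrArg (fun z => (ofLex z).1) he
      simp only [ofLex_toLex, hb] at this
      exact (hpos x hx).1.ne' this
    · rintro x ⟨hx, -⟩ he
      have := congrArg (fun z => (ofLex z).1) he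
      simp only [ofLex_toLex, ht] at this
      exact (hpos x hx).2.ne this
    · intro T hT hne
      exact hR.exists_exit T hne (Set.disjoint_left.2 fun x hx => (hT hx).1)
  refine hR.isStrictHeight hP hb ht h0 hle (fun x hx => .inl ?_) (.inr ⟨hcb, hct⟩)
  refine (hm x hx).resolve_left fun hc => ?_
  have : x ∈ S := ⟨hx, hc⟩
  rw [hSe] at this
  exact this

end IsGradedRectangle

end Neumann

/-! ### No edge of the image is a fold -/

section Fold

variable {W : Type*} {Q : TriComplex W} {c : W → W → ℝ} {N₁ N₂ : Set W} {n : ℕ}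
  {b t : Fin (n + 1) → W} {g h : W → ℝ} {k P : ℝ}

/-- A triangle at an edge of the side `b` has its third vertex off `b`. -/
lemma notMem_range_of_triangle (hch : Q.IsChordless b) (hb : Function.Injective b)
    {s : Finset W} (hs : s ∈ Q.triangles) {x y z : W} (hx : x ∈ s) (hy : y ∈ s) (hz : z ∈ s)
    (hxy : x ≠ y) (hxz : x ≠ z) (hyz : y ≠ z) (hxb : x ∈ Set.range b) (hyb : y ∈ Set.range b) :
    z ∉ Set.range b := by
  obtain ⟨i, rfl⟩ := hxb
  obtain ⟨j, rfl⟩ := hyb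
  rintro ⟨l, rfl⟩
  have key : ∀ i j, IsPathEdge b (b i) (b j) → i.val + 1 = j.val ∨ j.val + 1 = i.val := by
    rintro i j ⟨m, ⟨h1, h2⟩ | ⟨h1, h2⟩⟩
    · left; rw [hb h1, hb h2]; simp
    · right; rw [hb h1, hb h2]; simp
  have h1 := key _ _ (hch i j (adj_of_mem hs hx hy hxy))
  have h2 := key _ _ (hch i l (adj_of_mem hs hx hz hxz))
  have h3 := key _ _ (hch j l (adj_of_mem hs hy hz hyz))
  omega

variable [Fintype W]

lemma laplacian_sub_mul (u v : W → ℝ) (a : ℝ) (x : W) :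
    Q.laplacian c (fun y => u y - a * v y) x = Q.laplacian c u x - a * Q.laplacian c v x := by
  classical
  simp only [laplacian, Finset.mul_sum, ← Finset.sum_sub_distrib]
  exact Finset.sum_congr rfl fun y _ => by ring

namespace IsGradedRectangle

/-- For each slope, the function `h - a g` has only two local extrema, at opposite corners. -/
lemma mixed_sub_mul (hR : Q.IsGradedRectangle c N₁ N₂ b t g k)
    (hh : Q.IsStrictHeight N₁ N₂ b t h P)
    (hlap : ∀ x, x ∉ Set.range b ∪ Set.range t → x ∉ N₁ → x ∉ N₂ → Q.laplacian c h x = 0)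
    {a : ℝ} (ha : a ≠ 0) : ∃ p q : W, p ≠ q ∧ Q.IsBoundaryVertex p ∧ Q.IsBoundaryVertex q ∧
      h p - a * g p ≠ h q - a * g q ∧
      ∀ x, x ≠ p → x ≠ q → Q.Mixed (fun x => h x - a * g x) x := by
  classical
  set f : W → ℝ := fun x => h x - a * g x with hf
  have hk := hR.k_pos
  have hP := hh.pos
  -- the values of `f` at the ends of boundary edges
  have hgN : ∀ x y, (x ∈ N₁ ∧ y ∈ N₁) ∨ (x ∈ N₂ ∧ y ∈ N₂) → g x = g y := by
    rintro x y (⟨h1, h2⟩ | ⟨h1, h2⟩)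
    · rw [(hR.eq_k _).2 h1, (hR.eq_k _).2 h2]
    · rw [(hR.eq_zero _).2 h1, (hR.eq_zero _).2 h2]
  have hoff : ∀ x, x ∉ Set.range b ∪ Set.range t → Q.Mixed f x ∨
      x ∈ {x | x ∉ Set.range b ∪ Set.range t ∧ x ∉ N₁ ∧ x ∉ N₂ ∧
        ∀ y, Q.graph.Adj x y → f y = f x} := by
    intro x hx
    by_cases hN : x ∈ N₁ ∨ x ∈ N₂
    · left
      obtain ⟨⟨y, hy, hy'⟩, z, hz, hz'⟩ := hh.mixed_side x hx hN
      have e1 := hgN _ _ (hR.boundary_cases_of_notMem hx hy)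
      have e2 := hgN _ _ (hR.boundary_cases_of_notMem hx hz)
      exact ⟨⟨y, hy.1, by simp only [hf, e1]; linarith⟩, z, hz.1, by simp only [hf, e2]; linarith⟩
    · rw [not_or] at hN
      have h0 : Q.laplacian c f x = 0 := by
        rw [hf, laplacian_sub_mul, hlap x hx hN.1 hN.2, hR.harmonic x hx hN.1 hN.2]; ring
      rcases eq_or_mixed_of_laplacian hR.conductance_pos h0 with hc | hM
      · exact .inr ⟨hx, hN.1, hN.2, hc⟩
      · exact .inl hM
  set S : Set W := {x | x ∉ Set.range b ∪ Set.range t ∧ x ∉ N₁ ∧ x ∉ N₂ ∧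
        ∀ y, Q.graph.Adj x y → f y = f x} with hS
  have key : ∀ p q : W, p ≠ q → Q.IsBoundaryVertex p → Q.IsBoundaryVertex q →
      (∀ x ∈ S, f x ≠ f p) → (∀ x ∈ S, f x ≠ f q) →
      (∀ x ∈ Set.range b ∪ Set.range t, x ≠ p → x ≠ q → Q.Mixed f x) →
      ∀ x, x ≠ p → x ≠ q → Q.Mixed f x := by
    intro p q hpq hp hq hfp hfq hRm
    have hm : ∀ x, x ≠ p → x ≠ q → Q.Mixed f x ∨ x ∈ S := by
      intro x hxp hxq
      by_cases hx : x ∈ Set.range b ∪ Set.range t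
      · exact .inl (hRm x hx hxp hxq)
      · exact hoff x hx
    have hSe : S = ∅ := by
      obtain ⟨χ, hχ, hχm⟩ := hR.exists_resolution
      exact hR.disk.eq_empty_of_flat hpq hp hq (fun x hx => hx.2.2.2) hm hfp hfq
        (fun T hT hne => hR.exists_exit T hne (Set.disjoint_left.2 fun x hx => (hT hx).1)) hχ
        (fun x hx => hχm x hx.1) (hR.exists_side fun x hx => hx.1)
    intro x hxp hxq
    refine (hm x hxp hxq).resolve_right fun h => ?_
    rw [hSe] at h; exact h
  have hgS : ∀ x ∈ S, 0 < g x ∧ g x < k := fun x hx =>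
    ⟨(hR.nonneg x).lt_of_ne fun e => hx.2.2.1 ((hR.eq_zero x).1 e.symm),
      (hR.le x).lt_of_ne fun e => hx.2.1 ((hR.eq_k x).1 e)⟩
  have hfb : ∀ i, f (b i) = - a * g (b i) := fun i => by simp only [hf, hh.eq_zero]; ring
  have hft : ∀ i, f (t i) = P - a * g (t i) := fun i => by simp only [hf, hh.eq_top]
  rcases lt_or_gt_of_ne ha with ha | ha
  · refine ⟨b (Fin.last n), t 0, hR.b_ne_t _ _, hR.isBoundaryVertex_b _,
      hR.swap.isBoundaryVertex_b _, ?_, key _ _ (hR.b_ne_t _ _) (hR.isBoundaryVertex_b _)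
      (hR.swap.isBoundaryVertex_b _) ?_ ?_ ?_⟩
    · rw [hh.eq_zero, hh.eq_top, hR.g_b_last, hR.swap.g_b_zero]; nlinarith
    · intro x hx
      have := (hgS x hx).1
      have := hh.nonneg x
      rw [hfb, hR.g_b_last]; simp only [hf]; nlinarith
    · intro x hx
      have := (hgS x hx).2
      have := hh.le x
      rw [hft, hR.swap.g_b_zero]; simp only [hf]; nlinarith
    · rintro x (⟨i, rfl⟩ | ⟨i, rfl⟩) hx1 hx2
      · obtain ⟨y, hy, ⟨j, rfl⟩, hgy⟩ := hR.exists_b_succ (i := i) (fun e => hx1 (by rw [e]))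
        refine ⟨⟨_, hy.1, by rw [hfb, hfb]; nlinarith⟩, ?_⟩
        by_cases hi : i = 0
        · subst hi
          obtain ⟨z, hz, hzN, hzR⟩ := hR.exists_adj_b_zero
          refine ⟨z, hz.1, ?_⟩
          have := hh.h_pos hzR
          rw [hfb, hR.g_b_zero]; simp only [hf, (hR.eq_k z).2 hzN]; linarith
        · obtain ⟨z, hz, ⟨j, rfl⟩, hgz⟩ := hR.exists_b_pred hi
          exact ⟨_, hz.1, by rw [hfb, hfb]; nlinarith⟩
      · obtain ⟨y, hy, ⟨j, rfl⟩, hgy⟩ := hR.swap.exists_b_pred (i := i) (fun e => hx2 (by rw [e]))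
        refine ⟨?_, _, hy.1, by rw [hft, hft]; nlinarith⟩
        by_cases hi : i = Fin.last n
        · subst hi
          obtain ⟨z, hz, hzN, hzR⟩ := hR.swap.exists_adj_b_last
          rw [Set.union_comm] at hzR
          refine ⟨z, hz.1, ?_⟩
          have := hh.h_lt hzR
          rw [hft, hR.swap.g_b_last]; simp only [hf, (hR.eq_zero z).2 hzN]; linarith
        · obtain ⟨z, hz, ⟨j, rfl⟩, hgz⟩ := hR.swap.exists_b_succ hi
          exact ⟨_, hz.1, by rw [hft, hft]; nlinarith⟩
  · refine ⟨b 0, t (Fin.last n), hR.b_ne_t _ _, hR.isBoundaryVertex_b _,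
      hR.swap.isBoundaryVertex_b _, ?_, key _ _ (hR.b_ne_t _ _) (hR.isBoundaryVertex_b _)
      (hR.swap.isBoundaryVertex_b _) ?_ ?_ ?_⟩
    · rw [hh.eq_zero, hh.eq_top, hR.g_b_zero, hR.swap.g_b_last]; nlinarith
    · intro x hx
      have := (hgS x hx).2
      have := hh.nonneg x
      rw [hfb, hR.g_b_zero]; simp only [hf]; nlinarith
    · intro x hx
      have := (hgS x hx).1
      have := hh.le x
      rw [hft, hR.swap.g_b_last]; simp only [hf]; nlinarith
    · rintro x (⟨i, rfl⟩ | ⟨i, rfl⟩) hx1 hx2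
      · obtain ⟨y, hy, ⟨j, rfl⟩, hgy⟩ := hR.exists_b_pred (i := i) (fun e => hx1 (by rw [e]))
        refine ⟨⟨_, hy.1, by rw [hfb, hfb]; nlinarith⟩, ?_⟩
        by_cases hi : i = Fin.last n
        · subst hi
          obtain ⟨z, hz, hzN, hzR⟩ := hR.exists_adj_b_last
          refine ⟨z, hz.1, ?_⟩
          have := hh.h_pos hzR
          rw [hfb, hR.g_b_last]; simp only [hf, (hR.eq_zero z).2 hzN]; linarith
        · obtain ⟨z, hz, ⟨j, rfl⟩, hgz⟩ := hR.exists_b_succ hi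
          exact ⟨_, hz.1, by rw [hfb, hfb]; nlinarith⟩
      · obtain ⟨y, hy, ⟨j, rfl⟩, hgy⟩ := hR.swap.exists_b_succ (i := i) (fun e => hx2 (by rw [e]))
        refine ⟨?_, _, hy.1, by rw [hft, hft]; nlinarith⟩
        by_cases hi : i = 0
        · subst hi
          obtain ⟨z, hz, hzN, hzR⟩ := hR.swap.exists_adj_b_zero
          rw [Set.union_comm] at hzR
          refine ⟨z, hz.1, ?_⟩
          have := hh.h_lt hzR
          rw [hft, hR.swap.g_b_zero]; simp only [hf, (hR.eq_k z).2 hzN]; linarith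
        · obtain ⟨z, hz, ⟨j, rfl⟩, hgz⟩ := hR.swap.exists_b_pred hi
          exact ⟨_, hz.1, by rw [hft, hft]; nlinarith⟩

/-- At every edge off the sides, the images of the two adjacent triangles lie on different sides of
the image of the edge. -/
lemma exists_above_below (hR : Q.IsGradedRectangle c N₁ N₂ b t g k)
    (hh : Q.IsStrictHeight N₁ N₂ b t h P)
    (hlap : ∀ x, x ∉ Set.range b ∪ Set.range t → x ∉ N₁ → x ∉ N₂ → Q.laplacian c h x = 0)
    {a : ℝ} {u v : W} (huv : Q.graph.Adj u v) (hf : h u - a * g u = h v - a * g v) :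
    (¬ (u ∈ Set.range t ∧ v ∈ Set.range t) →
      ∃ s ∈ Q.triangles, u ∈ s ∧ v ∈ s ∧ ∃ z ∈ s, h u - a * g u < h z - a * g z) ∧
    (¬ (u ∈ Set.range b ∧ v ∈ Set.range b) →
      ∃ s ∈ Q.triangles, u ∈ s ∧ v ∈ s ∧ ∃ z ∈ s, h z - a * g z < h u - a * g u) := by
  classical
  by_cases ha : a = 0
  · subst ha
    simp only [zero_mul, sub_zero] at hf ⊢
    by_cases hub : u ∈ Set.range b
    · have hvb : v ∈ Set.range b := hh.mem_b_iff.1 (hf ▸ hh.mem_b_iff.2 hub)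
      refine ⟨fun _ => ?_, fun h => absurd ⟨hub, hvb⟩ h⟩
      obtain ⟨hne, s, hs, hus, hvs⟩ := huv
      obtain ⟨z, hzu, hzv, rfl⟩ := eq_triple_of_mem hs hus hvs hne
      refine ⟨_, hs, hus, hvs, z, by simp, ?_⟩
      have := notMem_range_of_triangle hh.chordless_b hR.b_injective hs hus hvs (by simp) hne
        hzu.symm hzv.symm hub hvb
      rw [hh.mem_b_iff.2 hub]
      exact (hh.nonneg z).lt_of_ne fun e => this (hh.mem_b_iff.1 e.symm)
    by_cases hut : u ∈ Set.range t
    · have hvt : v ∈ Set.range t := hh.mem_t_iff.1 (hf ▸ hh.mem_t_iff.2 hut)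
      refine ⟨fun h => absurd ⟨hut, hvt⟩ h, fun _ => ?_⟩
      obtain ⟨hne, s, hs, hus, hvs⟩ := huv
      obtain ⟨z, hzu, hzv, rfl⟩ := eq_triple_of_mem hs hus hvs hne
      refine ⟨_, hs, hus, hvs, z, by simp, ?_⟩
      have := notMem_range_of_triangle hh.chordless_t hR.swap.b_injective hs hus hvs (by simp) hne
        hzu.symm hzv.symm hut hvt
      rw [hh.mem_t_iff.2 hut]
      exact (hh.le z).lt_of_ne fun e => this (hh.mem_t_iff.1 e)
    · have huR : u ∉ Set.range b ∪ Set.range t := fun h => h.elim hub hut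
      set κ : W → ℝ := fun x => if x ∈ Set.range b ∪ Set.range t then g x else 0 with hκ
      have κR : ∀ x ∈ Set.range b ∪ Set.range t, κ x = g x := fun x hx => by
        simp only [hκ, if_pos hx]
      have κ0 : ∀ x, h x = h u → κ x = κ u := fun x hx => by
        have hxR : x ∉ Set.range b ∪ Set.range t := by
          rintro (h' | h')
          · exact hub (hh.mem_b_iff.1 (hx ▸ hh.mem_b_iff.2 h'))
          · exact hut (hh.mem_t_iff.1 (hx ▸ hh.mem_t_iff.2 h'))
        simp only [hκ, if_neg hxR, if_neg huR]
      have hm : ∀ x, x ≠ b (Fin.last n) → x ≠ t 0 → Q.Mixed (fun x => toLex (h x, κ x)) x := by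
        intro x hx1 hx2
        by_cases hx : x ∈ Set.range b ∪ Set.range t
        · exact hR.mixed_lex_of_mem hh.eq_zero hh.eq_top (fun x hx => ⟨hh.h_pos hx, hh.h_lt hx⟩) κR
            hx hx1 hx2
        · obtain ⟨⟨z, hz, hz'⟩, w, hw, hw'⟩ := hh.mixed x hx
          exact ⟨⟨z, hz, Prod.Lex.toLex_lt_toLex.2 (.inl hz')⟩,
            w, hw, Prod.Lex.toLex_lt_toLex.2 (.inl hw')⟩
      obtain ⟨⟨s, hs, hus, hvs, z, hz, hz'⟩, s', hs', hus', hvs', z', hzs', hzz⟩ :=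
        hR.disk.exists_triangles (hR.b_ne_t _ _) (hR.isBoundaryVertex_b _)
          (hR.swap.isBoundaryVertex_b _) hm (x := u) (y := v)
          (fun e => huR (.inl ⟨_, e.symm⟩)) (fun e => huR (.inr ⟨_, e.symm⟩)) huv
          (by simp only [κ0 v hf.symm, hf])
      rw [Prod.Lex.toLex_lt_toLex] at hz' hzz
      exact ⟨fun _ => ⟨s', hs', hus', hvs', z', hzs', hzz.resolve_right
        fun h => h.2.ne (κ0 _ h.1.symm).symm⟩,
        fun _ => ⟨s, hs, hus, hvs, z, hz, hz'.resolve_right fun h => h.2.ne (κ0 _ h.1)⟩⟩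
  · obtain ⟨p, q, hpq, hp, hq, hfpq, hm⟩ := hR.mixed_sub_mul hh hlap ha
    suffices H : (∃ s ∈ Q.triangles, u ∈ s ∧ v ∈ s ∧ ∃ z ∈ s, h z - a * g z < h u - a * g u) ∧
        ∃ s ∈ Q.triangles, u ∈ s ∧ v ∈ s ∧ ∃ z ∈ s, h u - a * g u < h z - a * g z from
      ⟨fun _ => H.2, fun _ => H.1⟩
    by_cases hu : u ≠ p ∧ u ≠ q
    · exact hR.disk.exists_triangles hpq hp hq hm hu.1 hu.2 huv hf.symm
    · have hv : v ≠ p ∧ v ≠ q := by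
        have hne := huv.1
        constructor
        · rintro rfl
          rcases not_and_or.1 hu with h | h
          · exact hne (not_not.1 h)
          · rw [not_not] at h; subst h; exact hfpq hf.symm
        · rintro rfl
          rcases not_and_or.1 hu with h | h
          · rw [not_not] at h; subst h; exact hfpq hf
          · exact hne (not_not.1 h)
      obtain ⟨⟨s, hs, hvs, hus, z, hz, hz'⟩, s', hs', hvs', hus', z', hzs', hzz⟩ :=
        hR.disk.exists_triangles hpq hp hq hm hv.1 hv.2 huv.symm hf
      rw [← hf] at hz' hzz
      exact ⟨⟨s, hs, hus, hvs, z, hz, hz'⟩, s', hs', hus', hvs', z', hzs', hzz⟩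

/-- No triangle has all its vertices in `N₁` or in `N₂`. -/
lemma exists_g_ne (hR : Q.IsGradedRectangle c N₁ N₂ b t g k) {x y z : W}
    {s : Finset W} (hs : s ∈ Q.triangles) (hx : x ∈ s) (hy : y ∈ s) (hz : z ∈ s) (hxy : x ≠ y)
    (hxz : x ≠ z) (hyz : y ≠ z) (h1 : g y = g x) : g z ≠ g x := by
  intro h2
  have hb := hR.boundary_of_eq x y (adj_of_mem hs hx hy hxy) h1.symm
  refine hR.ne_of_boundary_triangle hs hx hy hz hxz.symm hyz.symm hb ?_ h1 h2
  by_cases hxR : x ∈ Set.range b ∪ Set.range t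
  · have key : ∀ {b t : Fin (n + 1) → W} (_ : Q.IsGradedRectangle c N₁ N₂ b t g k),
    x ∈ Set.range b →
        ∃ w, Q.graph.Adj x w ∧ g w ≠ g x := by
      rintro b t hR ⟨i, rfl⟩
      by_cases hi : i = 0
      · have hn : i ≠ Fin.last n := by
          rw [hi]; intro e
          have := congrArg Fin.val e
          have := hR.n_pos
          simp at *; omega
        obtain ⟨w, hw, -, hw'⟩ := hR.exists_b_succ hn
        exact ⟨w, hw.1, hw'.ne⟩
      · obtain ⟨w, hw, -, hw'⟩ := hR.exists_b_pred hi
        exact ⟨w, hw.1, hw'.ne'⟩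
    rcases hxR with h | h
    · exact key hR h
    · exact key hR.swap h
  · rcases hR.boundary_cases_of_notMem hxR hb with ⟨h, -⟩ | ⟨h, -⟩
    · obtain ⟨w, hw, hw'⟩ := hR.exists_adj_lt x h hxR
      exact ⟨w, hw, hw'.ne⟩
    · obtain ⟨w, hw, hw'⟩ := hR.exists_adj_gt x h hxR
      exact ⟨w, hw, hw'.ne'⟩

/-- The image of a triangle under `(g, h)` is not degenerate. -/
lemma det_ne_zero (hR : Q.IsGradedRectangle c N₁ N₂ b t g k)
    (hh : Q.IsStrictHeight N₁ N₂ b t h P)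
    (hlap : ∀ x, x ∉ Set.range b ∪ Set.range t → x ∉ N₁ → x ∉ N₂ → Q.laplacian c h x = 0)
    {s : Finset W} (hs : s ∈ Q.triangles) {x y z : W} (hx : x ∈ s) (hy : y ∈ s) (hz : z ∈ s)
    (hxy : x ≠ y) (hxz : x ≠ z) (hyz : y ≠ z) :
    (g y - g x) * (h z - h x) - (g z - g x) * (h y - h x) ≠ 0 := by
  classical
  -- it suffices to treat an edge on which `g` is not constant
  have key : ∀ x ∈ s, ∀ y ∈ s, ∀ z ∈ s, x ≠ y → x ≠ z → y ≠ z → g x ≠ g y →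
      (g y - g x) * (h z - h x) - (g z - g x) * (h y - h x) ≠ 0 := by
    clear! x y z
    intro x hx y hy z hz hxy hxz hyz hg hdet
    have hadj := adj_of_mem hs hx hy hxy
    have hg' : g y - g x ≠ 0 := sub_ne_zero.2 hg.symm
    set a := (h y - h x) / (g y - g x) with ha
    have hay : h x - a * g x = h y - a * g y := by
      have : a * (g y - g x) = h y - h x := by rw [ha]; field_simp
      linarith
    have haz : h z - a * g z = h x - a * g x := by
      have : a * (g y - g x) = h y - h x := by rw [ha]; field_simp
      have h2 : (g y - g x) * ((h z - h x) - a * (g z - g x)) = 0 := by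
        rw [← this] at hdet; linear_combination hdet
      have := (mul_eq_zero.1 h2).resolve_left hg'
      linarith
    have hall : ∀ w ∈ s, h w - a * g w = h x - a * g x := by
      obtain ⟨w, -, -, rfl⟩ := eq_triple_of_mem hs hx hy hxy
      simp only [Finset.mem_insert, Finset.mem_singleton] at hz ⊢
      rintro v (rfl | rfl | rfl)
      · rfl
      · exact hay.symm
      · rcases hz with h | h | h
        · exact absurd h.symm hxz
        · exact absurd h.symm hyz
        · rw [← h]; exact haz
    obtain ⟨hA, hB⟩ := hR.exists_above_below hh hlap hadj hay
    have hA' : ¬ (x ∈ Set.range t ∧ y ∈ Set.range t) → ∃ s' ∈ Q.triangles, x ∈ s' ∧ y ∈ s' ∧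
        s' ≠ s ∧ ∃ z ∈ s', h x - a * g x < h z - a * g z := by
      intro h
      obtain ⟨s', hs', hx', hy', w, hw, hw'⟩ := hA h
      exact ⟨s', hs', hx', hy', fun e => (hall w (e ▸ hw)).not_gt hw', w, hw, hw'⟩
    have hB' : ¬ (x ∈ Set.range b ∧ y ∈ Set.range b) → ∃ s' ∈ Q.triangles, x ∈ s' ∧ y ∈ s' ∧
        s' ≠ s ∧ ∃ z ∈ s', h z - a * g z < h x - a * g x := by
      intro h
      obtain ⟨s', hs', hx', hy', w, hw, hw'⟩ := hB h
      exact ⟨s', hs', hx', hy', fun e => (hall w (e ▸ hw)).not_lt hw', w, hw, hw'⟩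
    have hsub : ∀ T : Finset (Finset W), (∀ s' ∈ T, s' ∈ Q.triangles ∧ x ∈ s' ∧ y ∈ s') →
        T.card ≤ Q.edgeDegree x y := fun T hT => Finset.card_le_card fun s' hs' => by
      simpa using hT s' hs'
    by_cases hxb : x ∈ Set.range b ∧ y ∈ Set.range b
    · have hxt : ¬ (x ∈ Set.range t ∧ y ∈ Set.range t) := by
        obtain ⟨⟨i, rfl⟩, -⟩ := hxb
        rintro ⟨⟨j, hj⟩, -⟩
        exact hR.b_ne_t _ _ hj.symm
      obtain ⟨s', hs', hx', hy', hne, -⟩ := hA' hxt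
      obtain ⟨⟨i, rfl⟩, j, rfl⟩ := hxb
      have h1 := (boundaryGraph_adj_iff.1 (hR.adj_of_isPathEdge (hh.chordless_b i j hadj))).2
      have h2 := hsub {s', s} (by simp [hs, hs', hx, hy, hx', hy'])
      rw [Finset.card_pair hne] at h2
      omega
    by_cases hxt : x ∈ Set.range t ∧ y ∈ Set.range t
    · obtain ⟨s', hs', hx', hy', hne, -⟩ := hB' hxb
      obtain ⟨⟨i, rfl⟩, j, rfl⟩ := hxt
      have h1 := (boundaryGraph_adj_iff.1 (hR.swap.adj_of_isPathEdge (hh.chordless_t i j hadj))).2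
      have h2 := hsub {s', s} (by simp [hs, hs', hx, hy, hx', hy'])
      rw [Finset.card_pair hne] at h2
      omega
    · obtain ⟨s₁, hs₁, hx₁, hy₁, hne₁, w₁, hw₁, hw₁'⟩ := hA' hxt
      obtain ⟨s₂, hs₂, hx₂, hy₂, hne₂, w₂, hw₂, hw₂'⟩ := hB' hxb
      have hne : s₁ ≠ s₂ := by
        rintro rfl
        obtain ⟨w, -, -, rfl⟩ := eq_triple_of_mem hs₁ hx₁ hy₁ hxy
        simp only [Finset.mem_insert, Finset.mem_singleton] at hw₁ hw₂
        rcases hw₁ with rfl | rfl | rfl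
        · exact lt_irrefl _ hw₁'
        · exact hw₁'.ne hay
        · rcases hw₂ with rfl | rfl | rfl
          · exact lt_irrefl _ hw₂'
          · exact hw₂'.ne' hay
          · exact lt_asymm hw₁' hw₂'
      have h2 := hsub {s₁, s₂, s} (by simp [hs, hs₁, hs₂, hx, hy, hx₁, hy₁, hx₂, hy₂])
      have h3 := hR.disk.edge_le_two x y hadj
      rw [Finset.card_eq_three.2 ⟨s₁, s₂, s, hne, hne₁, hne₂, rfl⟩] at h2
      omega
  by_cases hg : g x = g y
  · have hg2 := hR.exists_g_ne hs hx hy hz hxy hxz hyz hg.symm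
    intro h0
    refine key x hx z hz y hy hxz hxy hyz.symm hg2.symm ?_
    linear_combination -h0
  · exact key x hx y hy z hz hxy hxz hyz hg

end IsGradedRectangle

end Fold

/-! ### Maps of triangulated surfaces onto a rectangle -/

section FoldFree

variable {W : Type*}

/-- Twice the signed area of the image of the triangle `x y z` under `(g, h)`. -/
def signedArea (g h : W → ℝ) (x y z : W) : ℝ :=
  (g y - g x) * (h z - h x) - (g z - g x) * (h y - h x)

lemma signedArea_swap₁₃ (g h : W → ℝ) (x y z : W) :
    signedArea g h z y x = - signedArea g h x y z := by
  simp only [signedArea]; ring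

lemma signedArea_swap₂₃ (g h : W → ℝ) (x y z : W) :
    signedArea g h x z y = - signedArea g h x y z := by
  simp only [signedArea]; ring

/-- The vertices `u`, `v`, `z` are the three vertices of a triangle of `Q`. -/
def Spans (Q : TriComplex W) (u v z : W) : Prop :=
  u ≠ v ∧ u ≠ z ∧ v ≠ z ∧ ∃ s ∈ Q.triangles, u ∈ s ∧ v ∈ s ∧ z ∈ s

lemma Spans.swap₁₃ {Q : TriComplex W} {u v z : W} (h : Q.Spans u v z) : Q.Spans z v u :=
  ⟨h.2.2.1.symm, h.2.1.symm, h.1.symm, h.2.2.2.imp fun _ hs => ⟨hs.1, hs.2.2.2, hs.2.2.1, hs.2.1⟩⟩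

lemma Spans.swap₂₃ {Q : TriComplex W} {u v z : W} (h : Q.Spans u v z) : Q.Spans u z v :=
  ⟨h.2.1, h.1, h.2.2.1.symm, h.2.2.2.imp fun _ hs => ⟨hs.1, hs.2.1, hs.2.2.2, hs.2.2.1⟩⟩

/-- The map `(g, h)` takes `Q` into the rectangle with sides `k` and `P`, it is not degenerate on
triangles, and it does not fold `Q` along any edge, except at the top and at the base of the
rectangle; the edges that are mapped there form a path from left to right. The last condition is
stated as: exactly one of these edges lies over each point of `[0, k]`, where the edges are taken
without their left ends (`base`, `top`), respectively without their right ends (`base'`, `top'`). In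
this form all the conditions are invariant under the reflections of the rectangle. -/
structure IsFoldFree (Q : TriComplex W) (g h : W → ℝ) (k P : ℝ) : Prop where
  k_pos : 0 < k
  P_pos : 0 < P
  g_nonneg : ∀ x, 0 ≤ g x
  g_le : ∀ x, g x ≤ k
  h_nonneg : ∀ x, 0 ≤ h x
  h_le : ∀ x, h x ≤ P
  area_ne : ∀ u v z, Q.Spans u v z → signedArea g h u v z ≠ 0
  exists_above : ∀ u v, Q.graph.Adj u v → g u < g v → ¬ (h u = P ∧ h v = P) →
    ∃ z, Q.Spans u v z ∧ 0 < signedArea g h u v z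
  exists_below : ∀ u v, Q.graph.Adj u v → g u < g v → ¬ (h u = 0 ∧ h v = 0) →
    ∃ z, Q.Spans u v z ∧ signedArea g h u v z < 0
  unique : ∀ u v z z', g u ≠ g v → Q.Spans u v z → Q.Spans u v z' →
    0 < signedArea g h u v z * signedArea g h u v z' → z = z'
  base : ∀ a, 0 < a → a ≤ k → ∃! e : W × W, Q.graph.Adj e.1 e.2 ∧ g e.1 < a ∧ a ≤ g e.2 ∧
    h e.1 = 0 ∧ h e.2 = 0
  base' : ∀ a, 0 ≤ a → a < k → ∃! e : W × W, Q.graph.Adj e.1 e.2 ∧ g e.1 ≤ a ∧ a < g e.2 ∧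
    h e.1 = 0 ∧ h e.2 = 0
  top : ∀ a, 0 < a → a ≤ k → ∃! e : W × W, Q.graph.Adj e.1 e.2 ∧ g e.1 < a ∧ a ≤ g e.2 ∧
    h e.1 = P ∧ h e.2 = P
  top' : ∀ a, 0 ≤ a → a < k → ∃! e : W × W, Q.graph.Adj e.1 e.2 ∧ g e.1 ≤ a ∧ a < g e.2 ∧
    h e.1 = P ∧ h e.2 = P
  exists_lt : ∀ v, 0 < g v → ∃ l, Q.graph.Adj v l ∧ g l < g v
  exists_gt : ∀ v, g v < k → ∃ r, Q.graph.Adj v r ∧ g v < g r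
  eq_or_eq : ∀ u v, Q.graph.Adj u v → g u = g v → g u = 0 ∨ g u = k

namespace IsFoldFree

variable {Q : TriComplex W} {g h : W → ℝ} {k P : ℝ}

lemma flip_right (hF : Q.IsFoldFree g h k P) : Q.IsFoldFree g (fun x => P - h x) k P := by
  have hA : ∀ u v z, signedArea g (fun x => P - h x) u v z = - signedArea g h u v z := by
    intros; simp only [signedArea]; ring
  have e0 : ∀ x, P - h x = 0 ↔ h x = P := fun x => by rw [sub_eq_zero, eq_comm]
  have e1 : ∀ x, P - h x = P ↔ h x = 0 := fun x => by constructor <;> intro h <;> linarith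
  refine ⟨hF.k_pos, hF.P_pos, hF.g_nonneg, hF.g_le, fun x => sub_nonneg.2 (hF.h_le x),
    fun x => sub_le_self _ (hF.h_nonneg x), ?_, ?_, ?_, ?_, ?_, ?_, ?_, ?_, hF.exists_lt,
    hF.exists_gt, hF.eq_or_eq⟩
  · intro u v z hs; rw [hA]; exact neg_ne_zero.2 (hF.area_ne u v z hs)
  · intro u v; simp only [hA, e1, neg_pos]; exact hF.exists_below u v
  · intro u v; simp only [hA, e0, neg_lt_zero]; exact hF.exists_above u v
  · intro u v z z'; simp only [hA, neg_mul_neg]; exact hF.unique u v z z'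
  · simp only [e0]; exact hF.top
  · simp only [e0]; exact hF.top'
  · simp only [e1]; exact hF.base
  · simp only [e1]; exact hF.base'

lemma flip_left (hF : Q.IsFoldFree g h k P) : Q.IsFoldFree (fun x => k - g x) h k P := by
  have hA : ∀ u v z, signedArea (fun x => k - g x) h u v z = - signedArea g h u v z := by
    intros; simp only [signedArea]; ring
  have hA2 : ∀ u v z, signedArea g h v u z = - signedArea g h u v z := by
    intros; simp only [signedArea]; ring
  have hs : ∀ u v z, Q.Spans v u z → Q.Spans u v z := fun u v z h => h.swap₁₃.swap₂₃.swap₁₃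
  have key : ∀ (p : W → Prop) (q : W × W → Prop), (∃! e : W × W, Q.graph.Adj e.1 e.2 ∧ q e ∧ p e.1
    ∧ p e.2) →
      ∀ (q' : W × W → Prop), (∀ e, q' e ↔ q e.swap) →
      ∃! e : W × W, Q.graph.Adj e.1 e.2 ∧ q' e ∧ p e.1 ∧ p e.2 := by
    rintro p q ⟨e, ⟨h1, h2, h3, h4⟩, he⟩ q' hq
    refine ⟨e.swap, ⟨h1.symm, (hq _).2 (by simpa using h2), h4, h3⟩, ?_⟩
    rintro e' ⟨h1', h2', h3', h4'⟩
    rw [← he e'.swap ⟨h1'.symm, (hq _).1 h2', h4', h3'⟩, Prod.swap_swap]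
  refine ⟨hF.k_pos, hF.P_pos, fun x => sub_nonneg.2 (hF.g_le x),
    fun x => sub_le_self _ (hF.g_nonneg x), hF.h_nonneg, hF.h_le, ?_, ?_, ?_, ?_, ?_, ?_, ?_, ?_,
    ?_, ?_, ?_⟩
  · intro u v z hs; rw [hA]; exact neg_ne_zero.2 (hF.area_ne u v z hs)
  · intro u v huv hg hP
    obtain ⟨z, hz, hz'⟩ := hF.exists_above v u huv.symm (by linarith) (fun h => hP h.symm)
    exact ⟨z, hs _ _ _ hz, by rw [hA, ← hA2]; exact hz'⟩
  · intro u v huv hg hP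
    obtain ⟨z, hz, hz'⟩ := hF.exists_below v u huv.symm (by linarith) (fun h => hP h.symm)
    exact ⟨z, hs _ _ _ hz, by rw [hA, ← hA2]; exact hz'⟩
  · intro u v z z' hg; simp only [hA, neg_mul_neg]
    exact hF.unique u v z z' fun e => hg (by rw [e])
  · intro a h0 hk
    have := key (h · = 0) (fun e => g e.1 ≤ k - a ∧ k - a < g e.2)
      (by simpa only [and_assoc] using hF.base' (k - a) (by linarith) (by linarith))
      (fun e => k - g e.1 < a ∧ a ≤ k - g e.2)
      (fun e => by simp only [Prod.fst_swap, Prod.snd_swap]; constructor <;> rintro ⟨h1,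
        h2⟩ <;> constructor <;> linarith)
    simpa only [and_assoc] using this
  · intro a h0 hk
    have := key (h · = 0) (fun e => g e.1 < k - a ∧ k - a ≤ g e.2)
      (by simpa only [and_assoc] using hF.base (k - a) (by linarith) (by linarith))
      (fun e => k - g e.1 ≤ a ∧ a < k - g e.2)
      (fun e => by simp only [Prod.fst_swap, Prod.snd_swap]; constructor <;> rintro ⟨h1,
        h2⟩ <;> constructor <;> linarith)
    simpa only [and_assoc] using this
  · intro a h0 hk
    have := key (h · = P) (fun e => g e.1 ≤ k - a ∧ k - a < g e.2)
      (by simpa only [and_assoc] using hF.top' (k - a) (by linarith) (by linarith))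
      (fun e => k - g e.1 < a ∧ a ≤ k - g e.2)
      (fun e => by simp only [Prod.fst_swap, Prod.snd_swap]; constructor <;> rintro ⟨h1,
        h2⟩ <;> constructor <;> linarith)
    simpa only [and_assoc] using this
  · intro a h0 hk
    have := key (h · = P) (fun e => g e.1 < k - a ∧ k - a ≤ g e.2)
      (by simpa only [and_assoc] using hF.top (k - a) (by linarith) (by linarith))
      (fun e => k - g e.1 ≤ a ∧ a < k - g e.2)
      (fun e => by simp only [Prod.fst_swap, Prod.snd_swap]; constructor <;> rintro ⟨h1,
        h2⟩ <;> constructor <;> linarith)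
    simpa only [and_assoc] using this
  · intro v hv
    obtain ⟨l, hl, hl'⟩ := hF.exists_gt v (by linarith)
    exact ⟨l, hl, by linarith⟩
  · intro v hv
    obtain ⟨l, hl, hl'⟩ := hF.exists_lt v (by linarith)
    exact ⟨l, hl, by linarith⟩
  · intro u v huv he
    rcases hF.eq_or_eq u v huv (by linarith) with h | h
    · right; linarith
    · left; linarith

/-! ### Counting the triangles over a point of the rectangle -/

/-- The height at which the image of the edge `u v` crosses the vertical line at `a`. -/
def crossing (g h : W → ℝ) (a : ℝ) (u v : W) : ℝ :=
  h u + (a - g u) / (g v - g u) * (h v - h u)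

lemma mul_sub_crossing {u v : W} (huv : g u < g v) (a b : ℝ) :
    (g v - g u) * (b - crossing g h a u v) = (g v - g u) * (b - h u) - (a - g u) * (h v - h u) := by
  have : g v - g u ≠ 0 := (sub_pos.2 huv).ne'
  simp only [crossing]
  field_simp
  ring

/-- If the edge `u v` of the triangle `f = (u, v, z)` crosses the vertical line at `a` from left to
right, this is the same triangle with the other edge that crosses the line. -/
def otherEdge (g : W → ℝ) (a : ℝ) (f : W × W × W) : W × W × W :=
  open Classical in if g f.2.2 < a then (f.2.2, f.2.1, f.1) else (f.1, f.2.2, f.2.1)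

/-- `f = (u, v, z)` is a triangle with an edge `u v` that crosses the vertical line at `a`; the
right end of the edge may lie on this line. -/
def IsFlag (Q : TriComplex W) (g : W → ℝ) (a : ℝ) (f : W × W × W) : Prop :=
  Q.Spans f.1 f.2.1 f.2.2 ∧ g f.1 < a ∧ a ≤ g f.2.1

lemma IsFlag.otherEdge {a : ℝ} {f : W × W × W} (hf : IsFlag Q g a f) :
    IsFlag Q g a (otherEdge g a f) := by
  rw [IsFoldFree.otherEdge]
  split_ifs with h
  · exact ⟨hf.1.swap₁₃, h, hf.2.2⟩
  · exact ⟨hf.1.swap₂₃, hf.2.1, not_lt.1 h⟩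

lemma IsFlag.otherEdge_otherEdge {a : ℝ} {f : W × W × W} (hf : IsFlag Q g a f) :
    IsFoldFree.otherEdge g a (IsFoldFree.otherEdge g a f) = f := by
  simp only [IsFoldFree.otherEdge]
  split_ifs with h h1 h2
  · rfl
  · exact absurd hf.2.1 h1
  · exact absurd h2 (not_lt.2 hf.2.2)
  · rfl

lemma signedArea_otherEdge (a : ℝ) (f : W × W × W) :
    signedArea g h (otherEdge g a f).1 (otherEdge g a f).2.1 (otherEdge g a f).2.2 =
      - signedArea g h f.1 f.2.1 f.2.2 := by
  rw [otherEdge]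
  split_ifs
  · exact signedArea_swap₁₃ ..
  · exact signedArea_swap₂₃ ..

/-- The triangle above a crossing edge leaves the line at a higher point. -/
lemma IsFlag.crossing_le {a : ℝ} {f : W × W × W} (hf : IsFlag Q g a f)
    (hpos : 0 < signedArea g h f.1 f.2.1 f.2.2) :
    crossing g h a f.1 f.2.1 ≤
      crossing g h a (IsFoldFree.otherEdge g a f).1 (IsFoldFree.otherEdge g a f).2.1 := by
  obtain ⟨u, v, z⟩ := f
  obtain ⟨-, hu, hv⟩ := hf
  simp only at hu hv hpos
  rw [signedArea] at hpos
  have huv : 0 < g v - g u := by linarith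
  rw [← sub_nonneg, IsFoldFree.otherEdge]
  simp only
  split_ifs with hz
  · have hzv : 0 < g v - g z := by linarith
    have e : crossing g h a z v - crossing g h a u v = (g v - a) *
        ((g v - g u) * (h z - h u) - (g z - g u) * (h v - h u)) / ((g v - g z) * (g v - g u)) := by
      simp only [crossing]; field_simp; ring
    simp only [e]
    have : 0 ≤ g v - a := by linarith
    positivity
  · have hzu : 0 < g z - g u := by linarith
    have e : crossing g h a u z - crossing g h a u v = (a - g u) *
        ((g v - g u) * (h z - h u) - (g z - g u) * (h v - h u)) / ((g z - g u) * (g v - g u)) := by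
      simp only [crossing]; field_simp; ring
    simp only [e]
    have : 0 ≤ a - g u := by linarith
    positivity

/-- Exactly one triangle lies over each point of the rectangle, if the triangles are taken without
their upper sides and without their left ends. -/
lemma existsUnique_flag [Fintype W] (hF : Q.IsFoldFree g h k P) {a b : ℝ} (ha : 0 < a)
    (hak : a ≤ k) (hb : 0 ≤ b)
    (hbP : b < P) : ∃! f : W × W × W, IsFlag Q g a f ∧ 0 < signedArea g h f.1 f.2.1 f.2.2 ∧
      crossing g h a f.1 f.2.1 ≤ b ∧
      b < crossing g h a (otherEdge g a f).1 (otherEdge g a f).2.1 := by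
  classical
  set H : W × W → ℝ := fun e => crossing g h a e.1 e.2 with hH
  set A : Finset (W × W × W) := Finset.univ.filter fun f => IsFlag Q g a f ∧
    0 < signedArea g h f.1 f.2.1 f.2.2 ∧ crossing g h a f.1 f.2.1 ≤ b with hA
  set B : Finset (W × W × W) := Finset.univ.filter fun f => IsFlag Q g a f ∧
    signedArea g h f.1 f.2.1 f.2.2 < 0 ∧ crossing g h a f.1 f.2.1 ≤ b with hB
  set E : Finset (W × W) := Finset.univ.filter fun e => Q.graph.Adj e.1 e.2 ∧ g e.1 < a
    ∧ a ≤ g e.2 ∧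
    crossing g h a e.1 e.2 ≤ b with hE
  set E' : Finset (W × W) := E.filter fun e => ¬ (h e.1 = 0 ∧ h e.2 = 0) with hE'
  have hadj : ∀ {u v z}, Q.Spans u v z → Q.graph.Adj u v := fun h =>
    ⟨h.1, h.2.2.2.imp fun _ hs => ⟨hs.1, hs.2.1, hs.2.2.1⟩⟩
  have hinj : ∀ f f' : W × W × W, IsFlag Q g a f → IsFlag Q g a f' →
      0 < signedArea g h f.1 f.2.1 f.2.2 * signedArea g h f'.1 f'.2.1 f'.2.2 →
      (f.1, f.2.1) = (f'.1, f'.2.1) → f = f' := by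
    rintro ⟨u, v, z⟩ ⟨u', v', z'⟩ hf hf' hm he
    obtain ⟨rfl, rfl⟩ := Prod.mk.inj he
    simp only at hm
    rw [hF.unique u v z z' (hf.2.1.trans_le hf.2.2).ne hf.1 hf'.1 hm]
  -- there is one triangle above each crossing edge, except for the one at height `P > b`
  have cA : A.card = E.card := by
    refine Finset.card_bij (fun f _ => (f.1, f.2.1)) ?_ ?_ ?_
    · intro f hf
      simp only [hA, hE, Finset.mem_filter, Finset.mem_univ, true_and] at hf ⊢
      exact ⟨hadj hf.1.1, hf.1.2.1, hf.1.2.2, hf.2.2⟩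
    · intro f hf f' hf' he
      simp only [hA, Finset.mem_filter, Finset.mem_univ, true_and] at hf hf'
      exact hinj f f' hf.1 hf'.1 (mul_pos hf.2.1 hf'.2.1) he
    · rintro ⟨u, v⟩ he
      simp only [hE, Finset.mem_filter, Finset.mem_univ, true_and] at he
      obtain ⟨h1, h2, h3, h4⟩ := he
      obtain ⟨z, hz, hz'⟩ := hF.exists_above u v h1 (h2.trans_le h3) (by
        rintro ⟨e1, e2⟩
        rw [crossing, e1, e2] at h4; linarith)
      exact ⟨(u, v, z), by simp only [hA, Finset.mem_filter, Finset.mem_univ, true_and];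
                           exact ⟨⟨hz, h2, h3⟩, hz', h4⟩, rfl⟩
  -- there is one triangle below each crossing edge, except for the one at height `0`
  have cB : B.card = E'.card := by
    refine Finset.card_bij (fun f _ => (f.1, f.2.1)) ?_ ?_ ?_
    · rintro ⟨u, v, z⟩ hf
      simp only [hB, hE', hE, Finset.mem_filter, Finset.mem_univ, true_and] at hf ⊢
      refine ⟨⟨hadj hf.1.1, hf.1.2.1, hf.1.2.2, hf.2.2⟩, ?_⟩
      rintro ⟨e1, e2⟩
      have h1 := hf.2.1
      rw [signedArea, e1, e2] at h1
      have h2 := hF.h_nonneg z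
      have h3 := hf.1.2.1.trans_le hf.1.2.2
      simp only at h3
      nlinarith
    · intro f hf f' hf' he
      simp only [hB, Finset.mem_filter, Finset.mem_univ, true_and] at hf hf'
      exact hinj f f' hf.1 hf'.1 (mul_pos_of_neg_of_neg hf.2.1 hf'.2.1) he
    · rintro ⟨u, v⟩ he
      simp only [hE', hE, Finset.mem_filter, Finset.mem_univ, true_and] at he
      obtain ⟨⟨h1, h2, h3, h4⟩, h5⟩ := he
      obtain ⟨z, hz, hz'⟩ := hF.exists_below u v h1 (h2.trans_le h3) h5
      exact ⟨(u, v, z), by simp only [hB, Finset.mem_filter, Finset.mem_univ, true_and];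
                           exact ⟨⟨hz, h2, h3⟩, hz', h4⟩, rfl⟩
  have cE : E.card = E'.card + 1 := by
    obtain ⟨e, he, hu⟩ := hF.base a ha hak
    have : E.filter (fun e => h e.1 = 0 ∧ h e.2 = 0) = {e} := by
      ext e'
      simp only [hE, Finset.mem_filter, Finset.mem_univ, true_and, Finset.mem_singleton]
      constructor
      · rintro ⟨⟨h1, h2, h3, -⟩, h4, h5⟩
        exact hu e' ⟨h1, h2, h3, h4, h5⟩
      · rintro rfl
        refine ⟨⟨he.1, he.2.1, he.2.2.1, ?_⟩, he.2.2.2⟩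
        rw [crossing, he.2.2.2.1, he.2.2.2.2]; simpa using hb
    rw [← Finset.card_filter_add_card_filter_not (s := E) (fun e => h e.1 = 0 ∧ h e.2 = 0), this,
      Finset.card_singleton, add_comm]
  -- a triangle whose upper side is at height at most `b` is one in `B`, seen from its upper side
  have cA' : (A.filter fun f => crossing g h a (otherEdge g a f).1 (otherEdge g a f).2.1 ≤ b).card
      = B.card := by
    refine Finset.card_bij (fun f _ => otherEdge g a f) ?_ ?_ ?_
    · intro f hf
      simp only [hA, hB, Finset.mem_filter, Finset.mem_univ, true_and] at hf ⊢
      refine ⟨hf.1.1.otherEdge, ?_, hf.2⟩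
      rw [signedArea_otherEdge]; exact neg_lt_zero.2 hf.1.2.1
    · intro f hf f' hf' he
      simp only [hA, Finset.mem_filter, Finset.mem_univ, true_and] at hf hf'
      rw [← hf.1.1.otherEdge_otherEdge, he, hf'.1.1.otherEdge_otherEdge]
    · intro f hf
      simp only [hB, Finset.mem_filter, Finset.mem_univ, true_and] at hf
      have hs : 0 < signedArea g h (otherEdge g a f).1 (otherEdge g a f).2.1
        (otherEdge g a f).2.2 := by
        rw [signedArea_otherEdge]; exact neg_pos.2 hf.2.1
      have h1 := hf.1.otherEdge.crossing_le hs
      rw [hf.1.otherEdge_otherEdge] at h1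
      refine ⟨otherEdge g a f, ?_, hf.1.otherEdge_otherEdge⟩
      simp only [hA, Finset.mem_filter, Finset.mem_univ, true_and]
      rw [hf.1.otherEdge_otherEdge]
      exact ⟨⟨hf.1.otherEdge, hs, h1.trans hf.2.2⟩, hf.2.2⟩
  have c1 : (A.filter fun f => ¬ crossing g h a (otherEdge g a f).1 (otherEdge g a f).2.1 ≤ b).card
      = 1 := by
    have := Finset.card_filter_add_card_filter_not (s := A)
      (fun f => crossing g h a (otherEdge g a f).1 (otherEdge g a f).2.1 ≤ b)
    omega
  obtain ⟨f, hf⟩ := Finset.card_eq_one.1 c1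
  have hmem : ∀ f', (IsFlag Q g a f' ∧ 0 < signedArea g h f'.1 f'.2.1 f'.2.2 ∧
      crossing g h a f'.1 f'.2.1 ≤ b ∧
      b < crossing g h a (otherEdge g a f').1 (otherEdge g a f').2.1) ↔ f' = f := by
    intro f'
    rw [← Finset.mem_singleton, ← hf]
    simp only [hA, Finset.mem_filter, Finset.mem_univ, true_and, not_le, and_assoc]
  exact ⟨f, (hmem f).2 rfl, fun f' hf' => (hmem f').1 hf'⟩

/-! ### The affine extension is injective and surjective -/

lemma sum_eq_of_support [Fintype W] {x : W → ℝ} {u v z : W} (huv : u ≠ v) (huz : u ≠ z)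
    (hvz : v ≠ z)
    (hx : ∀ w, w ≠ u → w ≠ v → w ≠ z → x w = 0) (f : W → ℝ) :
    ∑ w, x w * f w = x u * f u + x v * f v + x z * f z := by
  classical
  rw [← Finset.sum_subset (Finset.subset_univ {u, v, z}), Finset.sum_insert, Finset.sum_insert,
    Finset.sum_singleton, add_assoc]
  · simpa using hvz
  · simpa using ⟨huv, huz⟩
  · intro w _ hw
    simp only [Finset.mem_insert, Finset.mem_singleton, not_or] at hw
    rw [hx w hw.1 hw.2.1 hw.2.2, zero_mul]

/-- Every point `x` of the surface lies in a triangle `f`, in the half-open part of it that is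
counted by `existsUnique_flag`. If `x` is a vertex, then `f` is the triangle at `x` whose image
contains the points slightly to the left of and above the image of `x`. -/
lemma exists_flag [Fintype W] (hF : Q.IsFoldFree g h k P) {x : W → ℝ} (hx : x ∈ Q.realization)
    (ha : 0 < affineExtension g x) (hb : affineExtension h x < P) :
    ∃ f : W × W × W, IsFlag Q g (affineExtension g x) f ∧ 0 < signedArea g h f.1 f.2.1 f.2.2 ∧
      (∀ w, w ≠ f.1 → w ≠ f.2.1 → w ≠ f.2.2 → x w = 0) ∧
      (g f.2.2 < affineExtension g x → 0 < x f.1) ∧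
      (affineExtension g x ≤ g f.2.2 → 0 < x f.2.1) := by
  classical
  obtain ⟨hx0, hx1, s, hs, hxs⟩ := hx
  set a := affineExtension g x with ha'
  have hsupp : ∀ w, x w ≠ 0 → w ∈ s := fun w hw => by_contra fun h => hw (hxs w h)
  have hpos : ∀ w, x w ≠ 0 → 0 < x w := fun w hw => (hx0 w).lt_of_ne' hw
  have hSp : ∀ {u v z}, u ∈ s → v ∈ s → z ∈ s → u ≠ v → u ≠ z → v ≠ z → Q.Spans u v z :=
    fun hu hv hz h1 h2 h3 => ⟨h1, h2, h3, s, hs, hu, hv, hz⟩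
  have third : ∀ {u v}, u ∈ s → v ∈ s → u ≠ v → ∃ z ∈ s, u ≠ z ∧ v ≠ z ∧
      ∀ w, w ≠ u → w ≠ v → w ≠ z → x w = 0 := by
    intro u v hu hv huv
    obtain ⟨z, h1, h2, rfl⟩ := eq_triple_of_mem hs hu hv huv
    refine ⟨z, by simp, h1.symm, h2.symm, fun w hu hv hz => by_contra fun h => ?_⟩
    have := hsupp w h
    simp only [Finset.mem_insert, Finset.mem_singleton] at this
    tauto
  -- the deviations of `g` from its mean value `a` cancel
  have hbal : ∑ w, x w * (g w - a) = 0 := by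
    simp only [mul_sub, Finset.sum_sub_distrib, ← Finset.sum_mul, hx1, ha', affineExtension]; ring
  by_cases hlow : ∃ u, x u ≠ 0 ∧ g u < a
  · obtain ⟨u, hu, hua⟩ := hlow
    obtain ⟨v, hv, hva⟩ : ∃ v, x v ≠ 0 ∧ a < g v := by
      by_contra! hcon
      have : ∑ w, x w * (g w - a) < 0 := by
        refine Finset.sum_neg' (fun w _ => ?_) ⟨u, Finset.mem_univ _, ?_⟩
        · by_cases hw : x w = 0
          · rw [hw, zero_mul]
          · exact mul_nonpos_of_nonneg_of_nonpos (hx0 w) (sub_nonpos.2 (hcon w hw))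
        · exact mul_neg_of_pos_of_neg (hpos u hu) (sub_neg.2 hua)
      exact this.ne hbal
    have huv : u ≠ v := by rintro rfl; exact lt_asymm hua hva
    obtain ⟨z, hz, huz, hvz, hxz⟩ := third (hsupp u hu) (hsupp v hv) huv
    have hsp := hSp (hsupp u hu) (hsupp v hv) hz huv huz hvz
    by_cases hz0 : x z = 0
    · obtain ⟨z', hz', hpz⟩ := hF.exists_above u v
        ⟨huv, s, hs, hsupp u hu, hsupp v hv⟩ (hua.trans hva) (by
          rintro ⟨e1, e2⟩
          refine hb.ne ?_
          have h1 := sum_eq_of_support huv huz hvz hxz h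
          have h2 := sum_eq_of_support huv huz hvz hxz 1
          simp only [Pi.one_apply, mul_one, hx1, hz0, add_zero] at h2
          rw [affineExtension, h1, e1, e2, hz0, zero_mul, add_zero, ← add_mul, ← h2, one_mul])
      refine ⟨(u, v, z'), ⟨hz', hua, hva.le⟩, hpz, fun w h1 h2 _ => ?_, fun _ => hpos u hu,
        fun _ => hpos v hv⟩
      by_cases hwz : w = z
      · rw [hwz, hz0]
      · exact hxz w h1 h2 hwz
    · rcases lt_or_gt_of_ne (hF.area_ne u v z hsp) with hneg | hp
      · have hfl : IsFlag Q g a (u, v, z) := ⟨hsp, hua, hva.le⟩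
        refine ⟨otherEdge g a (u, v, z), hfl.otherEdge, ?_, ?_, ?_⟩
        · rw [signedArea_otherEdge]; exact neg_pos.2 hneg
        · rw [otherEdge]; split_ifs
          · exact fun w h1 h2 h3 => hxz w h3 h2 h1
          · exact fun w h1 h2 h3 => hxz w h1 h3 h2
        · rw [otherEdge]; split_ifs with hlt
          · exact ⟨fun _ => hpos z hz0, fun _ => hpos v hv⟩
          · exact ⟨fun _ => hpos u hu, fun _ => hpos z hz0⟩
      · exact ⟨(u, v, z), ⟨hsp, hua, hva.le⟩, hp, hxz, fun _ => hpos u hu, fun _ => hpos v hv⟩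
  · push Not at hlow
    have heq : ∀ w, x w ≠ 0 → g w = a := by
      intro w hw
      have := (Finset.sum_eq_zero_iff_of_nonneg (fun w _ => by
        by_cases hw : x w = 0
        · rw [hw, zero_mul]
        · exact mul_nonneg (hx0 w) (sub_nonneg.2 (hlow w hw)))).1 hbal w (Finset.mem_univ _)
      have := (mul_eq_zero.1 this).resolve_left hw
      linarith
    obtain ⟨v, hv⟩ : ∃ v, x v ≠ 0 := by
      by_contra! hcon
      simp [hcon] at hx1
    by_cases h2 : ∃ v', x v' ≠ 0 ∧ v' ≠ v
    · obtain ⟨v', hv', hne⟩ := h2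
      obtain ⟨z, hz, hvz, hv'z, hxz⟩ := third (hsupp v hv) (hsupp v' hv') hne.symm
      have hsp := hSp (hsupp v hv) (hsupp v' hv') hz hne.symm hvz hv'z
      have hak : a = k := by
        have := hF.eq_or_eq v v' ⟨hne.symm, s, hs, hsupp v hv, hsupp v' hv'⟩
          ((heq v hv).trans (heq v' hv').symm)
        rw [heq v hv] at this
        exact this.resolve_left ha.ne'
      have hza : g z < a := by
        refine lt_of_le_of_ne (hak ▸ hF.g_le z) fun e => hF.area_ne _ _ _ hsp ?_
        rw [signedArea, heq v hv, heq v' hv', e]; ring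
      rcases lt_or_gt_of_ne (hF.area_ne z v v' hsp.swap₁₃.swap₂₃) with hneg | hp
      · refine ⟨(z, v', v), ⟨hsp.swap₁₃, hza, (heq v' hv').ge⟩, ?_, fun w h1 h2 h3 =>
        hxz w h3 h2 h1,
          fun h => absurd h (heq v hv).not_lt, fun _ => hpos v' hv'⟩
        rw [signedArea_swap₂₃]; exact neg_pos.2 hneg
      · exact ⟨(z, v, v'), ⟨hsp.swap₁₃.swap₂₃, hza, (heq v hv).ge⟩, hp,
          fun w h1 h2 h3 => hxz w h2 h3 h1, fun h => absurd h (heq v' hv').not_lt, fun _ =>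
            hpos v hv⟩
    · push Not at h2
      have hxv : ∀ w, w ≠ v → x w = 0 := fun w hw => by_contra fun h => hw (h2 w h)
      have hv1 : x v = 1 := by
        rw [← hx1]; exact (Finset.sum_eq_single v (fun w _ hw => hxv w hw) (by simp)).symm
      have hhv : affineExtension h x = h v := by
        rw [affineExtension, Finset.sum_eq_single v (fun w _ hw => by rw [hxv w hw, zero_mul]) (by
          simp),
          hv1, one_mul]
      -- the triangle above the edge to the left neighbour in the steepest upward direction has no
      -- further vertex on the left
      set L : Finset W := Finset.univ.filter fun l => Q.graph.Adj v l ∧ g l < g v with hL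
      have hLne : L.Nonempty := by
        obtain ⟨l, hl⟩ := hF.exists_lt v (by rw [heq v hv]; exact ha)
        exact ⟨l, by simpa [hL] using hl⟩
      obtain ⟨l, hl, hmax⟩ := L.exists_max_image (fun l => (h l - h v) / (g v - g l)) hLne
      simp only [hL, Finset.mem_filter, Finset.mem_univ, true_and] at hl hmax
      obtain ⟨z, hz, hpz⟩ := hF.exists_above l v hl.1.symm hl.2 (by
        rintro ⟨-, e2⟩; rw [hhv, e2] at hb; exact lt_irrefl _ hb)
      have hza : a ≤ g z := by
        by_contra! hza
        rw [← heq v hv] at hza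
        have hadj : Q.graph.Adj v z := ⟨hz.2.2.1, hz.2.2.2.imp fun _ h => ⟨h.1, h.2.2.1, h.2.2.2⟩⟩
        have := hmax z ⟨hadj, hza⟩
        rw [div_le_div_iff₀ (sub_pos.2 hza) (sub_pos.2 hl.2)] at this
        rw [signedArea] at hpz
        nlinarith
      exact ⟨(l, v, z), ⟨hz, by rw [← heq v hv]; exact hl.2, (heq v hv).ge⟩, hpz,
        fun w _ h2 _ => hxv w h2, fun h => absurd h hza.not_gt, fun _ => by
          simp only [hv1]
          exact one_pos⟩

/-- The area coordinate of a point of a triangle. -/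
lemma mul_sub_crossing_eq [Fintype W] {x : W → ℝ} {u v z : W} (huv : g u < g v) (huz : u ≠ z)
    (hvz : v ≠ z) (hx1 : ∑ w, x w = 1) (hx : ∀ w, w ≠ u → w ≠ v → w ≠ z → x w = 0) :
    (g v - g u) * (affineExtension h x - crossing g h (affineExtension g x) u v) =
      x z * signedArea g h u v z := by
  have hne : u ≠ v := fun e => huv.ne (by rw [e])
  have e1 := sum_eq_of_support hne huz hvz hx 1
  simp only [Pi.one_apply, mul_one, hx1] at e1
  rw [mul_sub_crossing huv, affineExtension, affineExtension, sum_eq_of_support hne huz hvz hx,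
    sum_eq_of_support hne huz hvz hx, signedArea]
  linear_combination (h v * g u - g v * h u) * e1

lemma eq_of_flag [Fintype W] {x : W → ℝ} (hx1 : ∑ w, x w = 1)
    {f : W × W × W} (hf : IsFlag Q g (affineExtension g x) f)
    (hpos : 0 < signedArea g h f.1 f.2.1 f.2.2) (hx0 : ∀ w, 0 ≤ x w)
    (hsupp : ∀ w, w ≠ f.1 → w ≠ f.2.1 → w ≠ f.2.2 → x w = 0)
    (h1 : g f.2.2 < affineExtension g x → 0 < x f.1)
    (h2 : affineExtension g x ≤ g f.2.2 → 0 < x f.2.1) :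
    crossing g h (affineExtension g x) f.1 f.2.1 ≤ affineExtension h x ∧
      affineExtension h x < crossing g h (affineExtension g x)
        (otherEdge g (affineExtension g x) f).1 (otherEdge g (affineExtension g x) f).2.1 := by
  obtain ⟨u, v, z⟩ := f
  obtain ⟨⟨huv, huz, hvz, -⟩, hu, hv⟩ := hf
  simp only at *
  constructor
  · have e := mul_sub_crossing_eq (h := h) (hu.trans_le hv) huz hvz hx1 hsupp
    have h3 : 0 ≤ x z * signedArea g h u v z := mul_nonneg (hx0 z) hpos.le
    rw [← e] at h3
    exact sub_nonneg.1 (nonneg_of_mul_nonneg_right h3 (sub_pos.2 (hu.trans_le hv)))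
  · rw [otherEdge]
    simp only
    split_ifs with hz
    · have e := mul_sub_crossing_eq (h := h) (hz.trans_le hv) huz.symm huv.symm hx1
        (fun w h1 h2 h3 => hsupp w h3 h2 h1)
      rw [signedArea_swap₁₃] at e
      have := mul_pos (h1 hz) hpos
      have h4 := sub_pos.2 (hz.trans_le hv)
      by_contra! hc
      have := mul_nonneg h4.le (sub_nonneg.2 hc)
      simp only at *
      linarith
    · have hz := not_lt.1 hz
      have e := mul_sub_crossing_eq (h := h) (hu.trans_le hz) huv hvz.symm hx1
        (fun w h1 h2 h3 => hsupp w h1 h3 h2)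
      rw [signedArea_swap₂₃] at e
      have := mul_pos (h2 hz) hpos
      have h4 := sub_pos.2 (hu.trans_le hz)
      by_contra! hc
      have := mul_nonneg h4.le (sub_nonneg.2 hc)
      simp only at *
      linarith

lemma affineExtension_nonneg [Fintype W] {f x : W → ℝ} (hf : ∀ w, 0 ≤ f w) (hx : ∀ w, 0 ≤ x w) :
    0 ≤ affineExtension f x :=
  Finset.sum_nonneg fun w _ => mul_nonneg (hx w) (hf w)

lemma affineExtension_const_sub [Fintype W] (f : W → ℝ) {x : W → ℝ} (hx : ∑ w, x w = 1) (r : ℝ) :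
    affineExtension (fun w => r - f w) x = r - affineExtension f x := by
  simp only [affineExtension, mul_sub, Finset.sum_sub_distrib, ← Finset.sum_mul, hx, one_mul]

lemma affineExtension_le [Fintype W] {f x : W → ℝ} {r : ℝ} (hf : ∀ w, f w ≤ r) (hx : ∀ w, 0 ≤ x w)
    (hx1 : ∑ w, x w = 1) : affineExtension f x ≤ r := by
  have := affineExtension_nonneg (f := fun w => r - f w) (fun w => sub_nonneg.2 (hf w)) hx
  rw [affineExtension_const_sub f hx1] at this
  linarith

lemma eq_of_pos_of_lt [Fintype W] (hF : Q.IsFoldFree g h k P) {x y : W → ℝ}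
    (hx : x ∈ Q.realization) (hy : y ∈ Q.realization)
    (hg : affineExtension g x = affineExtension g y) (hh :
      affineExtension h x = affineExtension h y)
    (ha : 0 < affineExtension g x) (hb : affineExtension h x < P) : x = y := by
  obtain ⟨f, hf, hfp, hfs, hf1, hf2⟩ := hF.exists_flag hx ha hb
  obtain ⟨f', hf', hfp', hfs', hf1', hf2'⟩ := hF.exists_flag hy (hg ▸ ha) (hh ▸ hb)
  obtain ⟨hc1, hc2⟩ := eq_of_flag hx.2.1 hf hfp hx.1 hfs hf1 hf2
  obtain ⟨hc1', hc2'⟩ := eq_of_flag hy.2.1 hf' hfp' hy.1 hfs' hf1' hf2'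
  rw [← hg] at hf' hc1' hc2'
  rw [← hh] at hc1' hc2'
  obtain rfl := (hF.existsUnique_flag ha (affineExtension_le hF.g_le hx.1 hx.2.1)
    (affineExtension_nonneg hF.h_nonneg hx.1) hb).unique ⟨hf, hfp, hc1, hc2⟩ ⟨hf', hfp', hc1', hc2'⟩
  obtain ⟨u, v, z⟩ := f
  obtain ⟨⟨huv, huz, hvz, -⟩, hu, hv⟩ := hf
  simp only at *
  have e1 := sum_eq_of_support huv huz hvz hfs 1
  have e1' := sum_eq_of_support huv huz hvz hfs' 1
  simp only [Pi.one_apply, mul_one, hx.2.1, hy.2.1] at e1 e1'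
  rw [affineExtension, affineExtension, sum_eq_of_support huv huz hvz hfs,
    sum_eq_of_support huv huz hvz hfs'] at hg hh
  have hD := hfp.ne'
  rw [signedArea] at hD
  have ez : x z = y z := mul_left_cancel₀ hD (by
    linear_combination (g v - g u) * hh - (h v - h u) * hg - (g v * h u - g u * h v) * (e1' - e1))
  have huv' : g v - g u ≠ 0 := (sub_pos.2 (hu.trans_le hv)).ne'
  have ev : x v = y v := mul_left_cancel₀ huv' (by
    linear_combination hg - (g z - g u) * ez + g u * (e1 - e1'))
  have eu : x u = y u := by linarith
  funext w
  by_cases h1 : w = u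
  · rw [h1, eu]
  by_cases h2 : w = v
  · rw [h2, ev]
  by_cases h3 : w = z
  · rw [h3, ez]
  rw [hfs w h1 h2 h3, hfs' w h1 h2 h3]

/-- A point of a fold-free surface is determined by its coordinates. -/
lemma eq_of_eq [Fintype W] (hF : Q.IsFoldFree g h k P) {x y : W → ℝ}
    (hx : x ∈ Q.realization) (hy : y ∈ Q.realization)
    (hg : affineExtension g x = affineExtension g y)
    (hh : affineExtension h x = affineExtension h y) : x = y := by
  have aux : ∀ {g : W → ℝ}, Q.IsFoldFree g h k P → affineExtension g x = affineExtension g y →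
      0 < affineExtension g x → x = y := by
    intro g hF hg ha
    by_cases hb : affineExtension h x < P
    · exact hF.eq_of_pos_of_lt hx hy hg hh ha hb
    · refine hF.flip_right.eq_of_pos_of_lt hx hy hg ?_ ha ?_
      · rw [affineExtension_const_sub _ hx.2.1, affineExtension_const_sub _ hy.2.1, hh]
      · rw [affineExtension_const_sub _ hx.2.1]
        have := hF.P_pos
        linarith
  by_cases ha : 0 < affineExtension g x
  · exact aux hF hg ha
  · refine aux hF.flip_left ?_ ?_
    · rw [affineExtension_const_sub _ hx.2.1, affineExtension_const_sub _ hy.2.1, hg]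
    · rw [affineExtension_const_sub _ hx.2.1]
      have := hF.k_pos
      linarith

lemma exists_of_pos_of_lt [Fintype W] (hF : Q.IsFoldFree g h k P) {a b : ℝ} (ha : 0 < a)
    (hak : a ≤ k)
    (hb : 0 ≤ b) (hbP : b < P) :
    ∃ x ∈ Q.realization, affineExtension g x = a ∧ affineExtension h x = b := by
  classical
  obtain ⟨f, ⟨hf, hfp, h1, h2⟩, -⟩ := hF.existsUnique_flag ha hak hb hbP
  have hf' := hf.otherEdge
  -- the point of an edge at the crossing with the line at `a`
  have key : ∀ f : W × W × W, IsFlag Q g a f → ∀ s ∈ Q.triangles, f.1 ∈ s → f.2.1 ∈ s →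
      ∃ x : W → ℝ, (∀ w, 0 ≤ x w) ∧ ∑ w, x w = 1 ∧ (∀ w, w ∉ s → x w = 0) ∧
        affineExtension g x = a ∧ affineExtension h x = crossing g h a f.1 f.2.1 := by
    rintro ⟨u, v, z⟩ ⟨⟨huv, huz, hvz, -⟩, hu, hv⟩ s - hus hvs
    simp only at *
    have hd : 0 < g v - g u := by linarith
    set p : ℝ := (a - g u) / (g v - g u) with hp
    have hp0 : 0 ≤ p := div_nonneg (by linarith) hd.le
    have hp1 : p ≤ 1 := (div_le_one hd).2 (by linarith)
    set x : W → ℝ := fun w => if w = u then 1 - p else if w = v then p else 0 with hx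
    have hxu : x u = 1 - p := by simp [hx]
    have hxv : x v = p := by simp [hx, huv.symm]
    have hx0 : ∀ w, w ≠ u → w ≠ v → x w = 0 := fun w h1 h2 => by simp [hx, h1, h2]
    have hsum : ∀ F : W → ℝ, ∑ w, x w * F w = (1 - p) * F u + p * F v := by
      intro F
      rw [sum_eq_of_support huv huz hvz (fun w h1 h2 _ => hx0 w h1 h2), hxu, hxv,
        hx0 z huz.symm hvz.symm]
      ring
    refine ⟨x, ?_, ?_, ?_, ?_, ?_⟩
    · intro w
      simp only [hx]
      split_ifs <;> linarith
    · have := hsum 1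
      simpa using this
    · intro w hw
      exact hx0 w (fun e => hw (e ▸ hus)) (fun e => hw (e ▸ hvs))
    · rw [affineExtension, hsum, hp]; field_simp; ring
    · rw [affineExtension, hsum, crossing]; ring
  obtain ⟨-, -, -, s, hs, hs1, hs2, hs3⟩ := hf.1
  obtain ⟨x, hx0, hx1, hxs, hxg, hxh⟩ := key f hf s hs hs1 hs2
  obtain ⟨y, hy0, hy1, hys, hyg, hyh⟩ := key _ hf' s hs (by
    rw [otherEdge]
    split_ifs <;> assumption)
    (by rw [otherEdge]; split_ifs <;> assumption)
  rw [← hxh] at h1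
  rw [← hyh] at h2
  set q : ℝ := (b - affineExtension h x) / (affineExtension h y - affineExtension h x) with hq
  have hd : 0 < affineExtension h y - affineExtension h x := by linarith
  have hq0 : 0 ≤ q := div_nonneg (by linarith) hd.le
  have hq1 : q ≤ 1 := (div_le_one hd).2 (by linarith)
  have haff : ∀ F : W → ℝ, affineExtension F (fun w => (1 - q) * x w + q * y w) =
      (1 - q) * affineExtension F x + q * affineExtension F y := by
    intro F
    simp only [affineExtension, Finset.mul_sum, ← Finset.sum_add_distrib]
    exact Finset.sum_congr rfl fun w _ => by ring
  refine ⟨fun w => (1 - q) * x w + q * y w, ⟨fun w => ?_, ?_, s, hs, fun w hw => ?_⟩, ?_, ?_⟩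
  · exact add_nonneg (mul_nonneg (sub_nonneg.2 hq1) (hx0 w)) (mul_nonneg hq0 (hy0 w))
  · rw [Finset.sum_add_distrib, ← Finset.mul_sum, ← Finset.mul_sum, hx1, hy1]; ring
  · simp only [hxs w hw, hys w hw]; ring
  · rw [haff, hxg, hyg]; ring
  · rw [haff, hq]; field_simp; ring

lemma exists_eq [Fintype W] (hF : Q.IsFoldFree g h k P) {a b : ℝ} (ha : 0 ≤ a) (hak : a ≤ k)
    (hb : 0 ≤ b) (hbP : b ≤ P) :
    ∃ x ∈ Q.realization, affineExtension g x = a ∧ affineExtension h x = b := by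
  have aux : ∀ {g : W → ℝ}, Q.IsFoldFree g h k P → ∀ a : ℝ, 0 < a → a ≤ k →
      ∃ x ∈ Q.realization, affineExtension g x = a ∧ affineExtension h x = b := by
    intro g hF a ha hak
    by_cases hb' : b < P
    · exact hF.exists_of_pos_of_lt ha hak hb hb'
    · obtain ⟨x, hx, h1, h2⟩ := hF.flip_right.exists_of_pos_of_lt ha hak (b := P - b) (by linarith)
        (by have := hF.P_pos; linarith)
      rw [affineExtension_const_sub _ hx.2.1] at h2
      exact ⟨x, hx, h1, by linarith⟩
  by_cases ha' : 0 < a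
  · exact aux hF a ha' hak
  · obtain ⟨x, hx, h1, h2⟩ := aux hF.flip_left (k - a) (by have := hF.k_pos; linarith) (by linarith)
    rw [affineExtension_const_sub _ hx.2.1] at h1
    exact ⟨x, hx, by linarith, h2⟩

end IsFoldFree

end FoldFree

section FoldFree

variable {W : Type*}

/-- A property that holds at the start of a path, not at its end, and is inherited by predecessors
changes along exactly one edge. -/
lemma existsUnique_change {n : ℕ} {p : Fin (n + 1) → Prop} (hp : ∀ i j, i ≤ j → p j → p i)
    (h0 : p 0) (hn : ¬ p (Fin.last n)) : ∃! i : Fin n, p i.castSucc ∧ ¬ p i.succ := by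
  obtain ⟨i, hi⟩ : ∃ i : Fin n, p i.castSucc ∧ ¬ p i.succ := by
    by_contra! hc
    exact hn (Fin.induction (motive := p) h0 hc (Fin.last n))
  refine ⟨i, hi, fun j hj => ?_⟩
  rcases lt_trichotomy i j with h | h | h
  · exact absurd (hp _ _ (Fin.le_def.2 (by simpa using Fin.lt_def.1 h)) hj.1) hi.2
  · exact h.symm
  · exact absurd (hp _ _ (Fin.le_def.2 (by simpa using Fin.lt_def.1 h)) hi.1) hj.2

variable [Fintype W] {Q : TriComplex W} {c : W → W → ℝ} {N₁ N₂ : Set W} {n : ℕ}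
  {b t : Fin (n + 1) → W} {g h : W → ℝ} {k P : ℝ}

namespace IsGradedRectangle

lemma existsUnique_edge (hR : Q.IsGradedRectangle c N₁ N₂ b t g k) {p : ℝ → Prop}
    (hp : ∀ x y, x ≤ y → p x → p y) (hk : p k) (h0 : ¬ p 0) {q : W → Prop}
    (hq : ∀ x, q x ↔ x ∈ Set.range b) (hch : Q.IsChordless b) :
    ∃! e : W × W, Q.graph.Adj e.1 e.2 ∧ ¬ p (g e.1) ∧ p (g e.2) ∧ q e.1 ∧ q e.2 := by
  obtain ⟨i, ⟨hi1, hi2⟩, hu⟩ := existsUnique_change (p := fun i => p (g (b i)))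
    (fun i j hij => hp _ _ (hR.b_anti.antitone hij)) (by rw [hR.g_b_zero]; exact hk)
    (by rw [hR.g_b_last]; exact h0)
  refine ⟨(b i.succ, b i.castSucc), ⟨(hR.b_edge i).1.symm, hi2, hi1, (hq _).2 ⟨_, rfl⟩,
    (hq _).2 ⟨_, rfl⟩⟩, ?_⟩
  rintro ⟨x, y⟩ ⟨h1, h2, h3, h4, h5⟩
  obtain ⟨j, rfl⟩ := (hq _).1 h4
  obtain ⟨l, rfl⟩ := (hq _).1 h5
  obtain ⟨m, ⟨e1, e2⟩ | ⟨e1, e2⟩⟩ := hch _ _ h1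
  · simp only [e1, e2] at h2 h3
    exact absurd (hp _ _ (hR.b_anti (Fin.castSucc_lt_succ (i := m))).le h3) h2
  · simp only [e1, e2] at h2 h3
    rw [e1, e2, hu m ⟨h3, h2⟩]

/-- A harmonic function and a strict height function map a rectangle without folds. -/
lemma isFoldFree (hR : Q.IsGradedRectangle c N₁ N₂ b t g k)
    (hh : Q.IsStrictHeight N₁ N₂ b t h P)
    (hlap : ∀ x, x ∉ Set.range b ∪ Set.range t → x ∉ N₁ → x ∉ N₂ → Q.laplacian c h x = 0) :
    Q.IsFoldFree g h k P := by
  have hsp : ∀ {u v z}, Q.Spans u v z → Q.graph.Adj u v := fun h =>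
    ⟨h.1, h.2.2.2.imp fun _ hs => ⟨hs.1, hs.2.1, hs.2.2.1⟩⟩
  have slope : ∀ {u v}, g u ≠ g v → ∃ a, h u - a * g u = h v - a * g v ∧ ∀ z,
      signedArea g h u v z = (g v - g u) * ((h z - a * g z) - (h u - a * g u)) := by
    intro u v huv
    have hne : g v - g u ≠ 0 := sub_ne_zero.2 huv.symm
    refine ⟨(h v - h u) / (g v - g u), ?_, fun z => ?_⟩
    · field_simp; ring
    · rw [signedArea]; field_simp; ring
  have spans : ∀ {u v z a s}, Q.graph.Adj u v → h u - a * g u = h v - a * g v →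
      s ∈ Q.triangles → u ∈ s → v ∈ s → z ∈ s → h z - a * g z ≠ h u - a * g u → Q.Spans u v z := by
    intro u v z a s huv he hs hu hv hz hne
    refine ⟨huv.1, ?_, ?_, s, hs, hu, hv, hz⟩
    · rintro rfl; exact hne rfl
    · rintro rfl; exact hne he.symm
  refine ⟨hR.k_pos, hh.pos, hR.nonneg, hR.le, hh.nonneg, hh.le, ?_, ?_, ?_, ?_, ?_, ?_, ?_, ?_, ?_,
    ?_, ?_⟩
  · rintro u v z ⟨huv, huz, hvz, s, hs, hu, hv, hz⟩
    exact hR.det_ne_zero hh hlap hs hu hv hz huv huz hvz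
  · intro u v huv hg hP
    rw [hh.mem_t_iff, hh.mem_t_iff] at hP
    obtain ⟨a, ha, hA⟩ := slope hg.ne
    obtain ⟨s, hs, hu, hv, z, hz, hlt⟩ := (hR.exists_above_below hh hlap huv ha).1 hP
    exact ⟨z, spans huv ha hs hu hv hz hlt.ne', by
      rw [hA]; exact mul_pos (sub_pos.2 hg) (sub_pos.2 hlt)⟩
  · intro u v huv hg hP
    rw [hh.mem_b_iff, hh.mem_b_iff] at hP
    obtain ⟨a, ha, hA⟩ := slope hg.ne
    obtain ⟨s, hs, hu, hv, z, hz, hlt⟩ := (hR.exists_above_below hh hlap huv ha).2 hP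
    exact ⟨z, spans huv ha hs hu hv hz hlt.ne, by
      rw [hA]; exact mul_neg_of_pos_of_neg (sub_pos.2 hg) (sub_neg.2 hlt)⟩
  · classical
    intro u v z z' hg hz hz' hpos
    by_contra hne
    obtain ⟨a, ha, hA⟩ := slope hg
    have huv := hsp hz
    obtain ⟨-, huz, hvz, s, hs, hus, hvs, hzs⟩ := hz
    obtain ⟨-, huz', hvz', s', hs', hus', hvs', hzs'⟩ := hz'
    have hsub : ∀ T : Finset (Finset W), (∀ s' ∈ T, s' ∈ Q.triangles ∧ u ∈ s' ∧ v ∈ s') →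
        T.card ≤ Q.edgeDegree u v := fun T hT => Finset.card_le_card fun s' hs' => by
      simpa using hT s' hs'
    have hunique : ∀ {s : Finset W} {z z' : W}, s ∈ Q.triangles → u ∈ s → v ∈ s → z ∈ s → z' ∈ s →
        u ≠ z → v ≠ z → u ≠ z' → v ≠ z' → z = z' := by
      intro s z z' hs hu hv hz hz' h1 h2 h3 h4
      obtain ⟨w, -, -, rfl⟩ := eq_triple_of_mem hs hu hv huv.1
      simp only [Finset.mem_insert, Finset.mem_singleton] at hz hz'
      rw [(hz.resolve_left h1.symm).resolve_left h2.symm,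
        (hz'.resolve_left h3.symm).resolve_left h4.symm]
    have hss : s ≠ s' := by
      rintro rfl
      exact hne (hunique hs hus hvs hzs hzs' huz hvz huz' hvz')
    have h2 := hR.disk.edge_le_two u v huv
    have h3 := hsub {s, s'} (by simp [*])
    rw [Finset.card_pair hss] at h3
    have hpath : ∀ {b t : Fin (n + 1) → W}, Q.IsGradedRectangle c N₁ N₂ b t g k → Q.IsChordless b →
        ¬ (u ∈ Set.range b ∧ v ∈ Set.range b) := by
      rintro b t hR hch ⟨⟨i, rfl⟩, j, rfl⟩
      have := (boundaryGraph_adj_iff.1 (hR.adj_of_isPathEdge (hch i j huv))).2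
      omega
    have third : ∀ s'' ∈ Q.triangles, u ∈ s'' → v ∈ s'' → s'' ≠ s → s'' ≠ s' → False := by
      intro s'' hs'' hu hv hn hn'
      have := hsub {s'', s, s'} (by simp [*])
      rw [Finset.card_eq_three.2 ⟨s'', s, s', hn, hn', hss, rfl⟩] at this
      omega
    set φ : W → ℝ := fun w => h w - a * g w with hφ
    have hside : 0 < (φ z - φ u) * (φ z' - φ u) := by
      rw [hA, hA] at hpos
      have : 0 < (g v - g u) ^ 2 * ((φ z - φ u) * (φ z' - φ u)) := by
        simp only [hφ]; linarith
      exact pos_of_mul_pos_right this (sq_nonneg _)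
    have hother : ∀ s'' ∈ Q.triangles, u ∈ s'' → v ∈ s'' → ∀ w ∈ s'', u ≠ w → v ≠ w → w ≠ z
      → w ≠ z' →
        False := by
      intro s'' hs'' hu hv w hw huw hvw h1 h2
      refine third s'' hs'' hu hv ?_ ?_
      · rintro rfl; exact h1 (hunique hs'' hu hv hw hzs huw hvw huz hvz)
      · rintro rfl; exact h2 (hunique hs'' hu hv hw hzs' huw hvw huz' hvz')
    have hne_u : ∀ w, φ w ≠ φ u → u ≠ w ∧ v ≠ w := by
      refine fun w hw => ⟨?_, ?_⟩
      · rintro rfl; exact hw rfl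
      · rintro rfl; exact hw ha.symm
    rcases pos_and_pos_or_neg_and_neg_of_mul_pos hside with ⟨k1, k2⟩ | ⟨k1, k2⟩
    · obtain ⟨s'', hs'', hu, hv, w, hw, hlt⟩ :=
        (hR.exists_above_below hh hlap huv ha).2 (hpath hR hh.chordless_b)
      change φ w < φ u at hlt
      have := hne_u w hlt.ne
      refine hother s'' hs'' hu hv w hw this.1 this.2 ?_ ?_ <;> rintro rfl <;> linarith
    · obtain ⟨s'', hs'', hu, hv, w, hw, hlt⟩ :=
        (hR.exists_above_below hh hlap huv ha).1 (hpath hR.swap hh.chordless_t)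
      change φ u < φ w at hlt
      have := hne_u w hlt.ne'
      refine hother s'' hs'' hu hv w hw this.1 this.2 ?_ ?_ <;> rintro rfl <;> linarith
  · intro a ha hak
    simpa only [not_le] using hR.existsUnique_edge (p := fun r => a ≤ r)
      (fun _ _ h1 h2 => h2.trans h1) hak ha.not_ge (fun _ => hh.mem_b_iff) hh.chordless_b
  · intro a ha hak
    simpa only [not_lt] using hR.existsUnique_edge (p := fun r => a < r)
      (fun _ _ h1 h2 => h2.trans_le h1) hak ha.not_gt (fun _ => hh.mem_b_iff) hh.chordless_b
  · intro a ha hak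
    simpa only [not_le] using hR.swap.existsUnique_edge (p := fun r => a ≤ r)
      (fun _ _ h1 h2 => h2.trans h1) hak ha.not_ge (fun _ => hh.mem_t_iff) hh.chordless_t
  · intro a ha hak
    simpa only [not_lt] using hR.swap.existsUnique_edge (p := fun r => a < r)
      (fun _ _ h1 h2 => h2.trans_le h1) hak ha.not_gt (fun _ => hh.mem_t_iff) hh.chordless_t
  · intro v hv
    have key : ∀ {b t : Fin (n + 1) → W}, Q.IsGradedRectangle c N₁ N₂ b t g k → v ∈ Set.range b →
        ∃ l, Q.graph.Adj v l ∧ g l < g v := by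
      rintro b t hR ⟨i, rfl⟩
      obtain ⟨y, hy, -, hlt⟩ := hR.exists_b_succ (i := i) (by
        rintro rfl
        rw [hR.g_b_last] at hv
        exact hv.false)
      exact ⟨y, hy.1, hlt⟩
    by_cases hvR : v ∈ Set.range b ∪ Set.range t
    · exact hvR.elim (key hR) (key hR.swap)
    by_cases h1 : v ∈ N₁
    · exact hR.exists_adj_lt v h1 hvR
    exact (hR.mixed v hvR h1 fun h2 => hv.ne' ((hR.eq_zero v).2 h2)).1
  · intro v hv
    have key : ∀ {b t : Fin (n + 1) → W}, Q.IsGradedRectangle c N₁ N₂ b t g k → v ∈ Set.range b →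
        ∃ l, Q.graph.Adj v l ∧ g v < g l := by
      rintro b t hR ⟨i, rfl⟩
      obtain ⟨y, hy, -, hlt⟩ := hR.exists_b_pred (i := i) (by
        rintro rfl
        rw [hR.g_b_zero] at hv
        exact hv.false)
      exact ⟨y, hy.1, hlt⟩
    by_cases hvR : v ∈ Set.range b ∪ Set.range t
    · exact hvR.elim (key hR) (key hR.swap)
    by_cases h2 : v ∈ N₂
    · exact hR.exists_adj_gt v h2 hvR
    exact (hR.mixed v hvR (fun h1 => hv.ne ((hR.eq_k v).2 h1)) h2).2
  · intro u v huv he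
    have key : ∀ {b t : Fin (n + 1) → W}, Q.IsGradedRectangle c N₁ N₂ b t g k
      → ¬ IsPathEdge b u v := by
      rintro b t hR ⟨i, ⟨rfl, rfl⟩ | ⟨rfl, rfl⟩⟩
      · exact (hR.b_anti (Fin.castSucc_lt_succ (i := i))).ne' he
      · exact (hR.b_anti (Fin.castSucc_lt_succ (i := i))).ne he
    rcases hR.boundary_cases u v (hR.boundary_of_eq u v huv he) with h | h | h | h
    · exact absurd h (key hR)
    · exact absurd h (key hR.swap)
    · exact .inr ((hR.eq_k u).2 h.1)
    · exact .inl ((hR.eq_zero u).2 h.1)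

end IsGradedRectangle

end FoldFree

/-! ### Foliations and nets from rectangular coordinates -/

section Subdivision

/-- The closed intervals between consecutive points of the finite set `A`, parametrized by affine
maps `ρ i` of the unit interval. -/
structure IsSubdivision (A : Finset ℝ) (k : ℝ) {m : ℕ} (ρ : Fin m → I → ℝ) : Prop where
  continuous : ∀ i, Continuous (ρ i)
  injective : ∀ i, Function.Injective (ρ i)
  mem : ∀ i s, ρ i s ∈ Set.Icc 0 k
  cover : ∀ y ∈ Set.Icc 0 k, ∃ i s, ρ i s = y
  end_mem : ∀ i e, e = 0 ∨ e = 1 → ρ i e ∈ A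
  exists_end : ∀ a ∈ A, ∃ i e, (e = 0 ∨ e = 1) ∧ ρ i e = a
  inter : ∀ i j, i ≠ j → (∀ s s', ρ i s ≠ ρ j s') ∨
    ∃ e e', (e = 0 ∨ e = 1) ∧ (e' = 0 ∨ e' = 1) ∧ ∀ s s', ρ i s = ρ j s' ↔ s = e ∧ s' = e'

lemma exists_subdivision {A : Finset ℝ} {k : ℝ} (hk : 0 < k) (hA : ∀ a ∈ A, a ∈ Set.Icc 0 k)
    (h0 : 0 ∈ A) (hkA : k ∈ A) : ∃ (m : ℕ) (ρ : Fin m → I → ℝ), IsSubdivision A k ρ := by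
  obtain ⟨m, hm⟩ : ∃ m, A.card = m + 2 := by
    have h1 : ({0, k} : Finset ℝ).card ≤ A.card :=
      Finset.card_le_card (by
        intro x
        simp only [Finset.mem_insert, Finset.mem_singleton]
        rintro (rfl | rfl) <;> assumption)
    rw [Finset.card_pair hk.ne] at h1
    exact ⟨A.card - 2, by omega⟩
  set α : Fin (m + 1 + 1) → ℝ := fun i => A.orderEmbOfFin hm i with hα
  have hmono : StrictMono α := (A.orderEmbOfFin hm).strictMono
  have hmem : ∀ i, α i ∈ A := A.orderEmbOfFin_mem hm
  have hsurj : ∀ a ∈ A, ∃ i, α i = a := fun a ha => by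
    have := A.range_orderEmbOfFin hm
    rw [← Finset.mem_coe, ← this] at ha
    exact ha
  have hα0 : α 0 = 0 := by
    obtain ⟨i, hi⟩ := hsurj 0 h0
    exact le_antisymm (hi ▸ hmono.monotone (Fin.zero_le i)) (hA _ (hmem 0)).1
  have hαl : α (Fin.last _) = k := by
    obtain ⟨i, hi⟩ := hsurj k hkA
    exact le_antisymm (hA _ (hmem _)).2 (hi ▸ hmono.monotone (Fin.le_last i))
  have hlt : ∀ i : Fin (m + 1), 0 < α i.succ - α i.castSucc := fun i =>
    sub_pos.2 (hmono Fin.castSucc_lt_succ)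
  set ρ : Fin (m + 1) → I → ℝ := fun i s => α i.castSucc + s * (α i.succ - α i.castSucc) with hρ
  have ρ0 : ∀ i, ρ i 0 = α i.castSucc := fun i => by simp [hρ]
  have ρ1 : ∀ i, ρ i 1 = α i.succ := fun i => by simp [hρ]
  have ρmono : ∀ i, StrictMono (ρ i) := fun i s t hst => by
    simp only [hρ]
    have : (s : ℝ) < t := hst
    nlinarith [hlt i]
  have ρge : ∀ i s, α i.castSucc ≤ ρ i s := fun i s => by
    rw [← ρ0]; exact (ρmono i).monotone s.2.1
  have ρle : ∀ i s, ρ i s ≤ α i.succ := fun i s => by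
    rw [← ρ1]; exact (ρmono i).monotone s.2.2
  have cover : ∀ (i : Fin (m + 1)) y, α i.castSucc ≤ y → y ≤ α i.succ → ∃ s, ρ i s = y := by
    intro i y h1 h2
    refine ⟨⟨(y - α i.castSucc) / (α i.succ - α i.castSucc), div_nonneg (by linarith) (hlt i).le,
      (div_le_one (hlt i)).2 (by linarith)⟩, ?_⟩
    have := (hlt i).ne'
    simp only [hρ]
    field_simp
    ring
  have inter : ∀ i j : Fin (m + 1), i < j → (∀ s s', ρ i s ≠ ρ j s') ∨
      ∀ s s', ρ i s = ρ j s' ↔ s = 1 ∧ s' = 0 := by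
    intro i j hij
    by_cases h : i.succ = j.castSucc
    · right
      intro s s'
      constructor
      · intro he
        have h1 := ρle i s
        have h2 := ρge j s'
        rw [← h] at h2
        constructor
        · exact (ρmono i).injective (by rw [ρ1]; linarith)
        · exact (ρmono j).injective (by rw [ρ0, ← h]; linarith)
      · rintro ⟨rfl, rfl⟩
        rw [ρ1, ρ0, h]
    · left
      intro s s' he
      have h3 : i.succ < j.castSucc := by
        refine lt_of_le_of_ne ?_ h
        rw [Fin.le_def]; rw [Fin.lt_def] at hij; simpa using hij
      have := hmono h3
      have h1 := ρle i s
      have h2 := ρge j s'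
      linarith
  refine ⟨m + 1, ρ, ⟨fun i => by simp only [hρ]; fun_prop, fun i => (ρmono i).injective, ?_, ?_,
    ?_, ?_, ?_⟩⟩
  · exact fun i s => ⟨(hA _ (hmem _)).1.trans (ρge i s), (ρle i s).trans (hA _ (hmem _)).2⟩
  · intro y hy
    rcases hy.2.lt_or_eq with hlt | rfl
    · obtain ⟨i, ⟨h1, h2⟩, -⟩ := existsUnique_change (p := fun i => α i ≤ y)
        (fun i j hij h => (hmono.monotone hij).trans h) (hα0 ▸ hy.1) (by rw [hαl]; exact hlt.not_ge)
      exact ⟨i, cover i y h1 (not_le.1 h2).le⟩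
    · exact ⟨Fin.last m, 1, by rw [ρ1, Fin.succ_last, hαl]⟩
  · rintro i e (rfl | rfl)
    · rw [ρ0]; exact hmem _
    · rw [ρ1]; exact hmem _
  · intro a ha
    obtain ⟨i, rfl⟩ := hsurj a ha
    by_cases hi : i = Fin.last _
    · exact ⟨Fin.last m, 1, .inr rfl, by rw [ρ1, Fin.succ_last, hi]⟩
    · obtain ⟨j, rfl⟩ := Fin.exists_castSucc_eq.2 hi
      exact ⟨j, 0, .inl rfl, ρ0 j⟩
  · intro i j hij
    rcases lt_or_gt_of_ne hij with h | h
    · exact (inter i j h).imp_right fun h => ⟨1, 0, .inr rfl, .inl rfl, h⟩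
    · refine (inter j i h).imp (fun h s s' => (h s' s).symm) fun h => ⟨0, 1, .inl rfl, .inr rfl, ?_⟩
      intro s s'
      rw [eq_comm, h, and_comm]

end Subdivision

section Coordinates

variable {W : Type*} [Fintype W] {Q : TriComplex W} {g h : W → ℝ} {k P : ℝ}

lemma continuous_affineExtension (f : W → ℝ) : Continuous (affineExtension f) := by
  unfold affineExtension; fun_prop

lemma isCompact_realization (Q : TriComplex W) : IsCompact Q.realization := by
  have : Q.realization = stdSimplex ℝ W ∩ ⋃ t ∈ Q.triangles, {x | ∀ v, v ∉ t → x v = 0} := by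
    ext x
    simp only [realization, stdSimplex, Set.mem_inter_iff, Set.mem_iUnion, Set.mem_ofPred_eq,
      exists_prop, and_assoc]
  rw [this]
  refine (isCompact_stdSimplex ℝ W).inter_right
    (Set.Finite.isClosed_biUnion Q.triangles.finite_toSet fun t _ => ?_)
  simp only [Set.ofPred_forall]
  exact isClosed_iInter fun v => isClosed_iInter fun _ =>
    isClosed_eq (continuous_apply v) continuous_const

namespace IsFoldFree

/-- The functions `g` and `h` are coordinates on the surface. -/
lemma exists_homeomorph (hF : Q.IsFoldFree g h k P) :
    ∃ Θ : Q.realization ≃ₜ Set.Icc 0 k × Set.Icc 0 P, ∀ x, ((Θ x).1 : ℝ) = affineExtension g x ∧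
      ((Θ x).2 : ℝ) = affineExtension h x := by
  set F : Q.realization → Set.Icc 0 k × Set.Icc 0 P := fun x =>
    (⟨affineExtension g x, affineExtension_nonneg hF.g_nonneg x.2.1,
      affineExtension_le hF.g_le x.2.1 x.2.2.1⟩,
    ⟨affineExtension h x, affineExtension_nonneg hF.h_nonneg x.2.1,
      affineExtension_le hF.h_le x.2.1 x.2.2.1⟩) with hFdef
  have hcont : Continuous F :=
    (((continuous_affineExtension g).comp continuous_subtype_val).subtype_mk _).prodMk
      (((continuous_affineExtension h).comp continuous_subtype_val).subtype_mk _)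
  have hbij : Function.Bijective F := by
    constructor
    · intro x y hxy
      have h1 := congrArg (fun p => (p.1 : ℝ)) hxy
      have h2 := congrArg (fun p => (p.2 : ℝ)) hxy
      exact Subtype.ext (hF.eq_of_eq x.2 y.2 h1 h2)
    · rintro ⟨⟨a, ha0, hak⟩, b, hb0, hbP⟩
      obtain ⟨x, hx, rfl, rfl⟩ := hF.exists_eq ha0 hak hb0 hbP
      exact ⟨⟨x, hx⟩, rfl⟩
  have : CompactSpace Q.realization := isCompact_iff_compactSpace.1 (isCompact_realization Q)
  exact ⟨Continuous.homeoOfEquivCompactToT2 (f := Equiv.ofBijective F hbij) hcont,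
    fun x => ⟨rfl, rfl⟩⟩

end IsFoldFree

/-- A coordinate of a homeomorphism onto a rectangle defines a foliation. -/
lemma isNonsingularFoliation_of_homeomorph {f : W → ℝ} (hk : 0 < k) (hP : 0 < P)
    (Θ : Q.realization ≃ₜ Set.Icc 0 k × Set.Icc 0 P)
    (hΘ : ∀ x, ((Θ x).1 : ℝ) = affineExtension f x) : Q.IsNonsingularFoliation f := by
  constructor
  · rintro a ⟨y, hy, rfl⟩
    set a : Set.Icc 0 k := (Θ ⟨y, hy⟩).1 with ha
    have haf : (a : ℝ) = affineExtension f y := hΘ ⟨y, hy⟩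
    refine ⟨Homeomorph.trans ?_ (iccHomeoI 0 P hP)⟩
    exact
      { toFun := fun x => (Θ ⟨x.1, x.2.1⟩).2
        invFun := fun b => ⟨(Θ.symm (a, b)).1, (Θ.symm (a, b)).2, by
          rw [← hΘ, Θ.apply_symm_apply, haf]⟩
        left_inv := fun x => by
          have e : (a, (Θ ⟨x.1, x.2.1⟩).2) = Θ ⟨x.1, x.2.1⟩ := by
            refine Prod.ext (Subtype.ext ?_) rfl
            rw [haf, hΘ]; exact x.2.2.symm
          refine Subtype.ext ?_
          simp only [e, Θ.symm_apply_apply]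
        right_inv := fun b => by simp
        continuous_toFun := by fun_prop
        continuous_invFun := by fun_prop }
  · intro x
    refine ⟨Set.univ, isOpen_univ, trivial, Set.Icc 0 k, Set.Icc 0 P, Set.ordConnected_Icc,
      ⟨0, ⟨le_rfl, hk.le⟩, k, ⟨hk.le, le_rfl⟩, hk.ne⟩, Set.ordConnected_Icc,
      ⟨0, ⟨le_rfl, hP.le⟩, P, ⟨hP.le, le_rfl⟩, hP.ne⟩,
      (Homeomorph.Set.univ _).trans Θ, fun y z => ?_⟩
    rw [Subtype.ext_iff]
    simp only [Homeomorph.trans_apply, hΘ, Homeomorph.Set.univ_apply]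

namespace IsFoldFree

lemma isCombinatoriallyOrthogonalFilling (hF : Q.IsFoldFree g h k P) :
    Q.IsCombinatoriallyOrthogonalFilling g h := by
  obtain ⟨Θ, hΘ⟩ := hF.exists_homeomorph
  refine ⟨hF.g_nonneg, hF.h_nonneg, ?_,
    isNonsingularFoliation_of_homeomorph hF.k_pos hF.P_pos Θ fun x => (hΘ x).1,
    isNonsingularFoliation_of_homeomorph hF.P_pos hF.k_pos (Θ.trans (Homeomorph.prodComm _ _))
      fun x => (hΘ x).2⟩
  rintro α β ⟨x, hx, rfl⟩ ⟨y, hy, rfl⟩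
  obtain ⟨z, hz, h1, h2⟩ := hF.exists_eq (affineExtension_nonneg hF.g_nonneg hx.1)
    (affineExtension_le hF.g_le hx.1 hx.2.1) (affineExtension_nonneg hF.h_nonneg hy.1)
    (affineExtension_le hF.h_le hy.1 hy.2.1)
  rw [Set.ncard_eq_one]
  refine ⟨z, Set.eq_singleton_iff_unique_mem.2 ⟨⟨⟨hz, h1⟩, hz, h2⟩, ?_⟩⟩
  rintro w ⟨⟨hw, hw1⟩, -, hw2⟩
  exact hF.eq_of_eq hw hz (hw1.trans h1.symm) (hw2.trans h2.symm)

lemma inducesRectangularNets (hF : Q.IsFoldFree g h k P) : Q.InducesRectangularNets g h := by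
  obtain ⟨Θ, hΘ⟩ := hF.exists_homeomorph
  intro A B hA hB hgA hhB
  have hk := hF.k_pos
  have hP := hF.P_pos
  obtain ⟨⟨u, v⟩, ⟨-, -, hv, hu0, -⟩, -⟩ := hF.base k hk le_rfl
  obtain ⟨⟨u', v'⟩, ⟨-, hu', -⟩, -⟩ := hF.base' 0 le_rfl hk
  obtain ⟨⟨u'', v''⟩, ⟨-, -, -, huP, -⟩, -⟩ := hF.top k hk le_rfl
  obtain ⟨m, ρ, hρ⟩ := exists_subdivision (A := A) hk
    (by
      intro a ha
      obtain ⟨x, hx, rfl⟩ := hA a ha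
      exact ⟨affineExtension_nonneg hF.g_nonneg hx.1, affineExtension_le hF.g_le hx.1 hx.2.1⟩)
    (le_antisymm hu' (hF.g_nonneg _) ▸ hgA u') (le_antisymm (hF.g_le _) hv ▸ hgA v)
  obtain ⟨p, τ, hτ⟩ := exists_subdivision (A := B) hP
    (by
      intro a ha
      obtain ⟨x, hx, rfl⟩ := hB a ha
      exact ⟨affineExtension_nonneg hF.h_nonneg hx.1, affineExtension_le hF.h_le hx.1 hx.2.1⟩)
    (hu0 ▸ hhB u) (huP ▸ hhB u'')
  set F : Fin m × Fin p → I × I → (W → ℝ) := fun i q =>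
    (Θ.symm (⟨ρ i.1 q.1, hρ.mem _ _⟩, ⟨τ i.2 q.2, hτ.mem _ _⟩)).1 with hFd
  have Fmem : ∀ i q, F i q ∈ Q.realization := fun i q => Subtype.mem _
  have Fg : ∀ i q, affineExtension g (F i q) = ρ i.1 q.1 := fun i q => by
    simp only [hFd]; rw [← (hΘ _).1, Θ.apply_symm_apply]
  have Fh : ∀ i q, affineExtension h (F i q) = τ i.2 q.2 := fun i q => by
    simp only [hFd]; rw [← (hΘ _).2, Θ.apply_symm_apply]
  have Feq : ∀ i q x, x ∈ Q.realization → affineExtension g x = ρ i.1 q.1 →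
      affineExtension h x = τ i.2 q.2 → F i q = x := fun i q x hx h1 h2 =>
    hF.eq_of_eq (Fmem i q) hx (by rw [Fg, h1]) (by rw [Fh, h2])
  have Finj : ∀ i q j r, F i q = F j r ↔ ρ i.1 q.1 = ρ j.1 r.1 ∧ τ i.2 q.2 = τ j.2 r.2 := by
    intro i q j r
    constructor
    · intro e
      rw [← Fg, ← Fg, ← Fh, ← Fh, e]; exact ⟨rfl, rfl⟩
    · rintro ⟨h1, h2⟩
      exact Feq i q _ (Fmem _ _) (by rw [Fg, h1]) (by rw [Fh, h2])
  have side₁ : ∀ e : I, e = 0 ∨ e = 1 → {q : I × I | q.1 = e} ∈ squareSides := by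
    rintro e (rfl | rfl) <;> simp [squareSides]
  have side₂ : ∀ e : I, e = 0 ∨ e = 1 → {q : I × I | q.2 = e} ∈ squareSides := by
    rintro e (rfl | rfl) <;> simp [squareSides]
  have corner : ∀ e e' : I, e = 0 ∨ e = 1 → e' = 0 ∨ e' = 1 → (e, e') ∈ squareCorners := by
    rintro e e' (rfl | rfl) (rfl | rfl) <;> simp [squareCorners]
  have hinter : ∀ i j, i ≠ j →
      Set.range (F i) ∩ Set.range (F j) = ∅ ∨
      (∃ p ∈ squareCorners, ∃ q ∈ squareCorners,
        Set.range (F i) ∩ Set.range (F j) = {F i p} ∧ F i p = F j q) ∨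
      (∃ s ∈ squareSides, ∃ s' ∈ squareSides,
        Set.range (F i) ∩ Set.range (F j) = F i '' s ∧ F i '' s = F j '' s') := by
    rintro ⟨i, i'⟩ ⟨j, j'⟩ hne
    have hempty : (∀ q r, F (i, i') q ≠ F (j, j') r) →
        Set.range (F (i, i')) ∩ Set.range (F (j, j')) = ∅ := by
      intro h
      rw [Set.eq_empty_iff_forall_notMem]
      rintro _ ⟨⟨q, rfl⟩, r, hr⟩
      exact h q r hr.symm
    have hside : ∀ s s' : Set (I × I), (∀ q r, F (i, i') q = F (j, j') r → q ∈ s ∧ r ∈ s') →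
        (∀ q ∈ s, ∃ r ∈ s', F (i, i') q = F (j, j') r) →
        (∀ r ∈ s', ∃ q ∈ s, F (i, i') q = F (j, j') r) →
        Set.range (F (i, i')) ∩ Set.range (F (j, j')) = F (i, i') '' s ∧
          F (i, i') '' s = F (j, j') '' s' := by
      intro s s' h1 h2 h3
      constructor
      · ext x
        constructor
        · rintro ⟨⟨q, rfl⟩, r, hr⟩
          exact ⟨q, (h1 q r hr.symm).1, rfl⟩
        · rintro ⟨q, hq, rfl⟩
          obtain ⟨r, -, hr⟩ := h2 q hq
          exact ⟨⟨q, rfl⟩, r, hr.symm⟩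
      · ext x
        constructor
        · rintro ⟨q, hq, rfl⟩
          obtain ⟨r, hr, e⟩ := h2 q hq
          exact ⟨r, hr, e.symm⟩
        · rintro ⟨r, hr, rfl⟩
          obtain ⟨q, hq, e⟩ := h3 r hr
          exact ⟨q, hq, e⟩
    by_cases hi : i = j
    · subst hi
      have hi' : i' ≠ j' := fun e => hne (by rw [e])
      rcases hτ.inter i' j' hi' with hd | ⟨e, e', he, he', hee⟩
      · exact .inl (hempty fun q r hqr => hd _ _ ((Finj _ _ _ _).1 hqr).2)
      · refine .inr (.inr ⟨_, side₂ e he, _, side₂ e' he', hside _ _ ?_ ?_ ?_⟩)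
        · intro q r hqr
          exact (hee _ _).1 ((Finj _ _ _ _).1 hqr).2
        · rintro ⟨q, q'⟩ hq
          exact ⟨(q, e'), rfl, (Finj _ _ _ _).2 ⟨rfl, (hee _ _).2 ⟨hq, rfl⟩⟩⟩
        · rintro ⟨q, q'⟩ hq
          exact ⟨(q, e), rfl, (Finj _ _ _ _).2 ⟨rfl, (hee _ _).2 ⟨rfl, hq⟩⟩⟩
    · rcases hρ.inter i j hi with hd | ⟨e, e', he, he', hee⟩
      · exact .inl (hempty fun q r hqr => hd _ _ ((Finj _ _ _ _).1 hqr).1)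
      by_cases hi' : i' = j'
      · subst hi'
        refine .inr (.inr ⟨_, side₁ e he, _, side₁ e' he', hside _ _ ?_ ?_ ?_⟩)
        · intro q r hqr
          exact (hee _ _).1 ((Finj _ _ _ _).1 hqr).1
        · rintro ⟨q, q'⟩ hq
          exact ⟨(e', q'), rfl, (Finj _ _ _ _).2 ⟨(hee _ _).2 ⟨hq, rfl⟩, rfl⟩⟩
        · rintro ⟨q, q'⟩ hq
          exact ⟨(e, q'), rfl, (Finj _ _ _ _).2 ⟨(hee _ _).2 ⟨rfl, hq⟩, rfl⟩⟩
      · rcases hτ.inter i' j' hi' with hd | ⟨d, d', hd, hd', hdd⟩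
        · exact .inl (hempty fun q r hqr => hd _ _ ((Finj _ _ _ _).1 hqr).2)
        · have e1 : F (i, i') (e, d) = F (j, j') (e', d') :=
            (Finj _ _ _ _).2 ⟨(hee _ _).2 ⟨rfl, rfl⟩, (hdd _ _).2 ⟨rfl, rfl⟩⟩
          refine .inr (.inl ⟨_, corner e d he hd, _, corner e' d' he' hd', ?_, e1⟩)
          refine Set.eq_singleton_iff_unique_mem.2 ⟨⟨⟨_, rfl⟩, _, e1.symm⟩, ?_⟩
          rintro _ ⟨⟨q, rfl⟩, r, hr⟩
          obtain ⟨h1, h2⟩ := (Finj _ _ _ _).1 hr.symm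
          rw [Finj, ((hee _ _).1 h1).1, ((hdd _ _).1 h2).1]
          exact ⟨rfl, rfl⟩
  have hcov : ∀ x ∈ Q.realization, (∃ i s, ρ i s = affineExtension g x) ∧
      ∃ j t, τ j t = affineExtension h x := fun x hx =>
    ⟨hρ.cover _ ⟨affineExtension_nonneg hF.g_nonneg hx.1, affineExtension_le hF.g_le hx.1 hx.2.1⟩,
      hτ.cover _ ⟨affineExtension_nonneg hF.h_nonneg hx.1, affineExtension_le hF.h_le hx.1 hx.2.1⟩⟩
  refine ⟨m * p, fun i => F (finProdFinEquiv.symm i), ⟨?_, ?_, ?_, ?_, ?_, ?_⟩, ?_⟩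
  · intro i
    have h1 := hρ.continuous (finProdFinEquiv.symm i).1
    have h2 := hτ.continuous (finProdFinEquiv.symm i).2
    simp only [hFd]
    fun_prop
  · intro i q r hqr
    obtain ⟨h1, h2⟩ := (Finj _ _ _ _).1 hqr
    exact Prod.ext (hρ.injective _ h1) (hτ.injective _ h2)
  · ext x
    simp only [Set.mem_iUnion, Set.mem_range]
    constructor
    · rintro ⟨i, q, rfl⟩; exact Fmem _ _
    · intro hx
      obtain ⟨⟨i, s, hs⟩, j, t, ht⟩ := hcov x hx
      exact ⟨finProdFinEquiv (i, j), (s, t), Feq _ _ _ hx (by simp [hs]) (by simp [ht])⟩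
  · exact fun i j hij => hinter _ _ fun e => hij (finProdFinEquiv.symm.injective e)
  · exact fun i e _ => ⟨ρ (finProdFinEquiv.symm i).1 e, fun t => ⟨Fmem _ _, Fg _ _⟩⟩
  · exact fun i e _ => ⟨τ (finProdFinEquiv.symm i).2 e, fun t => ⟨Fmem _ _, Fh _ _⟩⟩
  · ext x
    simp only [netSkeleton, Set.mem_iUnion, Set.mem_union, Set.mem_image, exists_prop]
    constructor
    · rintro ⟨i, s, hs, q, hq, rfl⟩
      have c1 : ∀ e : I, e = 0 ∨ e = 1 → q.1 = e → (∃ a ∈ A, F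
        (finProdFinEquiv.symm i) q ∈ Q.levelCurve g a) :=
        fun e he hq => ⟨_, hρ.end_mem _ e he, Fmem _ _, by rw [Fg, hq]⟩
      have c2 : ∀ e : I, e = 0 ∨ e = 1 → q.2 = e → (∃ a ∈ B, F
        (finProdFinEquiv.symm i) q ∈ Q.levelCurve h a) :=
        fun e he hq => ⟨_, hτ.end_mem _ e he, Fmem _ _, by rw [Fh, hq]⟩
      rcases hs with rfl | rfl | rfl | rfl
      · exact .inl (c1 0 (.inl rfl) hq)
      · exact .inl (c1 1 (.inr rfl) hq)
      · exact .inr (c2 0 (.inl rfl) hq)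
      · exact .inr (c2 1 (.inr rfl) hq)
    · rintro (⟨a, ha, hx, hxa⟩ | ⟨a, ha, hx, hxa⟩)
      · obtain ⟨i, e, he, rfl⟩ := hρ.exists_end a ha
        obtain ⟨-, j, t, ht⟩ := hcov x hx
        exact ⟨finProdFinEquiv (i, j), _, side₁ e he, (e, t), rfl,
          Feq _ _ _ hx (by simp [hxa]) (by simp [ht])⟩
      · obtain ⟨i, e, he, rfl⟩ := hτ.exists_end a ha
        obtain ⟨⟨j, t, ht⟩, -⟩ := hcov x hx
        exact ⟨finProdFinEquiv (j, i), _, side₂ e he, (t, e), rfl,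
          Feq _ _ _ hx (by simp [ht]) (by simp [hxa])⟩

end IsFoldFree

end Coordinates

/-! ### The surface cut open along a slit -/

section Cut

variable {V : Type*} {K : TriComplex V} {n : ℕ} {γ : Fin (n + 1) → V}

lemma isPathEdge_comm {v w : V} : IsPathEdge γ v w ↔ IsPathEdge γ w v :=
  exists_congr fun _ => or_comm

lemma mem_cutTriangle {τ : {t // t ∈ K.triangles}} {x : K.CutVertex γ} :
    x ∈ K.cutTriangle γ τ ↔ ∃ v, ∃ h : v ∈ τ.1, K.cutMk γ ⟨(v, τ.1), τ.2, h⟩ = x := by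
  classical
  simp only [cutTriangle, Finset.mem_image, Finset.mem_attach, true_and, Subtype.exists]

lemma proj_mem {τ : {t // t ∈ K.triangles}} {x : K.CutVertex γ} (hx : x ∈ K.cutTriangle γ τ) :
    K.proj γ x ∈ τ.1 := by
  obtain ⟨v, hv, rfl⟩ := mem_cutTriangle.1 hx
  exact hv

lemma exists_mem_cutTriangle (γ : Fin (n + 1) → V) {τ : {t // t ∈ K.triangles}} {v : V}
    (hv : v ∈ τ.1) : ∃ x ∈ K.cutTriangle γ τ, K.proj γ x = v :=
  ⟨_, mem_cutTriangle.2 ⟨v, hv, rfl⟩, rfl⟩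

lemma eq_of_proj_eq {τ : {t // t ∈ K.triangles}} {x y : K.CutVertex γ}
    (hx : x ∈ K.cutTriangle γ τ) (hy : y ∈ K.cutTriangle γ τ) (h : K.proj γ x = K.proj γ y) :
    x = y := by
  obtain ⟨v, hv, rfl⟩ := mem_cutTriangle.1 hx
  obtain ⟨w, hw, rfl⟩ := mem_cutTriangle.1 hy
  obtain rfl : v = w := h
  rfl

lemma exists_cutTriangle (x : K.CutVertex γ) : ∃ τ, x ∈ K.cutTriangle γ τ := by
  obtain ⟨⟨⟨v, t⟩, ht, hv⟩, rfl⟩ := Quot.exists_rep x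
  exact ⟨⟨t, ht⟩, mem_cutTriangle.2 ⟨v, hv, rfl⟩⟩

lemma mem_cut_triangles {s : Finset (K.CutVertex γ)} :
    s ∈ (K.cut γ).triangles ↔ ∃ τ, K.cutTriangle γ τ = s := by
  classical
  simp [cut]

lemma cutTriangle_injective : Function.Injective (K.cutTriangle γ) := by
  have key : ∀ τ τ', K.cutTriangle γ τ = K.cutTriangle γ τ' → τ.1 ⊆ τ'.1 := by
    intro τ τ' h v hv
    obtain ⟨x, hx, rfl⟩ := exists_mem_cutTriangle γ hv
    exact proj_mem (h ▸ hx)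
  exact fun τ τ' h => Subtype.ext (Finset.Subset.antisymm (key _ _ h) (key _ _ h.symm))

lemma card_cut_triangles : (K.cut γ).triangles.card = K.triangles.card := by
  classical
  simp only [cut]
  rw [Finset.card_image_of_injective _ cutTriangle_injective, Finset.card_attach]

lemma cut_adj {x y : K.CutVertex γ} : (K.cut γ).graph.Adj x y ↔
    x ≠ y ∧ ∃ τ, x ∈ K.cutTriangle γ τ ∧ y ∈ K.cutTriangle γ τ := by
  refine and_congr_right fun _ => ⟨?_, ?_⟩
  · rintro ⟨s, hs, hx, hy⟩
    obtain ⟨τ, rfl⟩ := mem_cut_triangles.1 hs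
    exact ⟨τ, hx, hy⟩
  · rintro ⟨τ, hx, hy⟩
    exact ⟨_, mem_cut_triangles.2 ⟨τ, rfl⟩, hx, hy⟩

lemma proj_adj {x y : K.CutVertex γ} (h : (K.cut γ).graph.Adj x y) :
    K.graph.Adj (K.proj γ x) (K.proj γ y) := by
  obtain ⟨hne, τ, hx, hy⟩ := cut_adj.1 h
  exact adj_of_mem τ.2 (proj_mem hx) (proj_mem hy) fun e => hne (eq_of_proj_eq hx hy e)

/-- The triangles at an edge that is not cut stay together. -/
lemma eq_of_not_isPathEdge {τ τ' : {t // t ∈ K.triangles}} {x x' : K.CutVertex γ} {w : V}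
    (hx : x ∈ K.cutTriangle γ τ) (hx' : x' ∈ K.cutTriangle γ τ') (h : K.proj γ x = K.proj γ x')
    (hwx : w ≠ K.proj γ x) (hw : w ∈ τ.1) (hw' : w ∈ τ'.1)
    (hnp : ¬ IsPathEdge γ (K.proj γ x) w) : x = x' := by
  obtain ⟨v, hv, rfl⟩ := mem_cutTriangle.1 hx
  obtain ⟨v', hv', rfl⟩ := mem_cutTriangle.1 hx'
  obtain rfl : v = v' := h
  exact Quot.sound ⟨rfl, w, hwx, hw, hw', hnp⟩

lemma mem_cutTriangle_of_not_isPathEdge {x y : K.CutVertex γ} (hxy : (K.cut γ).graph.Adj x y)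
    (hnp : ¬ IsPathEdge γ (K.proj γ x) (K.proj γ y)) {τ : {t // t ∈ K.triangles}}
    (hx : K.proj γ x ∈ τ.1) (hy : K.proj γ y ∈ τ.1) :
    x ∈ K.cutTriangle γ τ ∧ y ∈ K.cutTriangle γ τ := by
  obtain ⟨hne, τ', hx', hy'⟩ := cut_adj.1 hxy
  have hadj := (proj_adj hxy).ne
  obtain ⟨a, ha, hax⟩ := exists_mem_cutTriangle γ hx
  obtain ⟨b, hb, hby⟩ := exists_mem_cutTriangle γ hy
  rw [eq_of_not_isPathEdge hx' ha hax.symm hadj.symm (proj_mem hy') hy hnp,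
    eq_of_not_isPathEdge hy' hb hby.symm hadj (proj_mem hx') hx
      (fun h => hnp (isPathEdge_comm.1 h))]
  exact ⟨ha, hb⟩

open Classical in
lemma edgeDegree_cut (x y : K.CutVertex γ) : (K.cut γ).edgeDegree x y =
    (K.triangles.attach.filter fun τ => x ∈ K.cutTriangle γ τ ∧ y ∈ K.cutTriangle γ τ).card := by
  rw [edgeDegree]
  symm
  refine Finset.card_bij (fun τ _ => K.cutTriangle γ τ) ?_ ?_ ?_
  · intro τ hτ
    simp only [Finset.mem_filter, Finset.mem_attach, true_and] at hτ ⊢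
    exact ⟨mem_cut_triangles.2 ⟨τ, rfl⟩, hτ⟩
  · exact fun τ _ τ' _ h => cutTriangle_injective h
  · intro s hs
    simp only [Finset.mem_filter] at hs
    obtain ⟨τ, rfl⟩ := mem_cut_triangles.1 hs.1
    exact ⟨τ, by simpa using hs.2, rfl⟩

open Classical in
lemma edgeDegree_eq_attach (v w : V) : K.edgeDegree v w =
    (K.triangles.attach.filter fun τ => v ∈ τ.1 ∧ w ∈ τ.1).card := by
  rw [edgeDegree]
  symm
  refine Finset.card_bij (fun τ _ => τ.1) ?_ ?_ ?_
  · intro τ hτ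
    simp only [Finset.mem_filter, Finset.mem_attach, true_and] at hτ ⊢
    exact ⟨τ.2, hτ⟩
  · exact fun τ _ τ' _ h => Subtype.ext h
  · intro s hs
    simp only [Finset.mem_filter] at hs
    exact ⟨⟨s, hs.1⟩, by simpa using hs.2, rfl⟩

lemma edgeDegree_cut_le (x y : K.CutVertex γ) :
    (K.cut γ).edgeDegree x y ≤ K.edgeDegree (K.proj γ x) (K.proj γ y) := by
  classical
  rw [edgeDegree_cut, edgeDegree_eq_attach]
  refine Finset.card_le_card fun τ hτ => ?_
  simp only [Finset.mem_filter, Finset.mem_attach, true_and] at hτ ⊢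
  exact ⟨proj_mem hτ.1, proj_mem hτ.2⟩

lemma edgeDegree_cut_eq {x y : K.CutVertex γ} (hxy : (K.cut γ).graph.Adj x y)
    (hnp : ¬ IsPathEdge γ (K.proj γ x) (K.proj γ y)) :
    (K.cut γ).edgeDegree x y = K.edgeDegree (K.proj γ x) (K.proj γ y) := by
  classical
  rw [edgeDegree_cut, edgeDegree_eq_attach]
  congr 1
  refine Finset.filter_congr fun τ _ => ⟨fun h => ⟨proj_mem h.1, proj_mem h.2⟩, fun h => ?_⟩
  exact mem_cutTriangle_of_not_isPathEdge hxy hnp h.1 h.2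

lemma boundaryGraph_cut_adj_iff {x y : K.CutVertex γ} (hxy : (K.cut γ).graph.Adj x y)
    (hnp : ¬ IsPathEdge γ (K.proj γ x) (K.proj γ y)) :
    (K.cut γ).boundaryGraph.Adj x y ↔ K.boundaryGraph.Adj (K.proj γ x) (K.proj γ y) := by
  rw [boundaryGraph_adj_iff, boundaryGraph_adj_iff, edgeDegree_cut_eq hxy hnp,
    and_iff_right hxy, and_iff_right (proj_adj hxy)]

/-- The links of the cut surface are connected: corners are identified along edges that are not
cut, and these edges are kept in the cut surface. -/
lemma link_connected_cut (x : K.CutVertex γ) (s : Finset (K.CutVertex γ))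
    (hs : s ∈ (K.cut γ).triangles) (s' : Finset (K.CutVertex γ)) (hs' : s' ∈ (K.cut γ).triangles)
    (hx : x ∈ s) (hx' : x ∈ s') : Relation.ReflTransGen
      (fun a b => a ∈ (K.cut γ).triangles ∧ b ∈ (K.cut γ).triangles ∧ x ∈ a ∧ x ∈ b ∧
        ∃ w, w ≠ x ∧ w ∈ a ∧ w ∈ b) s s' := by
  have key : ∀ p q : K.Corner, Relation.EqvGen (K.CornerRel γ) p q → K.cutMk γ p = x →
      Relation.ReflTransGen
      (fun a b => a ∈ (K.cut γ).triangles ∧ b ∈ (K.cut γ).triangles ∧ x ∈ a ∧ x ∈ b ∧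
        ∃ w, w ≠ x ∧ w ∈ a ∧ w ∈ b) (K.cutTriangle γ ⟨p.1.2, p.2.1⟩)
        (K.cutTriangle γ ⟨q.1.2, q.2.1⟩) := by
    intro p q hpq
    have hmk : ∀ p q : K.Corner, Relation.EqvGen (K.CornerRel γ) p q →
        K.cutMk γ p = K.cutMk γ q := fun p q h => Quot.eqvGen_sound h
    induction hpq with
    | rel p q h =>
      intro hp
      have hq := (hmk p q (.rel _ _ h)).symm.trans hp
      obtain ⟨⟨v, t⟩, ht, hv⟩ := p
      obtain ⟨⟨v', t'⟩, ht', hv'⟩ := q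
      have hr := h
      obtain ⟨h1, w, hwv, hw, hw', hnp⟩ := hr
      simp only at h1 hwv hw hw' hnp
      subst h1
      refine .single ⟨mem_cut_triangles.2 ⟨_, rfl⟩, mem_cut_triangles.2 ⟨_, rfl⟩,
        mem_cutTriangle.2 ⟨v, hv, hp⟩, mem_cutTriangle.2 ⟨v, hv', hq⟩,
        K.cutMk γ ⟨(w, t), ht, hw⟩, ?_, mem_cutTriangle.2 ⟨w, hw, rfl⟩,
        mem_cutTriangle.2 ⟨w, hw', ?_⟩⟩
      · rintro rfl
        exact hwv (congrArg (K.proj γ) hp).symm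
      · exact (Quot.sound ⟨rfl, v, hwv.symm, hv, hv', fun h => hnp (isPathEdge_comm.1 h)⟩ :
          K.cutMk γ ⟨(w, t), ht, hw⟩ = K.cutMk γ ⟨(w, t'), ht', hw'⟩).symm
    | refl p => exact fun _ => .refl
    | symm p q h ih =>
      intro hq
      refine (@Relation.ReflTransGen.stdSymm _ _ ⟨?_⟩).symm _ _ (ih ((hmk p q h).trans hq))
      exact fun a b ⟨h1, h2, h3, h4, w, h5, h6, h7⟩ => ⟨h2, h1, h4, h3, w, h5, h7, h6⟩
    | trans p q r h1 h2 ih1 ih2 =>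
      exact fun hp => (ih1 hp).trans (ih2 ((hmk p q h1).symm.trans hp))
  obtain ⟨τ, rfl⟩ := mem_cut_triangles.1 hs
  obtain ⟨τ', rfl⟩ := mem_cut_triangles.1 hs'
  obtain ⟨v, hv, hp⟩ := mem_cutTriangle.1 hx
  obtain ⟨v', hv', hq⟩ := mem_cutTriangle.1 hx'
  exact key _ _ (Quot.eqvGen_exact (hp.trans hq.symm)) hp

/-! #### The two sides of the slit -/

namespace AreCutSides

variable {base top : Fin (n + 1) → K.CutVertex γ}

lemma symm (hs : K.AreCutSides γ base top) : K.AreCutSides γ top base :=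
  ⟨hs.proj_top, hs.proj_base, hs.adj_top, hs.adj_base, fun i => (hs.ne i).symm⟩

/-- A cut edge lies in two triangles, one at each side of the slit. -/
lemma exists_triangles (hs : K.AreCutSides γ base top) (hK : K.IsConnectedSurface) (i : Fin n) :
    ∃ τ τ', base i.castSucc ∈ K.cutTriangle γ τ ∧ base i.succ ∈ K.cutTriangle γ τ ∧
      top i.castSucc ∈ K.cutTriangle γ τ' ∧ top i.succ ∈ K.cutTriangle γ τ' ∧
      ∀ τ'' : {t // t ∈ K.triangles}, γ i.castSucc ∈ τ''.1 → γ i.succ ∈ τ''.1 →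
        τ'' = τ ∨ τ'' = τ' := by
  classical
  obtain ⟨-, τ, h1, h2⟩ := cut_adj.1 (hs.adj_base i)
  obtain ⟨-, τ', h3, h4⟩ := cut_adj.1 (hs.adj_top i)
  refine ⟨τ, τ', h1, h2, h3, h4, fun τ'' h5 h6 => ?_⟩
  by_contra! hc
  have hne : τ ≠ τ' := by
    rintro rfl
    exact hs.ne _ (eq_of_proj_eq h1 h3 ((hs.proj_base _).trans (hs.proj_top _).symm))
  have hadj : K.graph.Adj (γ i.castSucc) (γ i.succ) := by
    have := proj_adj (hs.adj_base i)
    rwa [hs.proj_base, hs.proj_base] at this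
  have h7 := hK.edge_le_two _ _ hadj
  rw [ncard_trianglesThrough, edgeDegree_eq_attach] at h7
  have h8 : ({τ'', τ, τ'} : Finset {t // t ∈ K.triangles}) ⊆
      K.triangles.attach.filter fun τ => γ i.castSucc ∈ τ.1 ∧ γ i.succ ∈ τ.1 := by
    intro τ₀ hσ
    simp only [Finset.mem_insert, Finset.mem_singleton] at hσ
    simp only [Finset.mem_filter, Finset.mem_attach, true_and]
    have p1 := proj_mem h1
    have p2 := proj_mem h2
    have p3 := proj_mem h3
    have p4 := proj_mem h4
    rw [hs.proj_base] at p1 p2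
    rw [hs.proj_top] at p3 p4
    rcases hσ with rfl | rfl | rfl
    · exact ⟨h5, h6⟩
    · exact ⟨p1, p2⟩
    · exact ⟨p3, p4⟩
  have := (Finset.card_le_card h8).trans h7
  rw [Finset.card_eq_three.2 ⟨τ'', τ, τ', hc.1, hc.2, hne, rfl⟩] at this
  omega

lemma mem_or_mem (hs : K.AreCutSides γ base top) (hK : K.IsConnectedSurface) {i : Fin n}
    {τ : {t // t ∈ K.triangles}} (h1 : γ i.castSucc ∈ τ.1) (h2 : γ i.succ ∈ τ.1) :
    (base i.castSucc ∈ K.cutTriangle γ τ ∧ base i.succ ∈ K.cutTriangle γ τ) ∨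
      (top i.castSucc ∈ K.cutTriangle γ τ ∧ top i.succ ∈ K.cutTriangle γ τ) := by
  obtain ⟨τ₀, τ', a1, a2, a3, a4, h⟩ := hs.exists_triangles hK i
  rcases h τ h1 h2 with rfl | rfl
  · exact .inl ⟨a1, a2⟩
  · exact .inr ⟨a3, a4⟩

lemma boundary_base (hs : K.AreCutSides γ base top) (hK : K.IsConnectedSurface) (i : Fin n) :
    (K.cut γ).boundaryGraph.Adj (base i.castSucc) (base i.succ) := by
  classical
  refine boundaryGraph_adj_iff.2 ⟨hs.adj_base i, ?_⟩
  obtain ⟨τ, τ', h1, h2, h3, h4, h⟩ := hs.exists_triangles hK i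
  rw [edgeDegree_cut, Finset.card_eq_one]
  refine ⟨τ, ?_⟩
  ext τ''
  simp only [Finset.mem_filter, Finset.mem_attach, true_and, Finset.mem_singleton]
  constructor
  · rintro ⟨h5, h6⟩
    have p5 := proj_mem h5
    have p6 := proj_mem h6
    rw [hs.proj_base] at p5 p6
    refine (h τ'' p5 p6).resolve_right ?_
    rintro rfl
    exact hs.ne _ (eq_of_proj_eq h5 h3 ((hs.proj_base _).trans (hs.proj_top _).symm))
  · rintro rfl; exact ⟨h1, h2⟩

/-- The edges of the cut surface over an edge of the slit are its two copies. -/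
lemma isPathEdge_or (hs : K.AreCutSides γ base top) (hK : K.IsConnectedSurface)
    {x y : K.CutVertex γ} (hxy : (K.cut γ).graph.Adj x y)
    (hp : IsPathEdge γ (K.proj γ x) (K.proj γ y)) : IsPathEdge base x y ∨ IsPathEdge top x y := by
  have key : ∀ {x y : K.CutVertex γ}, (K.cut γ).graph.Adj x y → ∀ i : Fin n,
      K.proj γ x = γ i.castSucc → K.proj γ y = γ i.succ →
      (x = base i.castSucc ∧ y = base i.succ) ∨ (x = top i.castSucc ∧ y = top i.succ) := by
    intro x y hxy i h1 h2
    obtain ⟨-, τ, hx, hy⟩ := cut_adj.1 hxy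
    have p1 := proj_mem hx
    have p2 := proj_mem hy
    rw [h1] at p1
    rw [h2] at p2
    refine (hs.mem_or_mem hK p1 p2).imp (fun h => ?_) (fun h => ?_)
    · exact ⟨eq_of_proj_eq hx h.1 (h1.trans (hs.proj_base _).symm),
        eq_of_proj_eq hy h.2 (h2.trans (hs.proj_base _).symm)⟩
    · exact ⟨eq_of_proj_eq hx h.1 (h1.trans (hs.proj_top _).symm),
        eq_of_proj_eq hy h.2 (h2.trans (hs.proj_top _).symm)⟩
  obtain ⟨i, ⟨h1, h2⟩ | ⟨h1, h2⟩⟩ := hp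
  · exact (key hxy i h1 h2).imp (fun h => ⟨i, .inl h⟩) (fun h => ⟨i, .inl h⟩)
  · exact (key hxy.symm i h1 h2).imp (fun h => ⟨i, .inr h⟩) (fun h => ⟨i, .inr h⟩)

/-- The fibre over a vertex of the slit consists of its two copies. -/
lemma eq_or_eq (hs : K.AreCutSides γ base top) (hK : K.IsConnectedSurface)
    (hγ : Function.Injective γ) {i : Fin (n + 1)} {x : K.CutVertex γ} (hx : K.proj γ x = γ i) :
    x = base i ∨ x = top i := by
  obtain ⟨τ, hτ⟩ := exists_cutTriangle (base i)
  obtain ⟨τ', hτ'⟩ := exists_cutTriangle x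
  have hb := proj_mem hτ
  have hx' := proj_mem hτ'
  rw [hs.proj_base] at hb
  rw [hx] at hx'
  have key : ∀ t' : Finset V, Relation.ReflTransGen
      (fun a b => a ∈ K.triangles ∧ b ∈ K.triangles ∧ γ i ∈ a ∧ γ i ∈ b ∧
        ∃ w, w ≠ γ i ∧ w ∈ a ∧ w ∈ b) τ.1 t' → ∀ ht' : t' ∈ K.triangles,
        base i ∈ K.cutTriangle γ ⟨t', ht'⟩ ∨ top i ∈ K.cutTriangle γ ⟨t', ht'⟩ := by
    intro t' h
    induction h with
    | refl => exact fun _ => .inl hτ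
    | @tail a b _ hab ih =>
      obtain ⟨ha, hb', hia, hib, w, hwi, hwa, hwb⟩ := hab
      intro ht'
      by_cases hp : IsPathEdge γ (γ i) w
      · obtain ⟨j, ⟨h1, h2⟩ | ⟨h1, h2⟩⟩ := hp
        · rw [h1] at hib
          rw [h2] at hwb
          rw [hγ h1]
          exact (hs.mem_or_mem hK (τ := ⟨b, ht'⟩) hib hwb).imp And.left And.left
        · rw [h2] at hib
          rw [h1] at hwb
          rw [hγ h2]
          exact (hs.mem_or_mem hK (τ := ⟨b, ht'⟩) hwb hib).imp And.right And.right
      · have step : ∀ z, K.proj γ z = γ i → z ∈ K.cutTriangle γ ⟨a, ha⟩ →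
            z ∈ K.cutTriangle γ ⟨b, ht'⟩ := by
          intro z hz hza
          obtain ⟨y, hy, hyi⟩ := exists_mem_cutTriangle (τ := ⟨b, ht'⟩) γ hib
          rw [eq_of_not_isPathEdge hza hy (hz.trans hyi.symm) (w := w) (by rwa [hz]) hwa hwb
            (by rwa [hz])]
          exact hy
        exact (ih ha).imp (step _ (hs.proj_base i)) (step _ (hs.proj_top i))
  rcases key _ (hK.link_connected _ _ τ.2 _ τ'.2 hb hx') τ'.2 with h | h
  · exact .inl (eq_of_proj_eq hτ' h (hx.trans (hs.proj_base i).symm))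
  · exact .inr (eq_of_proj_eq hτ' h (hx.trans (hs.proj_top i).symm))

lemma mem_range_iff (hs : K.AreCutSides γ base top) (hK : K.IsConnectedSurface)
    (hγ : Function.Injective γ) {x : K.CutVertex γ} :
    x ∈ Set.range base ∪ Set.range top ↔ K.proj γ x ∈ Set.range γ := by
  constructor
  · rintro (⟨i, rfl⟩ | ⟨i, rfl⟩)
    · exact ⟨i, (hs.proj_base i).symm⟩
    · exact ⟨i, (hs.proj_top i).symm⟩
  · rintro ⟨i, hi⟩
    exact (hs.eq_or_eq hK hγ hi.symm).imp (fun h => ⟨i, h.symm⟩) (fun h => ⟨i, h.symm⟩)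

end AreCutSides

lemma not_isPathEdge {v w : V} (hv : v ∉ Set.range γ) : ¬ IsPathEdge γ v w := by
  rintro ⟨i, ⟨rfl, -⟩ | ⟨-, rfl⟩⟩ <;> exact hv ⟨_, rfl⟩

/-- A vertex off the slit is not split. -/
lemma mem_cutTriangle_of_notMem (hK : K.IsConnectedSurface) {x : K.CutVertex γ}
    (hx : K.proj γ x ∉ Set.range γ) {τ : {t // t ∈ K.triangles}} (hxτ : K.proj γ x ∈ τ.1) :
    x ∈ K.cutTriangle γ τ := by
  obtain ⟨τ₀, hσ⟩ := exists_cutTriangle x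
  have key : ∀ t' : Finset V, Relation.ReflTransGen
      (fun a b => a ∈ K.triangles ∧ b ∈ K.triangles ∧ K.proj γ x ∈ a ∧ K.proj γ x ∈ b ∧
        ∃ w, w ≠ K.proj γ x ∧ w ∈ a ∧ w ∈ b) τ₀.1 t' → ∀ ht' : t' ∈ K.triangles,
        x ∈ K.cutTriangle γ ⟨t', ht'⟩ := by
    intro t' h
    induction h with
    | refl => exact fun _ => hσ
    | @tail a b _ hab ih =>
      obtain ⟨ha, hb', hia, hib, w, hwi, hwa, hwb⟩ := hab
      intro ht'
      obtain ⟨y, hy, hyi⟩ := exists_mem_cutTriangle (τ := ⟨b, ht'⟩) γ hib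
      rw [eq_of_not_isPathEdge (ih ha) hy hyi.symm hwi hwa hwb (not_isPathEdge hx)]
      exact hy
  exact key _ (hK.link_connected _ _ τ₀.2 _ τ.2 (proj_mem hσ) hxτ) τ.2

lemma exists_lift_adj (hK : K.IsConnectedSurface) {x : K.CutVertex γ}
    (hx : K.proj γ x ∉ Set.range γ) {w : V} (hw : K.graph.Adj (K.proj γ x) w) :
    ∃ y, (K.cut γ).graph.Adj x y ∧ K.proj γ y = w := by
  obtain ⟨hne, t, ht, hxt, hwt⟩ := hw
  have h1 := mem_cutTriangle_of_notMem hK hx (τ := ⟨t, ht⟩) hxt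
  obtain ⟨y, hy, rfl⟩ := exists_mem_cutTriangle (τ := ⟨t, ht⟩) γ hwt
  exact ⟨y, cut_adj.2 ⟨fun e => hne (by rw [e]), _, h1, hy⟩, rfl⟩

lemma exists_proj_eq (hK : K.IsConnectedSurface) (γ : Fin (n + 1) → V) (v : V) :
    ∃ x : K.CutVertex γ, K.proj γ x = v := by
  obtain ⟨t, ht, hv⟩ := hK.mem_triangle v
  obtain ⟨x, -, hx⟩ := exists_mem_cutTriangle (τ := ⟨t, ht⟩) γ hv
  exact ⟨x, hx⟩

/-- A neighbour of an unsplit vertex is determined by its projection. -/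
lemma eq_of_adj_of_proj_eq {x y z : K.CutVertex γ}
    (hx : K.proj γ x ∉ Set.range γ) (hy : (K.cut γ).graph.Adj x y)
    (hz : (K.cut γ).graph.Adj x z) (h : K.proj γ y = K.proj γ z) : y = z := by
  obtain ⟨-, τ, h1, h2⟩ := cut_adj.1 hy
  refine eq_of_proj_eq h2 ?_ h
  exact (mem_cutTriangle_of_not_isPathEdge hz (not_isPathEdge hx) (proj_mem h1)
    (h ▸ proj_mem h2)).2

lemma laplacian_cut [Fintype V] (hK : K.IsConnectedSurface) {x : K.CutVertex γ}
    (hx : K.proj γ x ∉ Set.range γ) (c : V → V → ℝ) (g : V → ℝ) :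
    (K.cut γ).laplacian (K.cutConductance γ c) (fun y => g (K.proj γ y)) x =
      K.laplacian c g (K.proj γ x) := by
  classical
  unfold laplacian
  refine Finset.sum_bij (fun y _ => K.proj γ y) ?_ ?_ ?_ ?_
  · intro y hy
    simp only [Finset.mem_filter, Finset.mem_univ, true_and] at hy ⊢
    exact proj_adj hy
  · intro y hy z hz h
    simp only [Finset.mem_filter, Finset.mem_univ, true_and] at hy hz
    exact eq_of_adj_of_proj_eq hx hy hz h
  · intro w hw
    simp only [Finset.mem_filter, Finset.mem_univ, true_and] at hw
    obtain ⟨y, hy, rfl⟩ := exists_lift_adj hK hx hw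
    exact ⟨y, by simpa using hy, rfl⟩
  · intro y _
    rfl

end Cut

/-! ### The annulus -/

section Annulus

variable {V : Type*} {K : TriComplex V} {E₁ E₂ : Set V} {c : V → V → ℝ} {k : ℝ} {g : V → ℝ}

/-- A set of vertices that misses some vertex has an edge leaving it. -/
lemma IsConnectedSurface.exists_exit (hK : K.IsConnectedSurface) {S : Set V} {v w : V}
    (hv : v ∈ S) (hw : w ∉ S) : ∃ x ∈ S, ∃ y ∉ S, K.graph.Adj x y := by
  obtain ⟨p⟩ := hK.connected.preconnected v w
  obtain ⟨d, -, h1, h2⟩ := p.exists_boundary_dart S hv hw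
  exact ⟨_, h1, _, h2, d.adj⟩

/-- A surface that has a triangle without inner edges consists of this triangle. -/
lemma IsConnectedSurface.mem_of_boundary (hK : K.IsConnectedSurface) {s : Finset V}
    (hs : s ∈ K.triangles) (hbd : ∀ u ∈ s, ∀ v ∈ s, u ≠ v → K.boundaryGraph.Adj u v) (v : V) :
    v ∈ s := by
  classical
  by_contra hv
  obtain ⟨u, hu⟩ : s.Nonempty := Finset.card_pos.1 (by rw [K.card_eq_three s hs]; norm_num)
  obtain ⟨x, hx, y, hy, hxy⟩ := hK.exists_exit (S := (s : Set V)) hu hv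
  obtain ⟨hne, t, ht, hxt, hyt⟩ := hxy
  have key : ∀ t', Relation.ReflTransGen
      (fun a b => a ∈ K.triangles ∧ b ∈ K.triangles ∧ x ∈ a ∧ x ∈ b ∧ ∃ w, w ≠ x ∧ w ∈ a ∧ w ∈ b)
      s t' → t' = s := by
    intro t' h
    induction h with
    | refl => rfl
    | @tail a b _ hab ih =>
      subst ih
      obtain ⟨-, hb, hxa, hxb, w, hwx, hwa, hwb⟩ := hab
      have h1 := (boundaryGraph_adj_iff.1 (hbd x hxa w hwa hwx.symm)).2
      rw [edgeDegree, Finset.card_eq_one] at h1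
      obtain ⟨r, hr⟩ := h1
      have ha' : a = r := Finset.mem_singleton.1 (hr ▸ by simp [hs, hxa, hwa])
      have hb' : b = r := Finset.mem_singleton.1 (hr ▸ by simp [hb, hxb, hwb])
      rw [ha', hb']
  rw [key t (hK.link_connected x s hs t ht hx hxt)] at hyt
  exact hy hyt

namespace IsAnnulus

/-- Euler's formula for the annulus, in terms of sign changes. -/
lemma card_triangles_le [Fintype V] (hK : K.IsAnnulus E₁ E₂) :
    K.triangles.card ≤ ∑ v, K.expectedCut v := by
  classical
  set N : V → Finset V := fun v => Finset.univ.filter (K.graph.Adj v) with hN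
  set τ : V → ℕ := fun v => (K.triangles.filter (v ∈ ·)).card with hτ
  -- double counting of the flags at `v`, at the edges of `v`, and of all flags
  have h1 : ∀ v, ∑ y ∈ N v, K.edgeDegree v y = 2 * τ v := by
    intro v
    have e := Finset.sum_card_bipartiteAbove_eq_sum_card_bipartiteBelow (fun y t => y ∈ t)
      (s := N v) (t := K.triangles.filter (v ∈ ·))
    have e1 : ∀ y, K.edgeDegree v y =
        (Finset.bipartiteAbove (fun y t => y ∈ t) (K.triangles.filter (v ∈ ·)) y).card := by
      intro y
      rw [edgeDegree, Finset.bipartiteAbove, Finset.filter_filter]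
    have e2 : ∀ t ∈ K.triangles.filter (v ∈ ·),
        (Finset.bipartiteBelow (fun y t => y ∈ t) (N v) t).card = 2 := by
      intro t ht
      rw [Finset.mem_filter] at ht
      have : Finset.bipartiteBelow (fun y t => y ∈ t) (N v) t = t.erase v := by
        ext y
        simp only [Finset.bipartiteBelow, hN, Finset.mem_filter, Finset.mem_univ, true_and,
          Finset.mem_erase]
        exact ⟨fun h => ⟨h.1.ne', h.2⟩, fun h => ⟨adj_of_mem ht.1 ht.2 h.2 h.1.symm, h.2⟩⟩
      rw [this, Finset.card_erase_of_mem ht.2, K.card_eq_three t ht.1]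
    rw [Finset.sum_congr rfl fun y _ => e1 y, e, Finset.sum_congr rfl e2, Finset.sum_const,
      smul_eq_mul, mul_comm]
  -- the number of boundary edges at `v` is even, hence at least two at a boundary vertex
  have h2 : ∀ v, τ v + (2 - K.expectedCut v) ≤ (N v).card := by
    intro v
    have e : ∑ y ∈ N v, (K.edgeDegree v y + if K.boundaryGraph.Adj v y then 1 else 0) =
        2 * (N v).card := by
      rw [mul_comm, ← smul_eq_mul, ← Finset.sum_const]
      refine Finset.sum_congr rfl fun y hy => ?_
      have hadj : K.graph.Adj v y := by simpa [hN] using hy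
      have h3 := hK.surface.edge_le_two v y hadj
      rw [ncard_trianglesThrough] at h3
      have h4 := edgeDegree_pos hadj
      split_ifs with hb
      · rw [(boundaryGraph_adj_iff.1 hb).2]
      · have : K.edgeDegree v y ≠ 1 := fun h => hb (boundaryGraph_adj_iff.2 ⟨hadj, h⟩)
        omega
    rw [Finset.sum_add_distrib, h1, ← Finset.card_filter] at e
    rw [expectedCut]
    split_ifs with hb
    · obtain ⟨y, hy⟩ := hb
      have : 0 < ((N v).filter fun y => K.boundaryGraph.Adj v y).card :=
        Finset.card_pos.2 ⟨y, by simpa [hN] using ⟨hy.1, hy⟩⟩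
      omega
    · omega
  have h3 : ∑ v, τ v = 3 * K.triangles.card := by
    have e := Finset.sum_card_bipartiteAbove_eq_sum_card_bipartiteBelow (fun (y : V) t => y ∈ t)
      (s := Finset.univ) (t := K.triangles)
    have e2 : ∀ t ∈ K.triangles,
        (Finset.bipartiteBelow (fun (y : V) t => y ∈ t) Finset.univ t).card = 3 := by
      intro t ht
      rw [← K.card_eq_three t ht]
      congr 1
      ext y
      simp [Finset.bipartiteBelow]
    rw [Finset.sum_congr rfl e2, Finset.sum_const, smul_eq_mul, mul_comm] at e
    exact e
  have h4 : ∑ v, (N v).card = 2 * K.graph.edgeSet.ncard := by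
    rw [Set.ncard_eq_toFinset_card', ← SimpleGraph.edgeFinset,
      ← SimpleGraph.sum_degrees_eq_twice_card_edges]
    refine Finset.sum_congr rfl fun v _ => ?_
    rw [← SimpleGraph.card_neighborFinset_eq_degree, SimpleGraph.neighborFinset_eq_filter]
  have h5 := hK.euler
  rw [Nat.card_eq_fintype_card] at h5
  have h6 := Finset.sum_le_sum fun v (_ : v ∈ Finset.univ) => h2 v
  rw [Finset.sum_add_distrib, h3, h4] at h6
  have h7 : ∑ v, (2 - K.expectedCut v) + ∑ v, K.expectedCut v = 2 * Fintype.card V := by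
    rw [← Finset.sum_add_distrib, ← Finset.card_univ, mul_comm, ← smul_eq_mul, ← Finset.sum_const]
    refine Finset.sum_congr rfl fun v _ => Nat.sub_add_cancel ?_
    rw [expectedCut]; split_ifs <;> omega
  omega

lemma boundaryGraph_mem (hK : K.IsAnnulus E₁ E₂) {u v : V} (h : K.boundaryGraph.Adj u v) :
    (u ∈ E₁ ∧ v ∈ E₁) ∨ (u ∈ E₂ ∧ v ∈ E₂) := by
  rcases (hK.boundary u).1 ⟨v, h⟩ with hu | hu
  · exact .inl ⟨hu, (hK.component₁ u hu v).1 h.reachable⟩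
  · exact .inr ⟨hu, (hK.component₂ u hu v).1 h.reachable⟩

lemma exists_adj (hK : K.IsAnnulus E₁ E₂) (v : V) : ∃ w, K.graph.Adj v w := by
  obtain ⟨t, ht, hv⟩ := hK.surface.mem_triangle v
  obtain ⟨w, hw, hne⟩ := Finset.exists_mem_ne (s := t) (by rw [K.card_eq_three t ht]; norm_num) v
  exact ⟨w, adj_of_mem ht hv hw hne.symm⟩

/-- A vertex of a boundary circle has a neighbour off this circle. -/
lemma exists_adj_notMem {E E' : Set V} (hK : K.IsConnectedSurface) (hE : E'.Nonempty)
    (hd : Disjoint E E') {a : ℝ} (hgE : ∀ v ∈ E, g v = a)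
    (hne : ∀ u v, K.graph.Adj u v → g u = g v → K.boundaryGraph.Adj u v) {v : V} (hv : v ∈ E) :
    ∃ w, K.graph.Adj v w ∧ w ∉ E := by
  by_contra! hc
  obtain ⟨s, hs, hvs⟩ := hK.mem_triangle v
  have hsE : ∀ u ∈ s, u ∈ E := fun u hu => by
    by_cases huv : u = v
    · rwa [huv]
    · exact hc u (adj_of_mem hs hvs hu (Ne.symm huv))
  obtain ⟨w, hw⟩ := hE
  refine Set.disjoint_left.1 hd (hsE w (hK.mem_of_boundary hs (fun x hx y hy hxy => ?_) w)) hw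
  exact hne x y (adj_of_mem hs hx hy hxy) ((hgE x (hsE x hx)).trans (hgE y (hsE y hy)).symm)

/-- On a connected component of a graph, the distance from a vertex decreases along some edge. -/
lemma exists_dist_lt {G : SimpleGraph V} {u v : V} (h : G.Reachable u v) (hne : u ≠ v) :
    ∃ w, G.Adj u w ∧ G.dist w v < G.dist u v := by
  obtain ⟨p, hp⟩ := h.exists_walk_length_eq_dist
  cases p with
  | nil => exact absurd rfl hne
  | cons hadj q =>
    refine ⟨_, hadj, ?_⟩
    rw [← hp, SimpleGraph.Walk.length_cons]
    exact Nat.lt_succ_of_le (SimpleGraph.dist_le q)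

variable [Fintype V]

lemma mixed (hK : K.IsAnnulus E₁ E₂) (hc : K.IsConductance c)
    (hg : K.IsDirichletSolution c E₁ E₂ k g)
    (hne : ∀ u v, K.graph.Adj u v → g u = g v → K.boundaryGraph.Adj u v) {v : V} (h1 : v ∉ E₁)
    (h2 : v ∉ E₂) : K.Mixed g v := by
  refine (eq_or_mixed_of_laplacian (fun x y h => (hc x y h).2) (hg.harmonic v h1 h2)).resolve_left
    fun h => ?_
  obtain ⟨w, hw⟩ := hK.exists_adj v
  rcases hK.boundaryGraph_mem (hne v w hw (h w hw).symm) with h | h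
  · exact h1 h.1
  · exact h2 h.1

/-- The maximum principle. -/
lemma le_and_nonneg (hk : 0 < k) (hg : K.IsDirichletSolution c E₁ E₂ k g)
    (hm : ∀ v, v ∉ E₁ → v ∉ E₂ → K.Mixed g v) (v : V) : g v ≤ k ∧ 0 ≤ g v := by
  constructor
  · obtain ⟨w, -, hw⟩ := Finset.exists_max_image Finset.univ g ⟨v, Finset.mem_univ v⟩
    refine (hw v (Finset.mem_univ v)).trans ?_
    by_cases h1 : w ∈ E₁
    · exact (hg.eq_on₁ w h1).le
    by_cases h2 : w ∈ E₂
    · exact (hg.eq_on₂ w h2).trans_le hk.le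
    · obtain ⟨-, y, -, hy⟩ := hm w h1 h2
      exact absurd (hw y (Finset.mem_univ y)) hy.not_ge
  · obtain ⟨w, -, hw⟩ := Finset.exists_min_image Finset.univ g ⟨v, Finset.mem_univ v⟩
    refine le_trans ?_ (hw v (Finset.mem_univ v))
    by_cases h1 : w ∈ E₁
    · exact hk.le.trans (hg.eq_on₁ w h1).ge
    by_cases h2 : w ∈ E₂
    · exact (hg.eq_on₂ w h2).ge
    · obtain ⟨⟨y, -, hy⟩, -⟩ := hm w h1 h2
      exact absurd (hw y (Finset.mem_univ y)) hy.not_ge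

lemma eq_k_iff (hk : 0 < k) (hg : K.IsDirichletSolution c E₁ E₂ k g)
    (hm : ∀ v, v ∉ E₁ → v ∉ E₂ → K.Mixed g v) (v : V) : g v = k ↔ v ∈ E₁ := by
  refine ⟨fun h => by_contra fun h1 => ?_, hg.eq_on₁ v⟩
  by_cases h2 : v ∈ E₂
  · exact hk.ne ((hg.eq_on₂ v h2).symm.trans h)
  · obtain ⟨-, y, -, hy⟩ := hm v h1 h2
    exact (h ▸ hy).not_ge (le_and_nonneg hk hg hm y).1

lemma eq_zero_iff (hk : 0 < k) (hg : K.IsDirichletSolution c E₁ E₂ k g)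
    (hm : ∀ v, v ∉ E₁ → v ∉ E₂ → K.Mixed g v) (v : V) : g v = 0 ↔ v ∈ E₂ := by
  refine ⟨fun h => by_contra fun h2 => ?_, hg.eq_on₂ v⟩
  by_cases h1 : v ∈ E₁
  · exact hk.ne (h.symm.trans (hg.eq_on₁ v h1))
  · obtain ⟨⟨y, -, hy⟩, -⟩ := hm v h1 h2
    exact (h ▸ hy).not_ge (le_and_nonneg hk hg hm y).2

lemma period_pos (hk : 0 < k) (hc : K.IsConductance c) (hg : K.IsDirichletSolution c E₁ E₂ k g)
    (hm : ∀ v, v ∉ E₁ → v ∉ E₂ → K.Mixed g v) {u w : V} (hu : u ∈ E₁) (hw : w ∉ E₁)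
    (huw : K.graph.Adj u w) : 0 < K.period c E₁ g := by
  classical
  have hterm : ∀ v ∈ E₁, ∀ y, K.graph.Adj v y → 0 ≤ c v y * (g v - g y) := fun v hv y hvy =>
    mul_nonneg (hc v y hvy).2.le (by
      rw [hg.eq_on₁ v hv]; exact sub_nonneg.2 (le_and_nonneg hk hg hm y).1)
  unfold period normalDeriv
  refine Finset.sum_pos' (fun v hv => Finset.sum_nonneg fun y hy => ?_)
    ⟨u, by simpa using hu, Finset.sum_pos' (fun y hy => ?_) ⟨w, by simpa using ⟨huw, hw⟩, ?_⟩⟩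
  · simp only [Finset.mem_filter, Finset.mem_univ, true_and] at hv hy
    exact hterm v hv y hy.1
  · simp only [Finset.mem_filter, Finset.mem_univ, true_and] at hy
    exact hterm u hu y hy.1
  · refine mul_pos (hc u w huw).2 (sub_pos.2 ?_)
    rw [hg.eq_on₁ u hu]
    exact (le_and_nonneg hk hg hm w).1.lt_of_ne fun e => hw ((eq_k_iff hk hg hm w).1 e)

variable {n : ℕ} {γ : Fin (n + 1) → V} {base top : Fin (n + 1) → K.CutVertex γ}

/-- Cutting splits two boundary vertices in two, which raises the Euler characteristic by one. -/
lemma card_add_two_le (hK : K.IsAnnulus E₁ E₂)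
    (h0 : γ 0 ∈ E₁) (hl : γ (Fin.last n) ∈ E₂) (hs : K.AreCutSides γ base top) :
    (K.cut γ).triangles.card + 2 ≤ ∑ x, (K.cut γ).expectedCut x := by
  classical
  rw [card_cut_triangles]
  have h0l : γ 0 ≠ γ (Fin.last n) := fun e => Set.disjoint_left.1 hK.disjoint h0 (e ▸ hl)
  have hfib : ∀ v, K.expectedCut v + ((if v = γ 0 then 1 else 0) + if v = γ
    (Fin.last n) then 1 else 0) ≤
      ∑ x with K.proj γ x = v, (K.cut γ).expectedCut x := by
    intro v
    have hone : ∀ x, 1 ≤ (K.cut γ).expectedCut x := fun x => by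
      rw [expectedCut]; split_ifs <;> omega
    have hbv : ∀ v ∈ E₁ ∪ E₂, K.expectedCut v = 1 := fun v hv => by
      rw [expectedCut, if_pos (show K.IsBoundaryVertex v from (hK.boundary v).2 hv)]
    by_cases hv : v ∈ Set.range γ
    · obtain ⟨i, rfl⟩ := hv
      have hsub : ({base i, top i} : Finset (K.CutVertex γ)) ⊆
          Finset.univ.filter fun x => K.proj γ x = γ i := by
        intro x hx
        simp only [Finset.mem_insert, Finset.mem_singleton] at hx
        rw [Finset.mem_filter]
        rcases hx with rfl | rfl
        · exact ⟨Finset.mem_univ _, hs.proj_base i⟩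
        · exact ⟨Finset.mem_univ _, hs.proj_top i⟩
      have h2 := Finset.sum_le_sum_of_subset (f := (K.cut γ).expectedCut) hsub
      rw [Finset.sum_pair (hs.ne i)] at h2
      have hb := hone (base i)
      have ht := hone (top i)
      have hle : K.expectedCut (γ i) ≤ 2 := by rw [expectedCut]; split_ifs <;> omega
      by_cases hi0 : γ i = γ 0
      · rw [if_pos hi0, if_neg (fun e => h0l (hi0.symm.trans e)), hbv _ (.inl (hi0 ▸ h0))]
        omega
      · by_cases hil : γ i = γ (Fin.last n)
        · rw [if_neg hi0, if_pos hil, hbv _ (.inr (hil ▸ hl))]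
          omega
        · rw [if_neg hi0, if_neg hil]; omega
    · rw [if_neg (fun e => hv ⟨_, e.symm⟩), if_neg (fun e => hv ⟨_, e.symm⟩), add_zero, add_zero]
      obtain ⟨x, hx⟩ := exists_proj_eq hK.surface γ v
      refine le_trans ?_ (Finset.single_le_sum (fun _ _ => Nat.zero_le _)
        (Finset.mem_filter.2 ⟨Finset.mem_univ x, hx⟩))
      have : (K.cut γ).IsBoundaryVertex x → K.IsBoundaryVertex v := by
        rintro ⟨y, hy⟩
        rw [boundaryGraph_cut_adj_iff hy.1 (not_isPathEdge (hx ▸ hv))] at hy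
        exact ⟨_, hx ▸ hy⟩
      unfold expectedCut
      split_ifs with a1 a2
      · exact le_rfl
      · omega
      · exact absurd (this ‹_›) a1
      · exact le_rfl
  have h1 := Finset.sum_le_sum fun v (_ : v ∈ Finset.univ) => hfib v
  have hfw : ∑ v, ∑ x with K.proj γ x = v, (K.cut γ).expectedCut x =
      ∑ x, (K.cut γ).expectedCut x := Finset.sum_fiberwise Finset.univ (K.proj γ) _
  rw [hfw, Finset.sum_add_distrib, Finset.sum_add_distrib] at h1
  simp only [Finset.sum_ite_eq', Finset.mem_univ, if_true] at h1
  have := hK.card_triangles_le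
  omega

/-- The annulus cut open along a slit is a rectangle, graded by the solution of the Dirichlet
problem. -/
lemma isGradedRectangle_cut (hK : K.IsAnnulus E₁ E₂) (hc : K.IsConductance c) (hk : 0 < k)
    (hg : K.IsDirichletSolution c E₁ E₂ k g)
    (hne : ∀ u v, K.graph.Adj u v → g u = g v → K.boundaryGraph.Adj u v)
    (hγ : K.IsSlit E₁ E₂ g γ) (hs : K.AreCutSides γ base top) :
    (K.cut γ).IsGradedRectangle (K.cutConductance γ c) (K.proj γ ⁻¹' E₁) (K.proj γ ⁻¹' E₂)
      base top (fun x => g (K.proj γ x)) k := by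
  classical
  have hm : ∀ v, v ∉ E₁ → v ∉ E₂ → K.Mixed g v := fun v => hK.mixed hc hg hne
  have hinj : Function.Injective γ := fun i j h => hγ.decreasing.injective (congrArg g h)
  have hS := hK.surface
  have hpath : ∀ u v, IsPathEdge γ u v → g u ≠ g v := by
    rintro u v ⟨i, ⟨rfl, rfl⟩ | ⟨rfl, rfl⟩⟩ h
    · exact (hγ.decreasing (Fin.castSucc_lt_succ (i := i))).ne' h
    · exact (hγ.decreasing (Fin.castSucc_lt_succ (i := i))).ne h
  have hoff : ∀ {x}, x ∉ Set.range base ∪ Set.range top → K.proj γ x ∉ Set.range γ := fun hx h =>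
    hx ((hs.mem_range_iff hS hinj).2 h)
  have hlift : ∀ {x}, x ∉ Set.range base ∪ Set.range top → ∀ {w}, K.graph.Adj (K.proj γ x) w →
      ∃ y, (K.cut γ).graph.Adj x y ∧ K.proj γ y = w := fun hx _ hw =>
    exists_lift_adj hS (hoff hx) hw
  refine
    { disk := ⟨?_, link_connected_cut, hK.card_add_two_le hγ.start_mem hγ.end_mem hs⟩
      k_pos := hk
      conductance_pos := fun x y h => (hc _ _ (proj_adj h)).2
      nonneg := fun x => (le_and_nonneg hk hg hm _).2
      le := fun x => (le_and_nonneg hk hg hm _).1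
      eq_k := fun x => eq_k_iff hk hg hm _
      eq_zero := fun x => eq_zero_iff hk hg hm _
      b_zero := ?_
      b_last := ?_
      t_zero := ?_
      t_last := ?_
      b_anti := ?_
      t_anti := ?_
      b_ne_t := ?_
      not_adj := ?_
      boundary_cases := ?_
      b_edge := hs.boundary_base hS
      t_edge := hs.symm.boundary_base hS
      harmonic := ?_
      mixed := ?_
      boundary_of_eq := ?_
      exists_exit := ?_
      exists_adj_lt := ?_
      exists_adj_gt := ?_
      exists_potential := ?_ }
  · intro x y hxy
    have := hS.edge_le_two _ _ (proj_adj hxy)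
    rw [ncard_trianglesThrough] at this
    exact (edgeDegree_cut_le x y).trans this
  · rw [Set.mem_preimage, hs.proj_base]; exact hγ.start_mem
  · rw [Set.mem_preimage, hs.proj_base]; exact hγ.end_mem
  · rw [Set.mem_preimage, hs.proj_top]; exact hγ.start_mem
  · rw [Set.mem_preimage, hs.proj_top]; exact hγ.end_mem
  · simpa only [hs.proj_base] using hγ.decreasing
  · simpa only [hs.proj_top] using hγ.decreasing
  · intro i j h
    have h1 := congrArg (K.proj γ) h
    rw [hs.proj_base, hs.proj_top] at h1
    obtain rfl := hinj h1
    exact hs.ne i h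
  · intro i h
    have := proj_adj h
    rw [hs.proj_base, hs.proj_top] at this
    exact this.ne rfl
  · intro x y hxy
    by_cases hp : IsPathEdge γ (K.proj γ x) (K.proj γ y)
    · exact (hs.isPathEdge_or hS hxy.1 hp).imp_right .inl
    · exact .inr (.inr (hK.boundaryGraph_mem ((boundaryGraph_cut_adj_iff hxy.1 hp).1 hxy)))
  · intro x hx h1 h2
    rw [laplacian_cut hS (hoff hx)]
    exact hg.harmonic _ h1 h2
  · intro x hx h1 h2
    obtain ⟨⟨v, hv, hv'⟩, w, hw, hw'⟩ := hm _ h1 h2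
    obtain ⟨y, hy, rfl⟩ := hlift hx hv
    obtain ⟨z, hz, rfl⟩ := hlift hx hw
    exact ⟨⟨y, hy, hv'⟩, z, hz, hw'⟩
  · intro x y hxy he
    exact (boundaryGraph_cut_adj_iff hxy fun h => hpath _ _ h he).2 (hne _ _ (proj_adj hxy) he)
  · rintro S ⟨x, hx⟩ hd
    obtain ⟨v, ⟨y, hy, rfl⟩, w, hw, hvw⟩ := hS.exists_exit (S := K.proj γ '' S) (w := γ 0)
      ⟨x, hx, rfl⟩ (by
        rintro ⟨y, hy, h⟩
        exact hoff (Set.disjoint_left.1 hd hy) ⟨0, h.symm⟩)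
    obtain ⟨z, hz, rfl⟩ := hlift (Set.disjoint_left.1 hd hy) hvw
    exact ⟨y, hy, z, fun h => hw ⟨z, h, rfl⟩, hz⟩
  · intro x hx hxR
    obtain ⟨w, hw, hwE⟩ := exists_adj_notMem hS hK.nonempty₂ hK.disjoint hg.eq_on₁ hne hx
    obtain ⟨y, hy, rfl⟩ := hlift hxR hw
    refine ⟨y, hy, ?_⟩
    rw [hg.eq_on₁ _ hx]
    exact (le_and_nonneg hk hg hm _).1.lt_of_ne fun e => hwE ((eq_k_iff hk hg hm _).1 e)
  · intro x hx hxR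
    obtain ⟨w, hw, hwE⟩ := exists_adj_notMem hS hK.nonempty₁ hK.disjoint.symm hg.eq_on₂ hne hx
    obtain ⟨y, hy, rfl⟩ := hlift hxR hw
    refine ⟨y, hy, ?_⟩
    rw [hg.eq_on₂ _ hx]
    exact (le_and_nonneg hk hg hm _).2.lt_of_ne' fun e => hwE ((eq_zero_iff hk hg hm _).1 e)
  -- the distance from the slit along the two boundary circles
  · refine ⟨fun x => if K.proj γ x ∈ E₁ then - (K.boundaryGraph.dist (K.proj γ x) (γ 0) : ℝ) else
      K.boundaryGraph.dist (K.proj γ x) (γ (Fin.last n)), ?_, ?_⟩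
    · intro x hx hxR
      obtain ⟨w, hw, hlt⟩ := exists_dist_lt ((hK.component₁ _ hx _).2 hγ.start_mem)
        (fun e => hoff hxR ⟨0, e.symm⟩)
      have hwE : w ∈ E₁ := (hK.component₁ _ hx w).1 hw.reachable
      obtain ⟨y, hy, rfl⟩ := hlift hxR hw.1
      refine ⟨y, hwE, hy, ?_⟩
      simp only [if_pos hwE, if_pos (show K.proj γ x ∈ E₁ from hx)]
      exact neg_lt_neg (Nat.cast_lt.2 hlt)
    · intro x hx hxR
      obtain ⟨w, hw, hlt⟩ := exists_dist_lt ((hK.component₂ _ hx _).2 hγ.end_mem)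
        (fun e => hoff hxR ⟨Fin.last n, e.symm⟩)
      have hwE : w ∈ E₂ := (hK.component₂ _ hx w).1 hw.reachable
      obtain ⟨y, hy, rfl⟩ := hlift hxR hw.1
      refine ⟨y, hwE, hy, ?_⟩
      simp only [if_neg (Set.disjoint_right.1 hK.disjoint hwE),
        if_neg (Set.disjoint_right.1 hK.disjoint (show K.proj γ x ∈ E₂ from hx))]
      exact Nat.cast_lt.2 hlt

end IsAnnulus

end Annulus

end TriComplex

end

theorem theorem1p1 {V : Type*} [Fintype V] (K : TriComplex V) (E₁ E₂ : Set V)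
    (hK : K.IsAnnulus E₁ E₂) (c : V → V → ℝ) (hc : K.IsConductance c) (k : ℝ) (hk : 0 < k)
    (g : V → ℝ) (hg : K.IsDirichletSolution c E₁ E₂ k g)
    (hne : ∀ u v, K.graph.Adj u v → g u = g v → K.boundaryGraph.Adj u v)
    {n : ℕ} (γ : Fin (n + 1) → V) (hγ : K.IsSlit E₁ E₂ g γ)
    (base top : Fin (n + 1) → K.CutVertex γ) (hsides : K.AreCutSides γ base top)
    (h : K.CutVertex γ → ℝ)
    (hh :
      -- normal derivative relative to the vertices off the boundary component in question
      (K.IsHarmonicConjugate γ c E₁ E₂ g base top (K.proj γ ⁻¹' E₁)ᶜ (K.proj γ ⁻¹' E₂)ᶜ h ∧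
        ∀ t ∈ (K.cut γ).triangles, ∃ x ∈ t, ∃ y ∈ t, h x ≠ h y) ∨
      -- normal derivative relative to all vertices of the cut surface
      (K.IsHarmonicConjugate γ c E₁ E₂ g base top Set.univ Set.univ h ∧
        (K.cut γ).IsChordless base ∧ (K.cut γ).IsChordless top)) :
    (K.cut γ).IsCombinatoriallyOrthogonalFilling (fun x => g (K.proj γ x)) h ∧
      (K.cut γ).InducesRectangularNets (fun x => g (K.proj γ x)) h := by
  have hR := hK.isGradedRectangle_cut hc hk hg hne hγ hsides
  have hP : 0 < K.period c E₁ g := by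
    obtain ⟨w, hw, hwE⟩ := TriComplex.IsAnnulus.exists_adj_notMem hK.surface hK.nonempty₂
      hK.disjoint hg.eq_on₁ hne hγ.start_mem
    exact TriComplex.IsAnnulus.period_pos hk hc hg (fun v => hK.mixed hc hg hne) hγ.start_mem hwE hw
  have hF : (K.cut γ).IsFoldFree (fun x => g (K.proj γ x)) h k (K.period c E₁ g) := by
    rcases hh with ⟨hh, hT⟩ | ⟨hh, hcb, hct⟩
    · exact hR.isFoldFree (hR.isStrictHeight_of_compl hP hh hT) fun x hx h1 h2 =>
        hh.harmonic x (by simp_all)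
    · exact hR.isFoldFree (hR.isStrictHeight_of_univ hP hh hcb hct) fun x hx h1 h2 =>
        hh.harmonic x (by simp_all)
  exact ⟨hF.isCombinatoriallyOrthogonalFilling, hF.inducesRectangularNets⟩
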